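/- \textbf{Setting.} A \emph{quantum decoration graph} $G_*$ is a connected finite metric graph (loops and multiple edges allowed, each edge $e$ identified with $(0,\ell_e)$, $\ell_e>0$) with two distinct connecting vertices $o_0,o_1$ and a real number $q$ (strength of the vertex potential at $o_1$). For $f$ on $G_*$ let $f'(v)$ be the sum of the inward derivatives of $f$ at $v$ over all edge ends at $v$, and put $$f^\dagger(o_0)=-f'(o_0),\qquad f^\dagger(o_1)=f'(o_1)+q\,f(o_1).$$ Let $\mathsf H^2(G_*)$ be the space of functions that are in $\mathsf H^2$ of each edge, continuous at all vertices, with $f'(v)=0$ at all inner vertices $v\ne o_0,o_1$. Let $(G_n)_{n\ge1}$ be a sequence of quantum decoration graphs with strengths $q_n$ and let $(b_n)_{n\ge0}$ be integers $b_n\ge1$ with $b_0=1$. Let $T$ be a rooted tree with root $o$, edges directed away from $o$, in which every vertex of generation $n$ has exactly $b_n$ succeeding edges; the generation of an edge is that of its end vertex. The \emph{radial tree-like quantum graph} $G$ arises from $T$ by replacing each edge $t$ of generation $n$ by a copy $G_*(t)$ of $G_n$, with $\partial_-t=o_0$, $\partial_+t=o_1$. Its Hamiltonian $H_G$ acts in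 $L^2(G)=\bigoplus_{t}L^2(G_*(t))$ by $(H_Gf)_e=-f_e''$ on all $f$ with $f,f''\in L^2(G)$, $f_t=f|_{G_*(t)}\in\mathsf H^2(G_*(t))$ for all $t$, $f(o)=0$, and, at the end vertex $v=\partial_+t$ of every tree edge $t$, $$f_s(v)=f_t(v)\ \text{ for all tree edges } s \text{ with } \partial_-s=v,\qquad \sum_{s:\ \partial_-s=v} f_s^\dagger(v)=f_t^\dagger(v).$$ The line-like graph $L_n$ ($n\ge0$) is the concatenation of $G_k$, $k>n$, where the vertex $k_-:=o_1$ of $G_k$ is joined to $k_+:=o_0$ of $G_{k+1}$. Its Dirichlet Hamiltonian $H_{L_n}$ acts in $L^2(L_n)=\bigoplus_{k>n}L^2(G_k)$ by $f\mapsto-f''$ on all $f$ with $f,f''\in L^2(L_n)$, $f|_{G_k}\in \mathsf H^2(G_k)$ for $k>n$, $f(n_+)=0$, and $$f(k_-)=b_k^{-1/2}f(k_+),\qquad f^\dagger(k_-)=b_k^{1/2}f^\dagger(k_+)\qquad(k>n).$$ Put $H_n:=H_{L_{n-1}}$ for $n\ge1$. The sequence $(G_n)$ is \emph{uniform} with constants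 $\ell_\pm>0$, $0<\kappa\le1$, $q_\pm\in\mathbb R$ if for all $n\ge1$: the metric distance of $o_0$ and $o_1$ in $G_n$ is at least $\ell_-$; every edge of $G_n$ at $o_0$ has length at least $\kappa\ell_-$; $\deg o_0=1$ in $G_n$; the total length of $G_n$ is at most $\ell_+$; and $q_-\le q_n\le q_+$. \textbf{Theorem.} \begin{enumerate} \item $H_G$ is unitarily equivalent to $$H_1\oplus\bigoplus_{n\ge2}\bigl(\oplus\, b_0\cdots b_{n-2}(b_{n-1}-1)\bigr)H_n ,$$ where $(\oplus\, m)H_n$ denotes the $m$-fold orthogonal sum of copies of $H_n$ and $\bigoplus$ is the Hilbert space direct sum. \item If $(G_n)$ is uniform, then $H_G$ and all $H_n$, $n\ge1$, are self-adjoint on the domains given above. \item If $(G_n)$ is uniform, then the spectral measures of each $H_n$ are supported by polynomially bounded generalized eigenfunctions: there are constants $C(\lambda)$, depending only on $\lambda$ and on $\ell_\pm,\kappa,q_\pm$, such that for every $n\ge1$ and every $f\in L^2(L_{n-1})$, for almost all $\lambda$ with respect to the spectral measure of $f$ for $H_n$ there is a function $\phi$ on $L_{n-1}$ which is in $\mathsf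 H^2(G_k)$ for all $k\ge n$, satisfies $-\phi''=\lambda\phi$ on each edge and all vertex conditions of $H_n$ (including the Dirichlet condition at the starting vertex), is normalized by $\sum_{k\ge n}k^{-2}\|\phi\|^2_{L^2(G_k)}=1$, and satisfies $$|\phi(k_+)|\le C(\lambda)\,k,\qquad |\phi^\dagger(k_+)|\le C(\lambda)\,k\qquad\text{for all } k\ge\max(n-1,1).$$ \end{enumerate} -/

import Mathlib

open MeasureTheory Set
open scoped ENNReal ComplexInnerProductSpace

noncomputable section

/-! ### Functions on one edge -/

/-- Lebesgue measure on the open interval `(0, ℓ)`. -/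
abbrev edgeMeasure (ℓ : ℝ) : Measure ℝ := volume.restrict (Ioo 0 ℓ)

/-- `L²(e)` for an edge `e` of length `ℓ`, identified with the interval `(0, ℓ)`. -/
abbrev EdgeL2 (ℓ : ℝ) : Type := Lp ℂ 2 (edgeMeasure ℓ)

/-- The class `f ∈ L²(0, ℓ)` belongs to the Sobolev space `H²(0, ℓ)`: it has the absolutely
continuous representative `u` on `[0, ℓ]`, whose derivative `u'` is absolutely continuous with
derivative `w ∈ L²(0, ℓ)`. So `w` is `f''`, the boundary values of `f` are `u 0`, `u ℓ`, and
those of `f'` are `u' 0`, `u' ℓ`. -/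
structure IsEdgeH2 (ℓ : ℝ) (f w : EdgeL2 ℓ) (u u' : ℝ → ℂ) : Prop where
  ae_eq : f =ᵐ[edgeMeasure ℓ] u
  fst : ∀ x ∈ Icc 0 ℓ, u x = u 0 + ∫ s in (0 : ℝ)..x, u' s
  snd : ∀ x ∈ Icc 0 ℓ, u' x = u' 0 + ∫ s in (0 : ℝ)..x, w s

theorem EdgeL2.intervalIntegrable {ℓ : ℝ} (w : EdgeL2 ℓ) {x : ℝ} (hx : x ∈ Icc 0 ℓ) :
    IntervalIntegrable w volume 0 x := by
  have h1 : Integrable w (edgeMeasure ℓ) := (Lp.memLp w).integrable (by norm_num)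
  rw [intervalIntegrable_iff_integrableOn_Ioo_of_le hx.1]
  exact IntegrableOn.mono_set (t := Ioo 0 ℓ) h1 (Ioo_subset_Ioo_right hx.2)

theorem IsEdgeH2.continuousOn_deriv {ℓ : ℝ} {f w : EdgeL2 ℓ} {u u' : ℝ → ℂ}
    (h : IsEdgeH2 ℓ f w u u') (hℓ : 0 ≤ ℓ) : ContinuousOn u' (Icc 0 ℓ) := by
  have h0 : IntegrableOn (w : ℝ → ℂ) (uIcc 0 ℓ) volume :=
    (intervalIntegrable_iff' ).1 (w.intervalIntegrable ⟨hℓ, le_rfl⟩)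
  have h1 := intervalIntegral.continuousOn_primitive_interval h0
  rw [uIcc_of_le hℓ] at h1
  exact (continuousOn_const.add h1).congr h.snd

theorem IsEdgeH2.intervalIntegrable {ℓ : ℝ} {f w : EdgeL2 ℓ} {u u' : ℝ → ℂ}
    (h : IsEdgeH2 ℓ f w u u') {x : ℝ} (hx : x ∈ Icc 0 ℓ) :
    IntervalIntegrable u' volume 0 x := by
  have h1 := (h.continuousOn_deriv (hx.1.trans hx.2)).mono (Icc_subset_Icc_right hx.2)
  rw [← uIcc_of_le hx.1] at h1
  exact h1.intervalIntegrable

theorem IsEdgeH2.continuousOn {ℓ : ℝ} {f w : EdgeL2 ℓ} {u u' : ℝ → ℂ}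
    (h : IsEdgeH2 ℓ f w u u') (hℓ : 0 ≤ ℓ) : ContinuousOn u (Icc 0 ℓ) := by
  have h0 : IntegrableOn u' (uIcc 0 ℓ) volume :=
    (intervalIntegrable_iff' ).1 (h.intervalIntegrable ⟨hℓ, le_rfl⟩)
  have h1 := intervalIntegral.continuousOn_primitive_interval h0
  rw [uIcc_of_le hℓ] at h1
  exact (continuousOn_const.add h1).congr h.fst

theorem EdgeL2.integral_congr {ℓ : ℝ} {v : EdgeL2 ℓ} {g : ℝ → ℂ}
    (h : v =ᵐ[edgeMeasure ℓ] g) {x : ℝ} (hx : x ∈ Icc 0 ℓ) :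
    ∫ s in (0 : ℝ)..x, v s = ∫ s in (0 : ℝ)..x, g s := by
  rw [intervalIntegral.integral_of_le hx.1, intervalIntegral.integral_of_le hx.1,
    integral_Ioc_eq_integral_Ioo, integral_Ioc_eq_integral_Ioo]
  exact integral_congr_ae
    (ae_mono (Measure.restrict_mono (Ioo_subset_Ioo_right hx.2) le_rfl) h)

theorem IsEdgeH2.zero (ℓ : ℝ) : IsEdgeH2 ℓ 0 0 0 0 where
  ae_eq := Lp.coeFn_zero _ _ _
  fst := by simp
  snd := fun x hx => by
    rw [EdgeL2.integral_congr (Lp.coeFn_zero ℂ 2 (edgeMeasure ℓ)) hx]; simp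

theorem IsEdgeH2.add {ℓ : ℝ} {f w f₁ w₁ : EdgeL2 ℓ} {u u' u₁ u₁' : ℝ → ℂ}
    (h : IsEdgeH2 ℓ f w u u') (h₁ : IsEdgeH2 ℓ f₁ w₁ u₁ u₁') :
    IsEdgeH2 ℓ (f + f₁) (w + w₁) (u + u₁) (u' + u₁') where
  ae_eq := (Lp.coeFn_add _ _).trans (h.ae_eq.add h₁.ae_eq)
  fst := fun x hx => by
    have := intervalIntegral.integral_add (h.intervalIntegrable hx) (h₁.intervalIntegrable hx)
    simp only [Pi.add_apply]
    rw [this, h.fst x hx, h₁.fst x hx]; ring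
  snd := fun x hx => by
    have := intervalIntegral.integral_add (w.intervalIntegrable hx) (w₁.intervalIntegrable hx)
    rw [EdgeL2.integral_congr (Lp.coeFn_add w w₁) hx]
    simp only [Pi.add_apply]
    rw [this, h.snd x hx, h₁.snd x hx]; ring

theorem IsEdgeH2.smul {ℓ : ℝ} {f w : EdgeL2 ℓ} {u u' : ℝ → ℂ} (c : ℂ)
    (h : IsEdgeH2 ℓ f w u u') : IsEdgeH2 ℓ (c • f) (c • w) (c • u) (c • u') where
  ae_eq := (Lp.coeFn_smul _ _).trans (h.ae_eq.const_smul c)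
  fst := fun x hx => by
    simp only [Pi.smul_apply, intervalIntegral.integral_smul]
    rw [h.fst x hx, smul_add]
  snd := fun x hx => by
    rw [EdgeL2.integral_congr (Lp.coeFn_smul c w) hx]
    simp only [Pi.smul_apply, intervalIntegral.integral_smul]
    rw [h.snd x hx, smul_add]

/-- The second derivative is determined by the function. -/
theorem IsEdgeH2.eq_zero {ℓ : ℝ} (hℓ : 0 < ℓ) {w : EdgeL2 ℓ} {u u' : ℝ → ℂ}
    (h : IsEdgeH2 ℓ 0 w u u') : w = 0 := by
  have hu : ∀ x ∈ Ioo 0 ℓ, u x = 0 := by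
    have h1 : u =ᵐ[edgeMeasure ℓ] fun _ => (0 : ℂ) :=
      h.ae_eq.symm.trans (Lp.coeFn_zero _ _ _)
    exact Measure.eqOn_open_of_ae_eq h1 isOpen_Ioo
      ((h.continuousOn hℓ.le).mono Ioo_subset_Icc_self) continuousOn_const
  have hu0 : ∀ x ∈ Icc 0 ℓ, u x = 0 := by
    have h2 : EqOn u (fun _ => (0 : ℂ)) (closure (Ioo 0 ℓ)) := by
      refine EqOn.of_subset_closure (s := Ioo 0 ℓ) hu ?_ continuousOn_const subset_closure le_rfl
      rw [closure_Ioo hℓ.ne]; exact h.continuousOn hℓ.le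
    rw [closure_Ioo hℓ.ne] at h2; exact h2
  have key : ∀ (g : ℝ → ℂ), IntervalIntegrable g volume 0 ℓ →
      (∀ x ∈ Icc 0 ℓ, ∫ s in (0 : ℝ)..x, g s = 0) → g =ᵐ[edgeMeasure ℓ] 0 := by
    intro g hg hz
    have h3 := hg.ae_hasDerivAt_integral
    rw [Filter.EventuallyEq, ae_restrict_iff' measurableSet_Ioo]
    filter_upwards [h3] with x hx hxI
    have hx' := hx (by rw [uIcc_of_le hℓ.le]; exact Ioo_subset_Icc_self hxI) 0
      (by rw [uIcc_of_le hℓ.le]; exact ⟨le_rfl, hℓ.le⟩)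
    have h4 : HasDerivAt (fun b => ∫ s in (0 : ℝ)..b, g s) 0 x := by
      refine (hasDerivAt_const x (0 : ℂ)).congr_of_eventuallyEq ?_
      filter_upwards [isOpen_Ioo.mem_nhds hxI] with y hy
      exact hz y (Ioo_subset_Icc_self hy)
    exact hx'.unique h4
  have hmem : (ℓ : ℝ) ∈ Icc 0 ℓ := ⟨hℓ.le, le_rfl⟩
  have hmem0 : (0 : ℝ) ∈ Icc 0 ℓ := ⟨le_rfl, hℓ.le⟩
  have hp : ∀ x ∈ Ioo 0 ℓ, u' x = 0 := by
    have h5 := key u' (h.intervalIntegrable hmem) (fun x hx => by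
      have := h.fst x hx
      rw [hu0 x hx, hu0 0 hmem0] at this
      simpa using this.symm)
    exact Measure.eqOn_open_of_ae_eq h5 isOpen_Ioo
      ((h.continuousOn_deriv hℓ.le).mono Ioo_subset_Icc_self) continuousOn_const
  have hp0 : ∀ x ∈ Icc 0 ℓ, u' x = 0 := by
    have h2 : EqOn u' (fun _ => (0 : ℂ)) (closure (Ioo 0 ℓ)) := by
      refine EqOn.of_subset_closure (s := Ioo 0 ℓ) hp ?_ continuousOn_const subset_closure le_rfl
      rw [closure_Ioo hℓ.ne]; exact h.continuousOn_deriv hℓ.le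
    rw [closure_Ioo hℓ.ne] at h2; exact h2
  have h6 := key w (w.intervalIntegrable hmem) (fun x hx => by
    have := h.snd x hx
    rw [hp0 x hx, hp0 0 hmem0] at this
    simpa using this.symm)
  exact Lp.ext (h6.trans (Lp.coeFn_zero _ _ _).symm)

/-! ### Compact metric graphs and decoration graphs -/

/-- A finite metric graph: `src e = ∂₋e`, `tgt e = ∂₊e`; loops and multiple edges are allowed. -/
structure FiniteMetricGraph where
  V : Type
  E : Type
  [finite_V : Finite V]
  [fintype_E : Fintype E]
  src : E → V
  tgt : E → V
  len : E → ℝ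
  len_pos : ∀ e, 0 < len e

attribute [instance] FiniteMetricGraph.finite_V FiniteMetricGraph.fintype_E

namespace FiniteMetricGraph

/-- `G.HasWalk v w r`: some edge path from `v` to `w` has total length `r`. -/
inductive HasWalk (G : FiniteMetricGraph) (v : G.V) : G.V → ℝ → Prop
  | nil : HasWalk G v v 0
  | forward (e : G.E) (r : ℝ) : HasWalk G v (G.src e) r → HasWalk G v (G.tgt e) (r + G.len e)
  | backward (e : G.E) (r : ℝ) : HasWalk G v (G.tgt e) r → HasWalk G v (G.src e) (r + G.len e)

/-- The metric distance of two vertices. -/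
def dist (G : FiniteMetricGraph) (v w : G.V) : ℝ := sInf {r | G.HasWalk v w r}

/-- The degree of a vertex; a loop counts twice. -/
def degree (G : FiniteMetricGraph) (v : G.V) : ℕ :=
  Nat.card {e : G.E // G.src e = v} + Nat.card {e : G.E // G.tgt e = v}

/-- The flux into the vertex `v`, i.e. the sum of the inward derivatives at `v`, for a function
with derivative `u'`. -/
def flux (G : FiniteMetricGraph) (u' : G.E → ℝ → ℂ) (v : G.V) : ℂ := by
  classical
  exact (∑ e, if G.tgt e = v then u' e (G.len e) else 0) - ∑ e, if G.src e = v then u' e 0 else 0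

theorem flux_zero (G : FiniteMetricGraph) (v : G.V) : G.flux 0 v = 0 := by
  simp [flux]

theorem flux_add (G : FiniteMetricGraph) (p p₁ : G.E → ℝ → ℂ) (v : G.V) :
    G.flux (p + p₁) v = G.flux p v + G.flux p₁ v := by
  simp only [flux, Pi.add_apply, ← Finset.sum_filter, Finset.sum_add_distrib]; ring

theorem flux_smul (G : FiniteMetricGraph) (c : ℂ) (p : G.E → ℝ → ℂ) (v : G.V) :
    G.flux (c • p) v = c * G.flux p v := by
  simp only [flux, Pi.smul_apply, smul_eq_mul, ← Finset.sum_filter, mul_sub, Finset.mul_sum]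

end FiniteMetricGraph

/-- A quantum decoration graph: a connected compact metric graph with two distinct connecting
vertices `o₀`, `o₁` and a vertex potential of strength `q` at `o₁`. -/
structure DecorationGraph extends FiniteMetricGraph where
  connected : ∀ v w : V, ∃ r, toFiniteMetricGraph.HasWalk v w r
  o₀ : V
  o₁ : V
  o₀_ne_o₁ : o₀ ≠ o₁
  q : ℝ

namespace DecorationGraph

/-- The function `f` on the decoration graph, with edgewise second derivative `w`, belongs to the
Sobolev space `H²` of the graph: it is `H²` on each edge, continuous at all vertices (with the
value `a v` at `v`), and its flux vanishes at the inner vertices. -/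
structure IsH2 (Γ : DecorationGraph) (f w : ∀ e : Γ.E, EdgeL2 (Γ.len e))
    (u u' : Γ.E → ℝ → ℂ) (a : Γ.V → ℂ) : Prop where
  edge : ∀ e, IsEdgeH2 (Γ.len e) (f e) (w e) (u e) (u' e)
  src : ∀ e, u e 0 = a (Γ.src e)
  tgt : ∀ e, u e (Γ.len e) = a (Γ.tgt e)
  inner : ∀ v, v ≠ Γ.o₀ → v ≠ Γ.o₁ → Γ.flux u' v = 0

/-- `f†(o₀) = -f'(o₀)`. -/
def dag₀ (Γ : DecorationGraph) (u' : Γ.E → ℝ → ℂ) : ℂ := -Γ.flux u' Γ.o₀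

/-- `f†(o₁) = f'(o₁) + q f(o₁)`. -/
def dag₁ (Γ : DecorationGraph) (u' : Γ.E → ℝ → ℂ) (a : Γ.V → ℂ) : ℂ :=
  Γ.flux u' Γ.o₁ + Γ.q * a Γ.o₁

theorem IsH2.zero (Γ : DecorationGraph) : Γ.IsH2 0 0 0 0 0 where
  edge _ := IsEdgeH2.zero _
  src _ := rfl
  tgt _ := rfl
  inner v _ _ := Γ.flux_zero v

theorem IsH2.add {Γ : DecorationGraph} {f w f₁ w₁ : ∀ e : Γ.E, EdgeL2 (Γ.len e)}
    {u u' u₁ u₁' : Γ.E → ℝ → ℂ} {a a₁ : Γ.V → ℂ}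
    (h : Γ.IsH2 f w u u' a) (h₁ : Γ.IsH2 f₁ w₁ u₁ u₁' a₁) :
    Γ.IsH2 (f + f₁) (w + w₁) (u + u₁) (u' + u₁') (a + a₁) where
  edge e := (h.edge e).add (h₁.edge e)
  src e := by simp [h.src e, h₁.src e]
  tgt e := by simp [h.tgt e, h₁.tgt e]
  inner v h0 h1 := by rw [Γ.flux_add, h.inner v h0 h1, h₁.inner v h0 h1, add_zero]

theorem IsH2.smul {Γ : DecorationGraph} {f w : ∀ e : Γ.E, EdgeL2 (Γ.len e)}
    {u u' : Γ.E → ℝ → ℂ} {a : Γ.V → ℂ} (c : ℂ) (h : Γ.IsH2 f w u u' a) :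
    Γ.IsH2 (c • f) (c • w) (c • u) (c • u') (c • a) where
  edge e := (h.edge e).smul c
  src e := by simp [h.src e]
  tgt e := by simp [h.tgt e]
  inner v h0 h1 := by rw [Γ.flux_smul, h.inner v h0 h1, mul_zero]

theorem dag₀_zero (Γ : DecorationGraph) : Γ.dag₀ 0 = 0 := by simp [dag₀, Γ.flux_zero]

theorem dag₁_zero (Γ : DecorationGraph) : Γ.dag₁ 0 0 = 0 := by simp [dag₁, Γ.flux_zero]

theorem dag₀_add (Γ : DecorationGraph) (p p₁ : Γ.E → ℝ → ℂ) :
    Γ.dag₀ (p + p₁) = Γ.dag₀ p + Γ.dag₀ p₁ := by simp only [dag₀, Γ.flux_add]; ring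

theorem dag₁_add (Γ : DecorationGraph) (p p₁ : Γ.E → ℝ → ℂ) (a a₁ : Γ.V → ℂ) :
    Γ.dag₁ (p + p₁) (a + a₁) = Γ.dag₁ p a + Γ.dag₁ p₁ a₁ := by
  simp only [dag₁, Γ.flux_add, Pi.add_apply]; ring

theorem dag₀_smul (Γ : DecorationGraph) (c : ℂ) (p : Γ.E → ℝ → ℂ) :
    Γ.dag₀ (c • p) = c * Γ.dag₀ p := by simp only [dag₀, Γ.flux_smul]; ring

theorem dag₁_smul (Γ : DecorationGraph) (c : ℂ) (p : Γ.E → ℝ → ℂ) (a : Γ.V → ℂ) :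
    Γ.dag₁ (c • p) (c • a) = c * Γ.dag₁ p a := by
  simp only [dag₁, Γ.flux_smul, Pi.smul_apply, smul_eq_mul]; ring

end DecorationGraph

/-- The uniformity assumptions on the sequence `G₁, G₂, …` of quantum decoration graphs. The
index `0` is not used. -/
structure UniformDecoration (Γ : ℕ → DecorationGraph) (ℓm ℓp κ qm qp : ℝ) : Prop where
  dist_ge : ∀ n, 1 ≤ n → ℓm ≤ (Γ n).dist (Γ n).o₀ (Γ n).o₁
  len_ge : ∀ n, 1 ≤ n → ∀ e, ((Γ n).src e = (Γ n).o₀ ∨ (Γ n).tgt e = (Γ n).o₀) →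
    κ * ℓm ≤ (Γ n).len e
  degree_eq : ∀ n, 1 ≤ n → (Γ n).degree (Γ n).o₀ = 1
  volume_le : ∀ n, 1 ≤ n → ∑ e, (Γ n).len e ≤ ℓp
  potential_ge : ∀ n, 1 ≤ n → qm ≤ (Γ n).q
  potential_le : ∀ n, 1 ≤ n → (Γ n).q ≤ qp

/-! ### Radial trees -/

/-- A rooted tree graph on the vertex set `V`, radial with branching numbers `b`: every vertex of
generation `n` (distance `n` from the root) has exactly `b n` succeeding edges. -/
structure RadialTree (V : Type*) (b : ℕ → ℕ) where
  graph : SimpleGraph V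
  isTree : graph.IsTree
  root : V
  finite_succ : ∀ v, {w | graph.Adj v w ∧ graph.dist root w = graph.dist root v + 1}.Finite
  card_succ : ∀ v, {w | graph.Adj v w ∧ graph.dist root w = graph.dist root v + 1}.ncard =
    b (graph.dist root v)

namespace RadialTree

variable {V : Type*} {b : ℕ → ℕ}

/-- The edges of the tree, directed away from the root. -/
structure Edge (T : RadialTree V b) where
  src : V
  tgt : V
  adj : T.graph.Adj src tgt
  away : T.graph.dist T.root tgt = T.graph.dist T.root src + 1

/-- The generation of a tree edge is the generation of its end vertex. -/
def Edge.gen {T : RadialTree V b} (t : T.Edge) : ℕ := T.graph.dist T.root t.tgt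

theorem finite_edge_src (T : RadialTree V b) (v : V) : {t : T.Edge | t.src = v}.Finite := by
  refine Set.Finite.of_finite_image (f := Edge.tgt) ((T.finite_succ v).subset ?_) ?_
  · rintro _ ⟨t, rfl, rfl⟩
    exact ⟨t.adj, t.away⟩
  · rintro ⟨s, w, h, h'⟩ hs ⟨s₁, w₁, h₁, h₁'⟩ hs₁ hw
    simp only [mem_ofPred_eq] at hs hs₁ hw
    subst hs; subst hs₁; subst hw; rfl

/-- The edges of the tree-like metric graph obtained from `T` by decorating every tree edge of
generation `n` with a copy of `G_n`. -/
abbrev GraphEdge (T : RadialTree V b) (Γ : ℕ → DecorationGraph) : Type _ :=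
  Σ t : T.Edge, (Γ t.gen).E

/-- The Hilbert space `L²(G)`, the Hilbert direct sum of the spaces `L²(e)`, `e ∈ E(G)`. -/
abbrev L2 (T : RadialTree V b) (Γ : ℕ → DecorationGraph) : Type _ :=
  lp (fun x : T.GraphEdge Γ => EdgeL2 ((Γ x.1.gen).len x.2)) 2

/-- The function `f`, with edgewise second derivative `w`, satisfies all conditions in the domain
of the Hamiltonian except for the square integrability of `f` and `w` over the whole graph: `H²`
on every decoration graph, Dirichlet condition at the root, and, at the end vertex of each tree
edge `t`, continuity and the Kirchhoff condition including the vertex potential. -/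
structure IsH2 (T : RadialTree V b) (Γ : ℕ → DecorationGraph)
    (f w : ∀ x : T.GraphEdge Γ, EdgeL2 ((Γ x.1.gen).len x.2))
    (u u' : ∀ t : T.Edge, (Γ t.gen).E → ℝ → ℂ) (a : ∀ t : T.Edge, (Γ t.gen).V → ℂ) : Prop where
  deco : ∀ t : T.Edge,
    (Γ t.gen).IsH2 (fun e => f ⟨t, e⟩) (fun e => w ⟨t, e⟩) (u t) (u' t) (a t)
  root : ∀ t : T.Edge, t.src = T.root → a t (Γ t.gen).o₀ = 0
  continuity : ∀ t s : T.Edge, s.src = t.tgt → a s (Γ s.gen).o₀ = a t (Γ t.gen).o₁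
  kirchhoff : ∀ t : T.Edge, ∑ s ∈ (T.finite_edge_src t.tgt).toFinset, (Γ s.gen).dag₀ (u' s) =
    (Γ t.gen).dag₁ (u' t) (a t)

/-- The graph of the Hamiltonian `f ↦ -f''` of the radial tree-like quantum graph. -/
def hamiltonianGraph (T : RadialTree V b) (Γ : ℕ → DecorationGraph) :
    Submodule ℂ (T.L2 Γ × T.L2 Γ) where
  carrier := {F | ∃ u u' a, T.IsH2 Γ (fun x => F.1 x) (fun x => -F.2 x) u u' a}
  zero_mem' := by
    refine ⟨0, 0, 0, ⟨fun t => ?_, fun t _ => rfl, fun t s _ => rfl, fun t => ?_⟩⟩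
    · convert DecorationGraph.IsH2.zero (Γ t.gen) using 1
      all_goals first | rfl | (funext e; simp)
    · simp [DecorationGraph.dag₀_zero, DecorationGraph.dag₁_zero]
  add_mem' := by
    rintro F F₁ ⟨u, p, a, h⟩ ⟨u₁, p₁, a₁, h₁⟩
    refine ⟨u + u₁, p + p₁, a + a₁,
      ⟨fun t => ?_, fun t ht => ?_, fun t s hs => ?_, fun t => ?_⟩⟩
    · convert (h.deco t).add (h₁.deco t) using 1
      all_goals first | rfl | (funext e; simp [add_comm])
    · simp [h.root t ht, h₁.root t ht]
    · simp [h.continuity t s hs, h₁.continuity t s hs]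
    · simp only [Pi.add_apply, DecorationGraph.dag₀_add, DecorationGraph.dag₁_add,
        Finset.sum_add_distrib, h.kirchhoff t, h₁.kirchhoff t]
  smul_mem' := by
    rintro c F ⟨u, p, a, h⟩
    refine ⟨c • u, c • p, c • a,
      ⟨fun t => ?_, fun t ht => ?_, fun t s hs => ?_, fun t => ?_⟩⟩
    · convert (h.deco t).smul c using 1
      all_goals first | rfl | (funext e; simp)
    · simp [h.root t ht]
    · simp [h.continuity t s hs]
    · simp only [Pi.smul_apply, DecorationGraph.dag₀_smul, DecorationGraph.dag₁_smul,
        ← Finset.mul_sum, h.kirchhoff t]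

theorem hamiltonianGraph_functional (T : RadialTree V b) (Γ : ℕ → DecorationGraph)
    (F : T.L2 Γ × T.L2 Γ) (hF : F ∈ T.hamiltonianGraph Γ) (h0 : F.1 = 0) : F.2 = 0 := by
  obtain ⟨u, p, a, h⟩ := hF
  ext1
  funext x
  have h1 := (h.deco x.1).edge x.2
  simp only [h0, lp.coeFn_zero, Pi.zero_apply] at h1
  simpa using h1.eq_zero ((Γ x.1.gen).len_pos x.2)

/-- The Hamiltonian `H_G` of the radial tree-like quantum graph, an unbounded operator in
`L²(G)`. -/
def hamiltonian (T : RadialTree V b) (Γ : ℕ → DecorationGraph) : T.L2 Γ →ₗ.[ℂ] T.L2 Γ :=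
  (T.hamiltonianGraph Γ).toLinearPMap

theorem graph_hamiltonian (T : RadialTree V b) (Γ : ℕ → DecorationGraph) :
    (T.hamiltonian Γ).graph = T.hamiltonianGraph Γ :=
  Submodule.toLinearPMap_graph_eq _ (T.hamiltonianGraph_functional Γ)

end RadialTree

/-! ### Line-like graphs -/

namespace LineLike

/-- The edges of the line-like graph `L_n`, the concatenation of `G_{n+1}, G_{n+2}, …`. -/
abbrev GraphEdge (Γ : ℕ → DecorationGraph) (n : ℕ) : Type :=
  Σ k : Ioi n, (Γ k).E

/-- The Hilbert space `L²(L_n)`. -/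
abbrev L2 (Γ : ℕ → DecorationGraph) (n : ℕ) : Type :=
  lp (fun x : GraphEdge Γ n => EdgeL2 ((Γ x.1).len x.2)) 2

/-- The function `f` on `L_n`, with edgewise second derivative `w`, satisfies all conditions in
the domain of `H_{L_n}` except for the square integrability of `f` and `w` over `L_n`: `H²` on
every decoration graph, Dirichlet condition at the starting vertex, and the weighted conditions
`f(k₋) = b_k^{-1/2} f(k₊)` and `f†(k₋) = b_k^{1/2} f†(k₊)`. Here `k₋` is the vertex `o₁` of `G_k`
and `k₊` is the vertex `o₀` of `G_{k+1}`. -/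
structure IsH2 (b : ℕ → ℕ) (Γ : ℕ → DecorationGraph) (n : ℕ)
    (f w : ∀ x : GraphEdge Γ n, EdgeL2 ((Γ x.1).len x.2))
    (u u' : ∀ k, (Γ k).E → ℝ → ℂ) (a : ∀ k, (Γ k).V → ℂ) : Prop where
  deco : ∀ k : Ioi n,
    (Γ k).IsH2 (fun e => f ⟨k, e⟩) (fun e => w ⟨k, e⟩) (u k) (u' k) (a k)
  start : a (n + 1) (Γ (n + 1)).o₀ = 0
  value : ∀ k, n < k →
    a k (Γ k).o₁ = ((Real.sqrt (b k))⁻¹ : ℝ) * a (k + 1) (Γ (k + 1)).o₀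
  deriv : ∀ k, n < k →
    (Γ k).dag₁ (u' k) (a k) = (Real.sqrt (b k) : ℝ) * (Γ (k + 1)).dag₀ (u' (k + 1))

/-- The graph of the Hamiltonian `f ↦ -f''` of the line-like quantum graph `L_n`. -/
def hamiltonianGraph (b : ℕ → ℕ) (Γ : ℕ → DecorationGraph) (n : ℕ) :
    Submodule ℂ (L2 Γ n × L2 Γ n) where
  carrier := {F | ∃ u u' a, IsH2 b Γ n (fun x => F.1 x) (fun x => -F.2 x) u u' a}
  zero_mem' := by
    refine ⟨0, 0, 0, ⟨fun k => ?_, rfl, fun k _ => ?_, fun k _ => ?_⟩⟩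
    · convert DecorationGraph.IsH2.zero (Γ k) using 1
      all_goals first | rfl | (funext e; simp)
    · simp
    · simp [DecorationGraph.dag₀_zero, DecorationGraph.dag₁_zero]
  add_mem' := by
    rintro F F₁ ⟨u, p, a, h⟩ ⟨u₁, p₁, a₁, h₁⟩
    refine ⟨u + u₁, p + p₁, a + a₁, ⟨fun k => ?_, ?_, fun k hk => ?_, fun k hk => ?_⟩⟩
    · convert (h.deco k).add (h₁.deco k) using 1
      all_goals first | rfl | (funext e; simp [add_comm])
    · simp [h.start, h₁.start]
    · simp only [Pi.add_apply, h.value k hk, h₁.value k hk]; ring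
    · simp only [Pi.add_apply, DecorationGraph.dag₀_add, DecorationGraph.dag₁_add,
        h.deriv k hk, h₁.deriv k hk]; ring
  smul_mem' := by
    rintro c F ⟨u, p, a, h⟩
    refine ⟨c • u, c • p, c • a, ⟨fun k => ?_, ?_, fun k hk => ?_, fun k hk => ?_⟩⟩
    · convert (h.deco k).smul c using 1
      all_goals first | rfl | (funext e; simp)
    · simp [h.start]
    · simp only [Pi.smul_apply, smul_eq_mul, h.value k hk]; ring
    · simp only [Pi.smul_apply, DecorationGraph.dag₀_smul, DecorationGraph.dag₁_smul,
        h.deriv k hk]; ring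

theorem hamiltonianGraph_functional (b : ℕ → ℕ) (Γ : ℕ → DecorationGraph) (n : ℕ)
    (F : L2 Γ n × L2 Γ n) (hF : F ∈ hamiltonianGraph b Γ n) (h0 : F.1 = 0) : F.2 = 0 := by
  obtain ⟨u, p, a, h⟩ := hF
  ext1
  funext x
  have h1 := (h.deco x.1).edge x.2
  simp only [h0, lp.coeFn_zero, Pi.zero_apply] at h1
  simpa using h1.eq_zero ((Γ x.1).len_pos x.2)

/-- The Dirichlet Hamiltonian `H_{L_n}` of the line-like quantum graph `L_n`, an unbounded operator
in `L²(L_n)`. -/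
def hamiltonian (b : ℕ → ℕ) (Γ : ℕ → DecorationGraph) (n : ℕ) : L2 Γ n →ₗ.[ℂ] L2 Γ n :=
  (hamiltonianGraph b Γ n).toLinearPMap

theorem graph_hamiltonian (b : ℕ → ℕ) (Γ : ℕ → DecorationGraph) (n : ℕ) :
    (hamiltonian b Γ n).graph = hamiltonianGraph b Γ n :=
  Submodule.toLinearPMap_graph_eq _ (hamiltonianGraph_functional b Γ n)

/-- `f` is a generalized eigenfunction of `H_{L_n}` for the eigenvalue `lam`: `-f'' = lam f` on
each edge, and `f` satisfies all vertex conditions including the Dirichlet condition at the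
starting vertex, but need not be square integrable over `L_n`. -/
def IsGeneralizedEigenfunction (b : ℕ → ℕ) (Γ : ℕ → DecorationGraph) (n : ℕ) (lam : ℝ)
    (f : ∀ x : GraphEdge Γ n, EdgeL2 ((Γ x.1).len x.2))
    (u u' : ∀ k, (Γ k).E → ℝ → ℂ) (a : ∀ k, (Γ k).V → ℂ) : Prop :=
  IsH2 b Γ n f (fun x => -((lam : ℂ) • f x)) u u' a

end LineLike

/-! ### Unbounded operators -/

/-- The orthogonal direct sum of a family of unbounded operators, with its maximal domain. -/
def directSumOperator {ι : Type*} {K : ι → Type*} [∀ i, NormedAddCommGroup (K i)]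
    [∀ i, InnerProductSpace ℂ (K i)] (A : ∀ i, K i →ₗ.[ℂ] K i) : lp K 2 →ₗ.[ℂ] lp K 2 where
  domain :=
    { carrier := {f | ∃ g : lp K 2, ∀ i, (f i, g i) ∈ (A i).graph}
      zero_mem' := ⟨0, fun i => (A i).graph.zero_mem⟩
      add_mem' := fun {f f₁} ⟨g, hg⟩ ⟨g₁, hg₁⟩ => ⟨g + g₁, fun i => (A i).graph.add_mem (hg i) (hg₁ i)⟩
      smul_mem' := fun c f ⟨g, hg⟩ => ⟨c • g, fun i => (A i).graph.smul_mem c (hg i)⟩ }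
  toFun :=
    { toFun := fun f => f.2.choose
      map_add' := fun f f₁ => by
        ext1
        funext i
        exact LinearPMap.mem_graph_snd_inj' (A i) ((f + f₁).2.choose_spec i)
          ((A i).graph.add_mem (f.2.choose_spec i) (f₁.2.choose_spec i)) rfl
      map_smul' := fun c f => by
        ext1
        funext i
        exact LinearPMap.mem_graph_snd_inj' (A i) ((c • f).2.choose_spec i)
          ((A i).graph.smul_mem c (f.2.choose_spec i)) rfl }

/-- Unitary equivalence of unbounded operators: some unitary map carries the graph of `A` onto
the graph of `B`, i.e. `U (dom A) = dom B` and `B U = U A`. -/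
def UnitarilyEquivalent {K L : Type*} [NormedAddCommGroup K] [InnerProductSpace ℂ K]
    [NormedAddCommGroup L] [InnerProductSpace ℂ L] (A : K →ₗ.[ℂ] K) (B : L →ₗ.[ℂ] L) : Prop :=
  ∃ U : K ≃ₗᵢ[ℂ] L, ∀ x y, (x, y) ∈ A.graph ↔ (U x, U y) ∈ B.graph

/-- `μ` is the spectral measure of the vector `f` for the operator `A`: the finite Borel measure
whose Borel transform is `z ↦ ⟪f, (A - z)⁻¹ f⟫`. -/
structure IsSpectralMeasureAt {K : Type*} [NormedAddCommGroup K] [InnerProductSpace ℂ K]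
    (A : K →ₗ.[ℂ] K) (f : K) (μ : Measure ℝ) : Prop where
  finite : IsFiniteMeasure μ
  resolvent : ∀ z : ℂ, z.im ≠ 0 →
    ∃ x : A.domain, A x - z • (x : K) = f ∧ ⟪f, (x : K)⟫ = ∫ t : ℝ, ((t : ℂ) - z)⁻¹ ∂μ

/-- The multiplicity of `H_{L_m} = H_{m+1}` in the reduction: `1` for `m = 0`, and
`b₀ ⋯ b_{m-1} (b_m - 1)` for `m ≥ 1`. -/
def reductionMultiplicity (b : ℕ → ℕ) (m : ℕ) : ℕ :=
  if m = 0 then 1 else (∏ i ∈ Finset.range m, b i) * (b m - 1)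

end

open MeasureTheory Set
open scoped ENNReal ComplexInnerProductSpace ComplexConjugate

noncomputable section

/-! Reduction to line-like graphs. Generation `k` of the tree has `b 0 ⋯ b (k-1)` edges. A function
on generation `k`, made constant on the `b k` successors of each edge and multiplied by `(b
k)^(-1/2)`, becomes a function of the same norm on generation `k + 1`. The orthogonal complement of
all functions obtained so has dimension `b 0 ⋯ b (k-1) (b k - 1)` and consists of functions whose
sum over the successors of each edge is zero. Adding an orthonormal basis of it in every generation
gives the modes (`RadialTree.exists_isModeSystem`). The coefficients of a function on the tree-like
graph in a mode born at generation `m + 1` form a function on `L_m`. Continuity and Kirchhoff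
conditions turn into the weighted junction conditions, and the vanishing sums give the Dirichlet
condition at the start (`isH2_analysis`, `isH2_synthesis`). Orthonormality and completeness of the
modes make the correspondence unitary.

Self-adjointness. Green's identity, summed over the decoration graphs of a line, telescopes to the
Wronskian at a far junction. Since one edge, of length bounded below, meets `o₀`, boundary values
there are controlled by `L²` norms on this edge (`IsEdgeH2.norm_boundary_le`), so the Wronskian
tends to zero and the operator is symmetric. Conversely, an element of the adjoint is a weak
solution against finitely supported test functions, and weak solutions satisfy all local conditions
(`LineLike.exists_isH2_of_weak`). The result for the tree follows by direct sums and unitary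
equivalence.

Generalized eigenfunctions. The energy identity and the volume bound show that domain elements are
bounded by their graph norm (`LineLike.exists_sup_bound`). Hence the resolvent maps `L²` to bounded
functions, and its restriction to an edge is Hilbert–Schmidt with squared norm at most a constant
times the length. A spectral measure `μ` of `f` yields an isometry `W` from `L²(μ)` that carries the
kernels `(t - z)⁻¹` to the resolvent vectors of `f`: both have the same Gram matrix by the resolvent
identity, and the kernels are total by Stone–Weierstrass. The adjoint of `W` turns the operator into
multiplication by `t`. The Hilbert–Schmidt bounds, summed with weights `k⁻²`, show that this adjoint
is given at almost every `t` by pairing with a function `φ t` of finite weighted norm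
(`exists_generalized_functionals`). Diagonalization makes `φ t` a weak, hence a true, solution of
the eigenvalue equation, and the trace estimate at `o₀` gives linear growth. -/

/-! ### Integration by parts and Green's identity on one edge. -/

theorem integral_mul_primitive_real {ℓ : ℝ} {f g : ℝ → ℝ}
    (hf : IntervalIntegrable f volume 0 ℓ) (hg : IntervalIntegrable g volume 0 ℓ) :
    ∫ x in (0 : ℝ)..ℓ, (f x * (∫ s in (0 : ℝ)..x, g s) + (∫ s in (0 : ℝ)..x, f s) * g x) =
      (∫ x in (0 : ℝ)..ℓ, f x) * ∫ x in (0 : ℝ)..ℓ, g x := by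
  have hF := hf.absolutelyContinuousOnInterval_intervalIntegral left_mem_uIcc
  have hG := hg.absolutelyContinuousOnInterval_intervalIntegral left_mem_uIcc
  have hd : ∀ {h : ℝ → ℝ}, IntervalIntegrable h volume 0 ℓ →
      ∀ᵐ x : ℝ, x ∈ uIoc 0 ℓ → deriv (fun x => ∫ s in (0 : ℝ)..x, h s) x = h x := by
    intro h hh
    filter_upwards [hh.ae_hasDerivAt_integral] with x hx hxI
    exact (hx (uIoc_subset_uIcc hxI) 0 left_mem_uIcc).deriv
  have h1 := hF.integral_mul_deriv_eq_deriv_mul hG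
  rw [intervalIntegral.integral_congr_ae (g := fun x => (∫ s in (0 : ℝ)..x, f s) * g x)
      (by filter_upwards [hd hg] with x hx hxI; rw [hx hxI]),
    intervalIntegral.integral_congr_ae
      (f := fun x => deriv (fun x => ∫ s in (0 : ℝ)..x, f s) x * ∫ s in (0 : ℝ)..x, g s)
      (g := fun x => f x * (∫ s in (0 : ℝ)..x, g s))
      (by filter_upwards [hd hf] with x hx hxI; rw [hx hxI])] at h1
  have i1 : IntervalIntegrable (fun x => f x * (∫ s in (0 : ℝ)..x, g s)) volume 0 ℓ :=
    hf.mul_continuousOn hG.continuousOn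
  have i2 : IntervalIntegrable (fun x => (∫ s in (0 : ℝ)..x, f s) * g x) volume 0 ℓ :=
    hg.continuousOn_mul hF.continuousOn
  rw [intervalIntegral.integral_add i1 i2, h1]
  simp

theorem continuousOn_primitive_of_le {ℓ : ℝ} {f : ℝ → ℂ}
    (hf : IntervalIntegrable f volume 0 ℓ) :
    ContinuousOn (fun x => ∫ s in (0 : ℝ)..x, f s) (uIcc 0 ℓ) :=
  intervalIntegral.continuousOn_primitive_interval ((intervalIntegrable_iff' ).1 hf)

/-- Both sides are bilinear and symmetric in `f` and `g`, so splitting into real and imaginary parts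
reduces to the real product rule. By symmetry, linearity in the first argument is enough. -/
theorem integral_mul_primitive {ℓ : ℝ} {f g : ℝ → ℂ}
    (hf : IntervalIntegrable f volume 0 ℓ) (hg : IntervalIntegrable g volume 0 ℓ) :
    ∫ x in (0 : ℝ)..ℓ, (f x * (∫ s in (0 : ℝ)..x, g s) + (∫ s in (0 : ℝ)..x, f s) * g x) =
      (∫ x in (0 : ℝ)..ℓ, f x) * ∫ x in (0 : ℝ)..ℓ, g x := by
  have sub : ∀ {h : ℝ → ℂ}, IntervalIntegrable h volume 0 ℓ → ∀ x ∈ uIcc 0 ℓ,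
      IntervalIntegrable h volume 0 x := fun hh x hx =>
    hh.mono_set (uIcc_subset_uIcc_left hx)
  let P : (ℝ → ℂ) → (ℝ → ℂ) → Prop := fun f g =>
    ∫ x in (0 : ℝ)..ℓ, (f x * (∫ s in (0 : ℝ)..x, g s) + (∫ s in (0 : ℝ)..x, f s) * g x) =
      (∫ x in (0 : ℝ)..ℓ, f x) * ∫ x in (0 : ℝ)..ℓ, g x
  have symm : ∀ {f g}, P f g → P g f := by
    intro f g h
    simp only [P] at h ⊢
    rw [mul_comm, ← h]
    congr 1; funext x; ring
  have int : ∀ {f g : ℝ → ℂ}, IntervalIntegrable f volume 0 ℓ → IntervalIntegrable g volume 0 ℓ →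
      IntervalIntegrable (fun x => f x * (∫ s in (0 : ℝ)..x, g s) + (∫ s in (0 : ℝ)..x, f s) * g x)
        volume 0 ℓ := fun hf hg =>
    (hf.mul_continuousOn (continuousOn_primitive_of_le hg)).add
      (hg.continuousOn_mul (continuousOn_primitive_of_le hf))
  have lin : ∀ {f₁ f₂ g : ℝ → ℂ}, IntervalIntegrable f₁ volume 0 ℓ →
      IntervalIntegrable f₂ volume 0 ℓ → IntervalIntegrable g volume 0 ℓ → P f₁ g → P f₂ g →
      P (fun x => f₁ x + Complex.I * f₂ x) g := by
    intro f₁ f₂ g h₁ h₂ hg p₁ p₂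
    have h₂' := h₂.const_mul Complex.I
    simp only [P] at p₁ p₂ ⊢
    have e : ∫ x in (0 : ℝ)..ℓ, ((f₁ x + Complex.I * f₂ x) * (∫ s in (0 : ℝ)..x, g s) +
          (∫ s in (0 : ℝ)..x, (f₁ s + Complex.I * f₂ s)) * g x) =
        ∫ x in (0 : ℝ)..ℓ, ((f₁ x * (∫ s in (0 : ℝ)..x, g s) + (∫ s in (0 : ℝ)..x, f₁ s) * g x) +
          Complex.I * (f₂ x * (∫ s in (0 : ℝ)..x, g s) + (∫ s in (0 : ℝ)..x, f₂ s) * g x)) := by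
      refine intervalIntegral.integral_congr fun x hx => ?_
      rw [intervalIntegral.integral_add (sub h₁ x hx) (sub h₂' x hx),
        intervalIntegral.integral_const_mul]
      ring
    rw [e, intervalIntegral.integral_add (int h₁ hg) ((int h₂ hg).const_mul _),
      intervalIntegral.integral_const_mul, p₁, p₂, intervalIntegral.integral_add h₁ h₂',
      intervalIntegral.integral_const_mul]
    ring
  have re : ∀ {h : ℝ → ℂ}, IntervalIntegrable h volume 0 ℓ →
      IntervalIntegrable (fun x => (h x).re) volume 0 ℓ := fun hh =>
    ⟨hh.1.re, hh.2.re⟩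
  have im : ∀ {h : ℝ → ℂ}, IntervalIntegrable h volume 0 ℓ →
      IntervalIntegrable (fun x => (h x).im) volume 0 ℓ := fun hh =>
    ⟨hh.1.im, hh.2.im⟩
  have dec : ∀ h : ℝ → ℂ, h = fun x => ((h x).re : ℂ) + Complex.I * ((h x).im : ℂ) := fun h => by
    funext x; rw [mul_comm]; exact (Complex.re_add_im _).symm
  have real : ∀ {r t : ℝ → ℝ}, IntervalIntegrable r volume 0 ℓ → IntervalIntegrable t volume 0 ℓ →
      P (fun x => (r x : ℂ)) (fun x => (t x : ℂ)) := by
    intro r t hr ht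
    simp only [P, intervalIntegral.integral_ofReal]
    have := congrArg (fun y : ℝ => (y : ℂ)) (integral_mul_primitive_real hr ht)
    simp only [Complex.ofReal_mul] at this
    rw [← this, ← intervalIntegral.integral_ofReal]
    congr 1; funext x; push_cast; ring
  have ofR : ∀ {r : ℝ → ℝ}, IntervalIntegrable r volume 0 ℓ →
      IntervalIntegrable (fun x => (r x : ℂ)) volume 0 ℓ := fun hr => ⟨hr.1.ofReal, hr.2.ofReal⟩
  have half : ∀ {r : ℝ → ℝ}, IntervalIntegrable r volume 0 ℓ → P g (fun x => (r x : ℂ)) := by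
    intro r hr
    rw [dec g]
    exact lin (ofR (re hg)) (ofR (im hg)) (ofR hr) (real (re hg) hr) (real (im hg) hr)
  change P f g
  rw [dec f]
  exact lin (ofR (re hf)) (ofR (im hf)) hg (symm (half (re hf))) (symm (half (im hf)))

/-- Integration by parts for absolutely continuous functions. -/
theorem integral_by_parts_primitive {ℓ : ℝ} {f g u v : ℝ → ℂ} (hℓ : 0 ≤ ℓ)
    (hf : IntervalIntegrable f volume 0 ℓ) (hg : IntervalIntegrable g volume 0 ℓ)
    (hu : ∀ x ∈ Icc 0 ℓ, u x = u 0 + ∫ s in (0 : ℝ)..x, f s)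
    (hv : ∀ x ∈ Icc 0 ℓ, v x = v 0 + ∫ s in (0 : ℝ)..x, g s) :
    ∫ x in (0 : ℝ)..ℓ, f x * v x = u ℓ * v ℓ - u 0 * v 0 - ∫ x in (0 : ℝ)..ℓ, u x * g x := by
  have h := integral_mul_primitive hf hg
  have i1 := hf.mul_continuousOn (continuousOn_primitive_of_le hg)
  have i2 := hg.continuousOn_mul (continuousOn_primitive_of_le hf)
  rw [intervalIntegral.integral_add i1 i2] at h
  have e1 : ∫ x in (0 : ℝ)..ℓ, f x * v x =
      ∫ x in (0 : ℝ)..ℓ, (v 0 * f x + f x * ∫ s in (0 : ℝ)..x, g s) := by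
    refine intervalIntegral.integral_congr fun x hx => ?_
    rw [uIcc_of_le hℓ] at hx
    rw [hv x hx]; ring
  have e2 : ∫ x in (0 : ℝ)..ℓ, u x * g x =
      ∫ x in (0 : ℝ)..ℓ, (u 0 * g x + (∫ s in (0 : ℝ)..x, f s) * g x) := by
    refine intervalIntegral.integral_congr fun x hx => ?_
    rw [uIcc_of_le hℓ] at hx
    rw [hu x hx]; ring
  rw [e1, e2, intervalIntegral.integral_add (hf.const_mul _) i1,
    intervalIntegral.integral_add (hg.const_mul _) i2, intervalIntegral.integral_const_mul,
    intervalIntegral.integral_const_mul, hu ℓ ⟨hℓ, le_rfl⟩, hv ℓ ⟨hℓ, le_rfl⟩]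
  linear_combination h

theorem EdgeL2.inner_eq {ℓ : ℝ} (hℓ : 0 ≤ ℓ) (w g : EdgeL2 ℓ) {p : ℝ → ℂ}
    (h : g =ᵐ[edgeMeasure ℓ] p) : ⟪w, g⟫ = ∫ x in (0 : ℝ)..ℓ, conj (w x) * p x := by
  rw [L2.inner_def, intervalIntegral.integral_of_le hℓ, integral_Ioc_eq_integral_Ioo]
  refine integral_congr_ae ?_
  filter_upwards [h] with x hx
  simp [hx, mul_comm]

theorem intervalIntegral_conj {a b : ℝ} (f : ℝ → ℂ) :
    ∫ x in a..b, conj (f x) = conj (∫ x in a..b, f x) := by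
  simp only [intervalIntegral, integral_conj, map_sub]

namespace IsEdgeH2

variable {ℓ : ℝ} {f w g v : EdgeL2 ℓ} {u u' p p' : ℝ → ℂ}

/-- Since `w` is the second derivative of `f`, this gives the energy identity when the two functions
agree, and Green's identity when it is antisymmetrized. -/
theorem inner_deriv (hℓ : 0 ≤ ℓ) (h : IsEdgeH2 ℓ f w u u') (h₁ : IsEdgeH2 ℓ g v p p') :
    ⟪w, g⟫ = conj (u' ℓ) * p ℓ - conj (u' 0) * p 0 - ∫ x in (0 : ℝ)..ℓ, conj (u' x) * p' x := by
  have hm : ℓ ∈ Icc 0 ℓ := ⟨hℓ, le_rfl⟩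
  rw [EdgeL2.inner_eq hℓ w g h₁.ae_eq]
  have hw := w.intervalIntegrable hm
  refine integral_by_parts_primitive (u := fun x => conj (u' x)) hℓ
    ⟨?_, ?_⟩ (h₁.intervalIntegrable hm) (fun x hx => ?_) h₁.fst
  · exact (Complex.conjCLE.toContinuousLinearMap.integrable_comp hw.1 :)
  · exact (Complex.conjCLE.toContinuousLinearMap.integrable_comp hw.2 :)
  · rw [intervalIntegral_conj, h.snd x hx, map_add]

/-- Green's identity on one edge. -/
theorem green (hℓ : 0 ≤ ℓ) (h : IsEdgeH2 ℓ f w u u') (h₁ : IsEdgeH2 ℓ g v p p') :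
    ⟪w, g⟫ - ⟪f, v⟫ = (conj (u' ℓ) * p ℓ - conj (u ℓ) * p' ℓ) -
      (conj (u' 0) * p 0 - conj (u 0) * p' 0) := by
  rw [← inner_conj_symm f v, inner_deriv hℓ h h₁, inner_deriv hℓ h₁ h]
  simp only [map_sub, map_mul, Complex.conj_conj, ← intervalIntegral_conj]
  have : ∫ x in (0 : ℝ)..ℓ, p' x * conj (u' x) = ∫ x in (0 : ℝ)..ℓ, conj (u' x) * p' x := by
    congr 1; funext x; ring
  rw [this]; ring

end IsEdgeH2

/-! ### Existence, trace estimates and weak regularity on one edge. -/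

theorem exists_edgeL2_of_continuousOn {ℓ : ℝ} (hℓ : 0 ≤ ℓ) {p : ℝ → ℂ} {C : ℝ} (hC : 0 ≤ C)
    (hp : ContinuousOn p (Icc 0 ℓ)) (hb : ∀ x ∈ Icc 0 ℓ, ‖p x‖ ≤ C) :
    ∃ f : EdgeL2 ℓ, f =ᵐ[edgeMeasure ℓ] p ∧ ‖f‖ ≤ Real.sqrt ℓ * C := by
  have hae : ∀ᵐ x ∂edgeMeasure ℓ, ‖p x‖ ≤ C := by
    filter_upwards [ae_restrict_mem measurableSet_Ioo] with x hx
    exact hb x (Ioo_subset_Icc_self hx)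
  have hm : MemLp p 2 (edgeMeasure ℓ) :=
    MemLp.of_bound ((hp.mono Ioo_subset_Icc_self).aestronglyMeasurable measurableSet_Ioo) C hae
  refine ⟨hm.toLp p, hm.coeFn_toLp, ?_⟩
  have h1 : ∀ᵐ x ∂edgeMeasure ℓ, ‖hm.toLp p x‖ ≤ C := by
    filter_upwards [hae, hm.coeFn_toLp] with x hx hx'
    rwa [hx']
  refine (Lp.norm_le_of_ae_bound hC h1).trans (le_of_eq ?_)
  congr 1
  have : ((measureUnivNNReal (edgeMeasure ℓ) : NNReal) : ℝ) = ℓ := by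
    rw [← ENNReal.coe_toReal, coe_measureUnivNNReal]
    simp [hℓ]
  rw [this, Real.sqrt_eq_rpow]
  norm_num

theorem exists_isEdgeH2_of_initial {ℓ : ℝ} (hℓ : 0 ≤ ℓ) (w : EdgeL2 ℓ) (α α' : ℂ) :
    ∃ f u u', IsEdgeH2 ℓ f w u u' ∧ u 0 = α ∧ u' 0 = α' := by
  have hm : ℓ ∈ Icc 0 ℓ := ⟨hℓ, le_rfl⟩
  set u' : ℝ → ℂ := fun x => α' + ∫ s in (0 : ℝ)..x, w s
  set u : ℝ → ℂ := fun x => α + ∫ s in (0 : ℝ)..x, u' s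
  have hu' : ContinuousOn u' (uIcc 0 ℓ) :=
    continuousOn_const.add (continuousOn_primitive_of_le (w.intervalIntegrable hm))
  have hu : ContinuousOn u (uIcc 0 ℓ) :=
    continuousOn_const.add (continuousOn_primitive_of_le hu'.intervalIntegrable)
  rw [uIcc_of_le hℓ] at hu
  obtain ⟨C, hC⟩ := isCompact_Icc.exists_bound_of_continuousOn hu
  obtain ⟨f, hf, -⟩ := exists_edgeL2_of_continuousOn hℓ
    ((norm_nonneg _).trans (hC ℓ hm)) hu hC
  exact ⟨f, u, u', ⟨hf, fun x _ => by simp [u], fun x _ => by simp [u']⟩, by simp [u], by simp [u']⟩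

/-- Hermite interpolation: all boundary values of `f` and `f'` can be prescribed. -/
theorem exists_isEdgeH2_of_boundary {ℓ : ℝ} (hℓ : 0 < ℓ) (α α' β β' : ℂ) :
    ∃ f w u u', IsEdgeH2 ℓ f w u u' ∧ u 0 = α ∧ u' 0 = α' ∧ u ℓ = β ∧ u' ℓ = β' ∧
      ‖f‖ ≤ Real.sqrt ℓ * ((6 + 4 * ℓ) * (‖α‖ + ‖α'‖ + ‖β‖ + ‖β'‖)) ∧
      ‖w‖ ≤ Real.sqrt ℓ * ((18 + 10 * ℓ) / ℓ ^ 2 * (‖α‖ + ‖α'‖ + ‖β‖ + ‖β'‖)) := by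
  have hℓ' : (ℓ : ℂ) ≠ 0 := by exact_mod_cast hℓ.ne'
  set N := ‖α‖ + ‖α'‖ + ‖β‖ + ‖β'‖ with hN
  have hN0 : 0 ≤ N := by positivity
  have hα : ‖α‖ ≤ N := by have := norm_nonneg α'; have := norm_nonneg β
                          have := norm_nonneg β'; linarith
  have hα' : ‖α'‖ ≤ N := by have := norm_nonneg α; have := norm_nonneg β
                            have := norm_nonneg β'; linarith
  -- The quadratic and cubic coefficients of the polynomial with value `α` and slope `α'` at `0`,
  -- value `β` and slope `β'` at `ℓ`. The constants in the norm bounds come from the triangle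
  -- inequality for its four terms.
  set c₂ : ℂ := (3 * (β - α) - 2 * α' * ℓ - β' * ℓ) / (ℓ : ℂ) ^ 2 with hc₂
  set c₃ : ℂ := (2 * (α - β) + (α' + β') * ℓ) / (ℓ : ℂ) ^ 3 with hc₃
  have nℓ : ‖(ℓ : ℂ)‖ = ℓ := by simp [hℓ.le]
  have b₂ : ‖c₂‖ ≤ (3 + 2 * ℓ) * N / ℓ ^ 2 := by
    rw [hc₂, norm_div, norm_pow, nℓ]
    gcongr
    calc _ ≤ ‖3 * (β - α)‖ + ‖2 * α' * ℓ‖ + ‖β' * ℓ‖ :=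
          (norm_sub_le _ _).trans (add_le_add_left (norm_sub_le _ _) _)
      _ ≤ 3 * (‖β‖ + ‖α‖) + 2 * ‖α'‖ * ℓ + ‖β'‖ * ℓ := by
          simp only [norm_mul, nℓ, RCLike.norm_ofNat]
          gcongr
          exact norm_sub_le _ _
      _ ≤ _ := by
          rw [hN]
          nlinarith [norm_nonneg α, norm_nonneg α', norm_nonneg β, norm_nonneg β']
  have b₃ : ‖c₃‖ ≤ (2 + ℓ) * N / ℓ ^ 3 := by
    rw [hc₃, norm_div, norm_pow, nℓ]
    gcongr
    calc _ ≤ ‖2 * (α - β)‖ + ‖(α' + β') * ℓ‖ := norm_add_le _ _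
      _ ≤ 2 * (‖α‖ + ‖β‖) + (‖α'‖ + ‖β'‖) * ℓ := by
          simp only [norm_mul, nℓ, RCLike.norm_ofNat]
          gcongr
          · exact norm_sub_le _ _
          · exact norm_add_le _ _
      _ ≤ _ := by
          rw [hN]
          nlinarith [norm_nonneg α, norm_nonneg α', norm_nonneg β, norm_nonneg β']
  set u : ℝ → ℂ := fun x => α + α' * x + c₂ * (x : ℂ) ^ 2 + c₃ * (x : ℂ) ^ 3
  set u' : ℝ → ℂ := fun x => α' + 2 * c₂ * x + 3 * c₃ * (x : ℂ) ^ 2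
  set u'' : ℝ → ℂ := fun x => 2 * c₂ + 6 * c₃ * x
  have d₁ : ∀ x : ℝ, HasDerivAt u (u' x) x := fun x => by
    have hx := (hasDerivAt_id x).ofReal_comp
    have := (((hasDerivAt_const x α).add (hx.const_mul α')).add ((hx.pow 2).const_mul c₂)).add
      ((hx.pow 3).const_mul c₃)
    refine (this : HasDerivAt u _ x).congr_deriv ?_
    simp only [u', id]; push_cast; ring
  have d₂ : ∀ x : ℝ, HasDerivAt u' (u'' x) x := fun x => by
    have hx := (hasDerivAt_id x).ofReal_comp
    have := ((hasDerivAt_const x α').add (hx.const_mul (2 * c₂))).add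
      ((hx.pow 2).const_mul (3 * c₃))
    refine (this : HasDerivAt u' _ x).congr_deriv ?_
    simp only [u'', id]; push_cast; ring
  have cu : Continuous u := by fun_prop
  have cu' : Continuous u' := by fun_prop
  have cu'' : Continuous u'' := by fun_prop
  have bx : ∀ x ∈ Icc 0 ℓ, ‖(x : ℂ)‖ ≤ ℓ := fun x hx => by
    rw [Complex.norm_real, Real.norm_of_nonneg hx.1]; exact hx.2
  obtain ⟨f, hf, bf⟩ := exists_edgeL2_of_continuousOn hℓ.le (p := u)
    (C := (6 + 4 * ℓ) * N) (by positivity) cu.continuousOn (fun x hx => by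
      have hxb := bx x hx
      calc ‖u x‖ ≤ ‖α‖ + ‖α' * x‖ + ‖c₂ * (x : ℂ) ^ 2‖ + ‖c₃ * (x : ℂ) ^ 3‖ := by
            refine (norm_add_le _ _).trans (add_le_add_left ?_ _)
            refine (norm_add_le _ _).trans (add_le_add_left ?_ _)
            exact norm_add_le _ _
        _ ≤ N + N * ℓ + (3 + 2 * ℓ) * N / ℓ ^ 2 * ℓ ^ 2 + (2 + ℓ) * N / ℓ ^ 3 * ℓ ^ 3 := by
            simp only [norm_mul, norm_pow]
            gcongr
        _ = (6 + 4 * ℓ) * N := by field_simp; ring)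
  obtain ⟨w, hw, bw⟩ := exists_edgeL2_of_continuousOn hℓ.le (p := u'')
    (C := (18 + 10 * ℓ) / ℓ ^ 2 * N) (by positivity) cu''.continuousOn (fun x hx => by
      have hxb := bx x hx
      calc ‖u'' x‖ ≤ ‖2 * c₂‖ + ‖6 * c₃ * x‖ := norm_add_le _ _
        _ ≤ 2 * ((3 + 2 * ℓ) * N / ℓ ^ 2) + 6 * ((2 + ℓ) * N / ℓ ^ 3) * ℓ := by
            simp only [norm_mul, RCLike.norm_ofNat]
            gcongr
        _ = _ := by field_simp; ring)
  refine ⟨f, w, u, u', ⟨hf, fun x _ => ?_, fun x hx => ?_⟩, by simp [u], by simp [u'], ?_, ?_,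
    bf, bw⟩
  · rw [intervalIntegral.integral_eq_sub_of_hasDerivAt (fun y _ => d₁ y)
      (cu'.intervalIntegrable _ _)]
    ring
  · rw [EdgeL2.integral_congr hw hx, intervalIntegral.integral_eq_sub_of_hasDerivAt
      (fun y _ => d₂ y) (cu''.intervalIntegrable _ _)]
    ring
  · simp only [u, hc₂, hc₃]; field_simp; ring
  · simp only [u', hc₂, hc₃]; field_simp; ring

/-- The constant in the estimate of boundary values on an edge of length between `L₀` and `L₁`. -/
def traceConst (L₀ L₁ : ℝ) : ℝ := Real.sqrt L₁ * (6 + 4 * L₁ + (18 + 10 * L₁) / L₀ ^ 2)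

namespace IsEdgeH2

/-- By duality: Green's identity against the Hermite interpolant with one boundary datum equal to
`1` and the others `0` isolates one boundary value. Cauchy–Schwarz then bounds it, since
`traceConst` dominates the norms of the interpolant and of its second derivative. -/
theorem norm_boundary_le {ℓ L₀ L₁ : ℝ} {f w : EdgeL2 ℓ} {u u' : ℝ → ℂ} (h : IsEdgeH2 ℓ f w u u')
    (hL₀ : 0 < L₀) (h₀ : L₀ ≤ ℓ) (h₁ : ℓ ≤ L₁) :
    (‖u 0‖ ≤ traceConst L₀ L₁ * (‖f‖ + ‖w‖) ∧ ‖u' 0‖ ≤ traceConst L₀ L₁ * (‖f‖ + ‖w‖)) ∧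
    (‖u ℓ‖ ≤ traceConst L₀ L₁ * (‖f‖ + ‖w‖) ∧ ‖u' ℓ‖ ≤ traceConst L₀ L₁ * (‖f‖ + ‖w‖)) := by
  have hℓ : 0 < ℓ := hL₀.trans_le h₀
  have key : ∀ α α' β β' : ℂ, ‖α‖ + ‖α'‖ + ‖β‖ + ‖β'‖ = 1 →
      ‖(conj (u' ℓ) * β - conj (u ℓ) * β') - (conj (u' 0) * α - conj (u 0) * α')‖ ≤
        traceConst L₀ L₁ * (‖f‖ + ‖w‖) := by
    intro α α' β β' hN
    obtain ⟨g, v, p, p', hg, rfl, rfl, rfl, rfl, bg, bv⟩ :=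
      exists_isEdgeH2_of_boundary hℓ α α' β β'
    rw [hN, mul_one] at bg bv
    rw [← h.green hℓ.le hg]
    have bg' : ‖g‖ ≤ traceConst L₀ L₁ := by
      refine bg.trans ?_
      unfold traceConst
      have : 0 ≤ (18 + 10 * L₁) / L₀ ^ 2 := div_nonneg (by linarith) (by positivity)
      exact mul_le_mul (Real.sqrt_le_sqrt h₁) (by linarith) (by positivity) (Real.sqrt_nonneg _)
    have bv' : ‖v‖ ≤ traceConst L₀ L₁ := by
      refine bv.trans ?_
      unfold traceConst
      have : (18 + 10 * ℓ) / ℓ ^ 2 ≤ (18 + 10 * L₁) / L₀ ^ 2 := by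
        gcongr
        linarith
      exact mul_le_mul (Real.sqrt_le_sqrt h₁) (by linarith) (by positivity) (Real.sqrt_nonneg _)
    calc _ ≤ ‖⟪w, g⟫‖ + ‖⟪f, v⟫‖ := norm_sub_le _ _
      _ ≤ ‖w‖ * ‖g‖ + ‖f‖ * ‖v‖ := add_le_add (norm_inner_le_norm _ _) (norm_inner_le_norm _ _)
      _ ≤ ‖w‖ * traceConst L₀ L₁ + ‖f‖ * traceConst L₀ L₁ := by gcongr
      _ = _ := by ring
  have k1 := key 0 1 0 0 (by simp)
  have k2 := key 1 0 0 0 (by simp)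
  have k3 := key 0 0 0 1 (by simp)
  have k4 := key 0 0 1 0 (by simp)
  simp only [mul_zero, mul_one, sub_zero, zero_sub, norm_neg, neg_neg, RCLike.norm_conj] at k1 k2 k3 k4
  exact ⟨⟨k1, k2⟩, k3, k4⟩

/-- A weak solution of `-g'' = -h` on one edge, tested with all `H²` functions with vanishing
boundary data, is in `H²`. -/
theorem exists_of_weak {ℓ : ℝ} (hℓ : 0 < ℓ) {g k : EdgeL2 ℓ}
    (H : ∀ f w u u', IsEdgeH2 ℓ f w u u' → u 0 = 0 → u' 0 = 0 → u ℓ = 0 → u' ℓ = 0 →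
      ⟪w, g⟫ = ⟪f, k⟫) : ∃ p p', IsEdgeH2 ℓ g k p p' := by
  -- `V` is a particular solution; `Q = 1` and `R = x` span the solutions with vanishing second
  -- derivative. It remains to see that `g - V` lies in this span, and the test function is built
  -- from the part of `g - V` orthogonal to it.
  obtain ⟨V, p, p', hV, -, -⟩ := exists_isEdgeH2_of_initial hℓ.le k 0 0
  obtain ⟨Q, q, q', hQ, q0, q0'⟩ := exists_isEdgeH2_of_initial hℓ.le (0 : EdgeL2 ℓ) 1 0
  obtain ⟨R, r, r', hR, r0, r0'⟩ := exists_isEdgeH2_of_initial hℓ.le (0 : EdgeL2 ℓ) 0 1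
  have hm : ℓ ∈ Icc 0 ℓ := ⟨hℓ.le, le_rfl⟩
  have hz : ∀ x ∈ Icc 0 ℓ, ∫ s in (0 : ℝ)..x, (0 : EdgeL2 ℓ) s = 0 := fun x hx => by
    rw [EdgeL2.integral_congr (Lp.coeFn_zero ℂ 2 (edgeMeasure ℓ)) hx]; simp
  have hr' : ∀ x ∈ Icc 0 ℓ, r' x = 1 := fun x hx => by rw [hR.snd x hx, hz x hx, r0', add_zero]
  have hq' : ∀ x ∈ Icc 0 ℓ, q' x = 0 := fun x hx => by rw [hQ.snd x hx, hz x hx, q0', add_zero]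
  have hqℓ : q ℓ = 1 := by
    rw [hQ.fst ℓ hm, q0, intervalIntegral.integral_congr (g := fun _ => (0 : ℂ))
      (fun x hx => hq' x (by rwa [uIcc_of_le hℓ.le] at hx))]
    simp
  have hrℓ : r ℓ = ℓ := by
    rw [hR.fst ℓ hm, r0, intervalIntegral.integral_congr (g := fun _ => (1 : ℂ))
      (fun x hx => hr' x (by rwa [uIcc_of_le hℓ.le] at hx))]
    simp
  let K : Submodule ℂ (EdgeL2 ℓ) := Submodule.span ℂ {Q, R}
  have : FiniteDimensional ℂ K := FiniteDimensional.span_of_finite ℂ (by simp)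
  set d := g - V with hd
  set w := d - K.starProjection d with hw
  have hwK : w ∈ Kᗮ := K.sub_starProjection_mem_orthogonal d
  have hwQ : ⟪w, Q⟫ = 0 := (K.mem_orthogonal' w).1 hwK Q (Submodule.subset_span (by simp))
  have hwR : ⟪w, R⟫ = 0 := (K.mem_orthogonal' w).1 hwK R (Submodule.subset_span (by simp))
  obtain ⟨f, u, u', hf, u0, u0'⟩ := exists_isEdgeH2_of_initial hℓ.le w 0 0
  -- Starting from zero initial data, orthogonality of `w` to the affine functions forces the data
  -- at `ℓ` to vanish as well, so `f` is an admissible test function.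
  have g1 := hf.green hℓ.le hQ
  have g2 := hf.green hℓ.le hR
  rw [hwQ, u0, u0', hqℓ, hq' ℓ hm] at g1
  have hu'ℓ : u' ℓ = 0 := by simpa using g1.symm
  rw [hwR, u0, u0', hr' ℓ hm, hu'ℓ] at g2
  have huℓ : u ℓ = 0 := by simpa using g2.symm
  have g3 := hf.green hℓ.le hV
  rw [u0, u0', huℓ, hu'ℓ] at g3
  have g4 := H f w u u' hf u0 u0' huℓ hu'ℓ
  have g5 : ⟪w, d⟫ = 0 := by
    rw [hd, inner_sub_right, g4]
    simp only [map_zero, zero_mul, sub_zero] at g3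
    linear_combination -g3
  have g6 : ⟪w, K.starProjection d⟫ = 0 :=
    (K.mem_orthogonal' w).1 hwK _ (K.starProjection_apply_mem d)
  have hw0 : w = 0 := by
    have : ⟪w, w⟫ = 0 := by
      conv_lhs => rw [hw]
      rw [← hw, inner_sub_right, g5, g6, sub_zero]
    exact inner_self_eq_zero.1 this
  have hdK : d ∈ K := by
    rw [sub_eq_zero.1 hw0]
    exact K.starProjection_apply_mem d
  obtain ⟨α, β, hαβ⟩ := Submodule.mem_span_pair.1 hdK
  have e1 : g = V + (α • Q + β • R) := by rw [hαβ, hd]; abel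
  have e2 := hV.add ((hQ.smul α).add (hR.smul β))
  exact ⟨_, _, by simpa [← e1] using e2⟩

end IsEdgeH2

/-! ### Decoration graphs: Green's identity, prescribed boundary data, weak regularity. -/

namespace FiniteMetricGraph

open scoped Classical in
theorem sum_conj_flux_mul (G : FiniteMetricGraph) [Fintype G.V] (u' : G.E → ℝ → ℂ) (c : G.V → ℂ) :
    ∑ v, conj (G.flux u' v) * c v =
      ∑ e, (conj (u' e (G.len e)) * c (G.tgt e) - conj (u' e 0) * c (G.src e)) := by
  simp only [flux, map_sub, map_sum, sub_mul, Finset.sum_mul, Finset.sum_sub_distrib]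
  congr 1
  all_goals
    rw [Finset.sum_comm]
    refine Finset.sum_congr rfl fun e _ => ?_
    rw [Finset.sum_eq_single_of_mem _ (Finset.mem_univ _)
      (fun v _ hv => by rw [if_neg (fun h => hv h.symm)]; simp), if_pos rfl]

end FiniteMetricGraph

namespace DecorationGraph

variable (Γ : DecorationGraph)

open scoped Classical in
/-- The number of edge ends at a vertex. -/
def endCount (v : Γ.V) : ℕ :=
  (Finset.univ.filter fun e => Γ.tgt e = v).card + (Finset.univ.filter fun e => Γ.src e = v).card

/-- Connectedness together with the existence of two distinct vertices excludes isolated vertices.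
This justifies averaging over the edge ends at a vertex. -/
theorem endCount_ne_zero (v : Γ.V) : Γ.endCount v ≠ 0 := by
  classical
  have key : ∀ (e : Γ.E), Γ.endCount (Γ.tgt e) ≠ 0 ∧ Γ.endCount (Γ.src e) ≠ 0 := by
    intro e
    have h1 : 0 < (Finset.univ.filter fun e' => Γ.tgt e' = Γ.tgt e).card :=
      Finset.card_pos.2 ⟨e, by simp⟩
    have h2 : 0 < (Finset.univ.filter fun e' => Γ.src e' = Γ.src e).card :=
      Finset.card_pos.2 ⟨e, by simp⟩
    unfold endCount
    constructor <;> omega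
  obtain ⟨w, hw⟩ : ∃ w, w ≠ v := by
    by_cases h : Γ.o₀ = v
    · exact ⟨Γ.o₁, fun h' => Γ.o₀_ne_o₁ (h.trans h'.symm)⟩
    · exact ⟨_, h⟩
  obtain ⟨r, hr⟩ := Γ.connected w v
  cases hr with
  | nil => exact absurd rfl hw
  | forward e r _ => exact (key e).1
  | backward e r _ => exact (key e).2

theorem exists_isEdgeH2 (a : Γ.V → ℂ) (S R : Γ.E → ℂ) :
    ∃ (f w : ∀ e : Γ.E, EdgeL2 (Γ.len e)) (u u' : Γ.E → ℝ → ℂ),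
      (∀ e, IsEdgeH2 (Γ.len e) (f e) (w e) (u e) (u' e)) ∧
      (∀ e, u e 0 = a (Γ.src e)) ∧ (∀ e, u e (Γ.len e) = a (Γ.tgt e)) ∧
      (∀ e, u' e 0 = S e) ∧ ∀ e, u' e (Γ.len e) = R e := by
  choose f w u u' h h1 h2 h3 h4 _ _ using fun e =>
    exists_isEdgeH2_of_boundary (Γ.len_pos e) (a (Γ.src e)) (S e) (a (Γ.tgt e)) (R e)
  exact ⟨f, w, u, u', h, h1, h3, h2, h4⟩

open scoped Classical in
theorem flux_eq_of_boundary {u' : Γ.E → ℝ → ℂ} {S R : Γ.E → ℂ} (hS : ∀ e, u' e 0 = S e)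
    (hR : ∀ e, u' e (Γ.len e) = R e) (v : Γ.V) :
    Γ.flux u' v = (∑ e, if Γ.tgt e = v then R e else 0) - ∑ e, if Γ.src e = v then S e else 0 := by
  simp only [FiniteMetricGraph.flux, hS, hR]

/-- All boundary data at the connecting vertices can be prescribed. -/
theorem exists_isH2_of_boundary (A₀ D₀ A₁ D₁ : ℂ) :
    ∃ f w u u' a, Γ.IsH2 f w u u' a ∧ a Γ.o₀ = A₀ ∧ Γ.dag₀ u' = D₀ ∧ a Γ.o₁ = A₁ ∧
      Γ.dag₁ u' a = D₁ := by
  classical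
  set a : Γ.V → ℂ := fun v => if v = Γ.o₀ then A₀ else if v = Γ.o₁ then A₁ else 0
  set φ : Γ.V → ℂ := fun v => if v = Γ.o₀ then -D₀ else if v = Γ.o₁ then D₁ - Γ.q * A₁ else 0
  -- The desired flux `φ v` is shared equally among the edge ends at `v`. Source ends get the
  -- opposite sign because the flux counts them negatively.
  obtain ⟨f, w, u, u', h, h1, h2, h3, h4⟩ := Γ.exists_isEdgeH2 a
    (fun e => -(φ (Γ.src e) / Γ.endCount (Γ.src e))) (fun e => φ (Γ.tgt e) / Γ.endCount (Γ.tgt e))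
  have hφ : ∀ v, Γ.flux u' v = φ v := by
    intro v
    have hc : (Γ.endCount v : ℂ) ≠ 0 := by exact_mod_cast Γ.endCount_ne_zero v
    rw [Γ.flux_eq_of_boundary h3 h4, ← Finset.sum_filter, ← Finset.sum_filter,
      Finset.sum_congr rfl (g := fun _ => φ v / Γ.endCount v)
        (fun e he => by rw [(Finset.mem_filter.1 he).2]),
      Finset.sum_congr (s₁ := Finset.univ.filter fun e => Γ.src e = v) rfl
        (g := fun _ => -(φ v / Γ.endCount v)) (fun e he => by rw [(Finset.mem_filter.1 he).2])]
    simp only [Finset.sum_const, nsmul_eq_mul]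
    rw [mul_neg, sub_neg_eq_add, ← add_mul, ← Nat.cast_add]
    exact mul_div_cancel₀ _ hc
  have ho := Γ.o₀_ne_o₁.symm
  refine ⟨f, w, u, u', a, ⟨h, h1, h2, fun v hv0 hv1 => ?_⟩, ?_, ?_, ?_, ?_⟩
  · rw [hφ]; simp [φ, hv0, hv1]
  · simp [a]
  · simp [dag₀, hφ, φ]
  · simp [a, ho]
  · simp [dag₁, hφ, φ, a, ho]

namespace IsH2

variable {Γ} {f w g v : ∀ e : Γ.E, EdgeL2 (Γ.len e)} {u u' p p' : Γ.E → ℝ → ℂ} {a c : Γ.V → ℂ}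

theorem sum_boundary (h : Γ.IsH2 f w u u' a) (c : Γ.V → ℂ) :
    ∑ e, (conj (u' e (Γ.len e)) * c (Γ.tgt e) - conj (u' e 0) * c (Γ.src e)) =
      conj (Γ.dag₁ u' a - Γ.q * a Γ.o₁) * c Γ.o₁ - conj (Γ.dag₀ u') * c Γ.o₀ := by
  have := Fintype.ofFinite Γ.V
  rw [← Γ.sum_conj_flux_mul u' c, Finset.sum_eq_add Γ.o₁ Γ.o₀ Γ.o₀_ne_o₁.symm
    (fun v _ hv => by rw [h.inner v hv.2 hv.1]; simp) (by simp) (by simp)]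
  simp [dag₀, dag₁]

/-- Green's identity on a decoration graph. -/
theorem green (h : Γ.IsH2 f w u u' a) (h₁ : Γ.IsH2 g v p p' c) :
    ∑ e, ⟪w e, g e⟫ - ∑ e, ⟪f e, v e⟫ =
      (conj (Γ.dag₁ u' a) * c Γ.o₁ - conj (a Γ.o₁) * Γ.dag₁ p' c) -
      (conj (Γ.dag₀ u') * c Γ.o₀ - conj (a Γ.o₀) * Γ.dag₀ p') := by
  have h1 := h.sum_boundary c
  have h2 := congrArg conj (h₁.sum_boundary a)
  rw [← Finset.sum_sub_distrib, Finset.sum_congr rfl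
    fun e _ => (h.edge e).green (Γ.len_pos e).le (h₁.edge e)]
  simp only [h.src, h.tgt, h₁.src, h₁.tgt]
  simp only [map_sum, map_sub, map_mul, Complex.conj_conj, Complex.conj_ofReal] at h1 h2
  rw [Finset.sum_congr rfl (g := fun e =>
    (conj (u' e (Γ.len e)) * c (Γ.tgt e) - conj (u' e 0) * c (Γ.src e)) -
    (p' e (Γ.len e) * conj (a (Γ.tgt e)) - p' e 0 * conj (a (Γ.src e)))) (fun e _ => by ring),
    Finset.sum_sub_distrib, h1, h2]
  ring

/-- The energy identity; it is the source of the bound on the derivative from which the sup bound is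
derived. -/
theorem sum_integral_deriv (h : Γ.IsH2 f w u u' a) :
    ∑ e, ∫ x in (0 : ℝ)..Γ.len e, conj (u' e x) * u' e x =
      conj (Γ.dag₁ u' a - Γ.q * a Γ.o₁) * a Γ.o₁ - conj (Γ.dag₀ u') * a Γ.o₀ -
        ∑ e, ⟪w e, f e⟫ := by
  rw [← h.sum_boundary a, ← Finset.sum_sub_distrib]
  refine Finset.sum_congr rfl fun e _ => ?_
  rw [(h.edge e).inner_deriv (Γ.len_pos e).le (h.edge e), h.src, h.tgt]
  ring

end IsH2

/-- A weak solution on a decoration graph, tested with all `H²` functions with vanishing boundary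
data at the connecting vertices, is in `H²`. -/
theorem exists_isH2_of_weak {g k : ∀ e : Γ.E, EdgeL2 (Γ.len e)}
    (H : ∀ f w u u' a, Γ.IsH2 f w u u' a → a Γ.o₀ = 0 → Γ.dag₀ u' = 0 → a Γ.o₁ = 0 →
      Γ.dag₁ u' a = 0 → ∑ e, ⟪w e, g e⟫ = ∑ e, ⟪f e, k e⟫) :
    ∃ p p' c, Γ.IsH2 g k p p' c := by
  classical
  have hedge : ∀ e, ∃ p p', IsEdgeH2 (Γ.len e) (g e) (k e) p p' := by
    intro e
    refine IsEdgeH2.exists_of_weak (Γ.len_pos e) fun f w u u' hf h0 h0' h1 h1' => ?_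
    have hval : ∀ (e' : Γ.E), (Pi.single e u : Γ.E → ℝ → ℂ) e' 0 = 0 ∧
        (Pi.single e u : Γ.E → ℝ → ℂ) e' (Γ.len e') = 0 ∧
        (Pi.single e u' : Γ.E → ℝ → ℂ) e' 0 = 0 ∧
        (Pi.single e u' : Γ.E → ℝ → ℂ) e' (Γ.len e') = 0 := by
      intro e'
      by_cases he : e' = e
      · subst he; simp [h0, h0', h1, h1']
      · simp [he]
    have hflux : ∀ v, Γ.flux (Pi.single e u') v = 0 := fun v => by
      simp [FiniteMetricGraph.flux, hval]
    have := H (Pi.single e f) (Pi.single e w) (Pi.single e u) (Pi.single e u') 0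
      ⟨fun e' => ?_, fun e' => (hval e').1, fun e' => (hval e').2.1, fun v _ _ => hflux v⟩
      rfl (by simp [dag₀, hflux]) rfl (by simp [dag₁, hflux])
    · rwa [Finset.sum_eq_single_of_mem e (Finset.mem_univ _) (fun e' _ he => by simp [he]),
        Finset.sum_eq_single_of_mem e (Finset.mem_univ _) (fun e' _ he => by simp [he]),
        Pi.single_eq_same, Pi.single_eq_same] at this
    · by_cases he : e' = e
      · subst he; simpa using hf
      · simpa [he] using IsEdgeH2.zero (Γ.len e')
  choose p p' hp using hedge
  -- Green's identity turns the weak equation into the vanishing of the boundary form for all test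
  -- data with zero flux at every vertex and zero values at `o₀` and `o₁`.
  have bdry : ∀ (a : Γ.V → ℂ) (S R : Γ.E → ℂ),
      (∀ v, (∑ e, if Γ.tgt e = v then R e else 0) - (∑ e, if Γ.src e = v then S e else 0) = 0) →
      a Γ.o₀ = 0 → a Γ.o₁ = 0 →
      ∑ e, ((conj (R e) * p e (Γ.len e) - conj (a (Γ.tgt e)) * p' e (Γ.len e)) -
        (conj (S e) * p e 0 - conj (a (Γ.src e)) * p' e 0)) = 0 := by
    intro a S R hfl h0 h1
    obtain ⟨f, w, u, u', h, e1, e2, e3, e4⟩ := Γ.exists_isEdgeH2 a S R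
    have hflux : ∀ v, Γ.flux u' v = 0 := fun v => by
      rw [Γ.flux_eq_of_boundary e3 e4]; exact hfl v
    have := H f w u u' a ⟨h, e1, e2, fun v _ _ => hflux v⟩ h0 (by simp [dag₀, hflux]) h1
      (by simp [dag₁, hflux, h1])
    rw [← sub_eq_zero, ← Finset.sum_sub_distrib, Finset.sum_congr rfl
      fun e _ => (h e).green (Γ.len_pos e).le (hp e)] at this
    simpa only [e1, e2, e3, e4] using this
  -- The candidate for the value at a vertex is the mean of the end values there. The deviations
  -- from the mean sum to zero at each vertex, so they are admissible as derivative data `R`, `S`.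
  set c : Γ.V → ℂ := fun v => ((∑ e, if Γ.tgt e = v then p e (Γ.len e) else 0) +
    ∑ e, if Γ.src e = v then p e 0 else 0) / Γ.endCount v with hc
  have hcv : ∀ v, (∑ e, if Γ.tgt e = v then (p e (Γ.len e) - c v) else 0) +
      (∑ e, if Γ.src e = v then (p e 0 - c v) else 0) = 0 := by
    intro v
    have hn : (Γ.endCount v : ℂ) ≠ 0 := by exact_mod_cast Γ.endCount_ne_zero v
    have : c v * Γ.endCount v = (∑ e, if Γ.tgt e = v then p e (Γ.len e) else 0) +
        ∑ e, if Γ.src e = v then p e 0 else 0 := by rw [hc]; exact div_mul_cancel₀ _ hn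
    simp only [← Finset.sum_filter, Finset.sum_sub_distrib, Finset.sum_const, nsmul_eq_mul] at this ⊢
    simp only [endCount, Nat.cast_add] at this
    linear_combination -this
  set R : Γ.E → ℂ := fun e => p e (Γ.len e) - c (Γ.tgt e) with hR
  set S : Γ.E → ℂ := fun e => -(p e 0 - c (Γ.src e)) with hS
  have hfl : ∀ v, (∑ e, if Γ.tgt e = v then R e else 0) -
      (∑ e, if Γ.src e = v then S e else 0) = 0 := by
    intro v
    refine Eq.trans ?_ (hcv v)
    rw [sub_eq_add_neg, ← Finset.sum_neg_distrib]
    congr 1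
    · refine Finset.sum_congr rfl fun e _ => ?_
      split_ifs with h
      · rw [hR, ← h]
      · rfl
    · refine Finset.sum_congr rfl fun e _ => ?_
      split_ifs with h
      · rw [hS, ← h]; simp
      · simp
  have hz : ∑ e, (conj (R e) * c (Γ.tgt e) - conj (S e) * c (Γ.src e)) = 0 := by
    have := Fintype.ofFinite Γ.V
    obtain ⟨f, w, u, u', h, e1, e2, e3, e4⟩ := Γ.exists_isEdgeH2 0 S R
    have := Γ.sum_conj_flux_mul u' c
    simp only [e3, e4, Γ.flux_eq_of_boundary e3 e4, hfl] at this
    rw [← this]; simp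
  -- Testing with the deviations themselves gives the sum of their squares; the contribution of `c`
  -- drops out by `hz`. So all deviations vanish, which is continuity.
  have hval : ∀ e, R e = 0 ∧ S e = 0 := by
    have h1 := bdry 0 S R hfl rfl rfl
    have h2 : ∑ e, ((‖R e‖ ^ 2 + ‖S e‖ ^ 2 : ℝ) : ℂ) = 0 := by
      rw [← h1, ← sub_zero (∑ e, ((conj (R e) * p e (Γ.len e) - _) - _)), ← hz,
        ← Finset.sum_sub_distrib]
      refine Finset.sum_congr rfl fun e _ => ?_
      push_cast
      rw [← Complex.conj_mul', ← Complex.conj_mul']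
      simp only [hR, hS, Pi.zero_apply, map_zero]
      ring
    rw [← Complex.ofReal_sum, Complex.ofReal_eq_zero,
      Finset.sum_eq_zero_iff_of_nonneg (fun e _ => by positivity)] at h2
    intro e
    have h3 := h2 e (Finset.mem_univ _)
    have h4 := sq_nonneg ‖R e‖
    have h5 := sq_nonneg ‖S e‖
    exact ⟨by rw [← norm_eq_zero, ← sq_eq_zero_iff]; linarith,
      by rw [← norm_eq_zero, ← sq_eq_zero_iff]; linarith⟩
  refine ⟨p, p', c, hp, fun e => ?_, fun e => ?_, fun v hv0 hv1 => ?_⟩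
  · have := (hval e).2
    rw [hS, neg_eq_zero, sub_eq_zero] at this
    exact this
  · exact sub_eq_zero.1 (hval e).1
  -- A test function equal to `1` at the inner vertex `v`, with zero derivatives at all edge ends,
  -- picks out the flux at `v`.
  · have h1 := bdry (Pi.single v 1) 0 0 (fun _ => by simp) (by simp [hv0.symm]) (by simp [hv1.symm])
    simp only [FiniteMetricGraph.flux]
    rw [← neg_eq_zero, neg_sub, ← Finset.sum_sub_distrib]
    refine Eq.trans (Finset.sum_congr rfl fun e _ => ?_) h1
    simp only [Pi.single_apply]
    split_ifs <;> (simp; try ring)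

/-- The oscillation of a function on the vertices of a connected graph is bounded by the sum of
its increments over all edges. -/
theorem norm_sub_le_sum {a : Γ.V → ℂ} {d : Γ.E → ℝ} (hd : ∀ e, ‖a (Γ.tgt e) - a (Γ.src e)‖ ≤ d e)
    (v w : Γ.V) : ‖a w - a v‖ ≤ ∑ e, d e := by
  classical
  have hd0 : ∀ e, 0 ≤ d e := fun e => (norm_nonneg _).trans (hd e)
  -- Take a maximal vertex set that is controlled by edges inside it. An edge leaving the set has
  -- not been used yet, so adding it counts no increment twice; by connectedness a maximal set
  -- contains every vertex.
  let P : Set Γ.V → Prop := fun S => v ∈ S ∧ ∃ A : Finset Γ.E,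
    (∀ e ∈ A, Γ.src e ∈ S ∧ Γ.tgt e ∈ S) ∧ ∀ x ∈ S, ‖a x - a v‖ ≤ ∑ e ∈ A, d e
  obtain ⟨S, hS⟩ := (Set.toFinite {S | P S}).exists_maximal
    ⟨{v}, rfl, ∅, by simp, by simp⟩
  obtain ⟨⟨hvS, A, hA, hb⟩, hmax⟩ := hS
  have step : ∀ (e : Γ.E) (x y : Γ.V), x ∈ S → ‖a y - a x‖ ≤ d e →
      ((Γ.src e = x ∧ Γ.tgt e = y) ∨ (Γ.src e = y ∧ Γ.tgt e = x)) → y ∈ S := by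
    intro e x y hx hxy he
    by_contra hy
    refine hy (hmax (y := insert y S) ⟨mem_insert_of_mem _ hvS, insert e A, ?_, ?_⟩
      (subset_insert _ _) (mem_insert _ _))
    · intro e' he'
      rcases Finset.mem_insert.1 he' with rfl | h
      · rcases he with ⟨h1, h2⟩ | ⟨h1, h2⟩ <;> simp [h1, h2, hx]
      · exact ⟨mem_insert_of_mem _ (hA e' h).1, mem_insert_of_mem _ (hA e' h).2⟩
    · have heA : e ∉ A := fun h => hy (by
        rcases he with ⟨_, h2⟩ | ⟨h1, _⟩
        · exact h2 ▸ (hA e h).2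
        · exact h1 ▸ (hA e h).1)
      intro z hz
      rw [Finset.sum_insert heA]
      rcases hz with rfl | hz
      · calc _ = ‖(a z - a x) + (a x - a v)‖ := by congr 1; ring
          _ ≤ _ := (norm_add_le _ _).trans (add_le_add hxy (hb x hx))
      · linarith [hb z hz, hd0 e]
  have hall : ∀ x r, Γ.HasWalk v x r → x ∈ S := by
    intro x r h
    induction h with
    | nil => exact hvS
    | forward e r _ ih => exact step e _ _ ih (hd e) (Or.inl ⟨rfl, rfl⟩)
    | backward e r _ ih =>
      exact step e _ _ ih (by rw [norm_sub_rev]; exact hd e) (Or.inr ⟨rfl, rfl⟩)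
  obtain ⟨r, hr⟩ := Γ.connected v w
  exact (hb w (hall w r hr)).trans
    (Finset.sum_le_sum_of_subset_of_nonneg (Finset.subset_univ _) fun e _ _ => hd0 e)

end DecorationGraph

/-! ### Weak solutions on line-like graphs. -/

namespace LineLike

variable {b : ℕ → ℕ} {Γ : ℕ → DecorationGraph} {n : ℕ}

theorem exists_mem_hamiltonianGraph_of_finset {f w : ∀ x : GraphEdge Γ n, EdgeL2 ((Γ x.1).len x.2)}
    {u u' : ∀ k, (Γ k).E → ℝ → ℂ} {a : ∀ k, (Γ k).V → ℂ} (h : IsH2 b Γ n f w u u' a)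
    (s : Finset (GraphEdge Γ n)) (hs : ∀ x ∉ s, f x = 0 ∧ w x = 0) :
    ∃ F ∈ hamiltonianGraph b Γ n, (∀ x, F.1 x = f x) ∧ ∀ x, F.2 x = -w x := by
  have mem : ∀ g : ∀ x : GraphEdge Γ n, EdgeL2 ((Γ x.1).len x.2), (∀ x ∉ s, g x = 0) →
      Memℓp g 2 := fun g hg =>
    memℓp_gen (summable_of_ne_finset_zero (s := s) fun x hx => by simp [hg x hx])
  refine ⟨(⟨f, mem f fun x hx => (hs x hx).1⟩, ⟨fun x => -w x, mem _ fun x hx => ?_⟩),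
    ⟨u, u', a, ?_⟩, fun x => rfl, fun x => rfl⟩
  · rw [(hs x hx).2, neg_zero]
  · simpa using h

/-- Testing a weak solution on a line-like graph with functions supported on two successive
decoration graphs. -/
theorem sum_inner_eq_of_weak {g h : ∀ x : GraphEdge Γ n, EdgeL2 ((Γ x.1).len x.2)}
    (H : ∀ (s : Finset (GraphEdge Γ n)), ∀ F ∈ hamiltonianGraph b Γ n,
      (∀ x ∉ s, F.1 x = 0 ∧ F.2 x = 0) → ∑ x ∈ s, ⟪F.2 x, g x⟫ = ∑ x ∈ s, ⟪F.1 x, h x⟫)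
    {k : ℕ} (hk : n < k) {f₀ w₀ u₀ u₀' a₀} (h₀ : (Γ k).IsH2 f₀ w₀ u₀ u₀' a₀)
    {f₁ w₁ u₁ u₁' a₁} (h₁ : (Γ (k + 1)).IsH2 f₁ w₁ u₁ u₁' a₁)
    (ha₀ : a₀ (Γ k).o₀ = 0) (hd₀ : k = n + 1 ∨ (Γ k).dag₀ u₀' = 0)
    (ha₁ : a₁ (Γ (k + 1)).o₁ = 0) (hd₁ : (Γ (k + 1)).dag₁ u₁' a₁ = 0)
    (hv : a₀ (Γ k).o₁ = ((Real.sqrt (b k))⁻¹ : ℝ) * a₁ (Γ (k + 1)).o₀)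
    (hd : (Γ k).dag₁ u₀' a₀ = (Real.sqrt (b k) : ℝ) * (Γ (k + 1)).dag₀ u₁') :
    ∑ e, ⟪w₀ e, g ⟨⟨k, hk⟩, e⟩⟫ + ∑ e, ⟪w₁ e, g ⟨⟨k + 1, hk.trans k.lt_succ_self⟩, e⟩⟫ =
      ∑ e, ⟪f₀ e, -h ⟨⟨k, hk⟩, e⟩⟫ + ∑ e, ⟪f₁ e, -h ⟨⟨k + 1, hk.trans k.lt_succ_self⟩, e⟩⟫ := by
  classical
  have hk1 : k + 1 ≠ k := by omega
  set f : ∀ j, ∀ e : (Γ j).E, EdgeL2 ((Γ j).len e) :=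
    Function.update (Function.update (fun _ _ => 0) k f₀) (k + 1) f₁
  set w : ∀ j, ∀ e : (Γ j).E, EdgeL2 ((Γ j).len e) :=
    Function.update (Function.update (fun _ _ => 0) k w₀) (k + 1) w₁
  set u : ∀ j, (Γ j).E → ℝ → ℂ :=
    Function.update (Function.update (fun _ => 0) k u₀) (k + 1) u₁
  set u' : ∀ j, (Γ j).E → ℝ → ℂ :=
    Function.update (Function.update (fun _ => 0) k u₀') (k + 1) u₁'
  set a : ∀ j, (Γ j).V → ℂ :=
    Function.update (Function.update (fun _ => 0) k a₀) (k + 1) a₁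
  have e0 : f k = f₀ ∧ w k = w₀ ∧ u k = u₀ ∧ u' k = u₀' ∧ a k = a₀ := by
    simp [f, w, u, u', a]
  have e1 : f (k + 1) = f₁ ∧ w (k + 1) = w₁ ∧ u (k + 1) = u₁ ∧ u' (k + 1) = u₁' ∧
      a (k + 1) = a₁ := by
    simp [f, w, u, u', a]
  have e2 : ∀ j, j ≠ k → j ≠ k + 1 → f j = 0 ∧ w j = 0 ∧ u j = 0 ∧ u' j = 0 ∧ a j = 0 := by
    intro j hj hj'
    simp only [f, w, u, u', a, Function.update_of_ne hj, Function.update_of_ne hj']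
    exact ⟨rfl, rfl, trivial, trivial, trivial⟩
  have hH2 : IsH2 b Γ n (fun x => f x.1 x.2) (fun x => w x.1 x.2) u u' a := by
    refine ⟨?_, ?_, ?_, ?_⟩
    · rintro ⟨j, hj⟩
      by_cases hjk : j = k
      · subst hjk
        simpa only [e0] using h₀
      by_cases hjk' : j = k + 1
      · subst hjk'
        simpa only [e1] using h₁
      simpa only [e2 j hjk hjk'] using DecorationGraph.IsH2.zero (Γ j)
    · by_cases hjk : n + 1 = k
      · subst hjk; rw [e0.2.2.2.2, ha₀]
      · rw [(e2 (n + 1) hjk (by omega)).2.2.2.2]; rfl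
    · intro j hj
      by_cases hjk : j = k
      · subst hjk; rw [e0.2.2.2.2, e1.2.2.2.2, hv]
      by_cases hjk' : j = k + 1
      · subst hjk'
        rw [e1.2.2.2.2, ha₁, (e2 (k + 1 + 1) (by omega) (by omega)).2.2.2.2]; simp
      rw [(e2 j hjk hjk').2.2.2.2]
      by_cases hjk2 : j + 1 = k
      · subst hjk2; rw [e0.2.2.2.2, ha₀]; simp
      · rw [(e2 (j + 1) hjk2 (by omega)).2.2.2.2]; simp
    · intro j hj
      by_cases hjk : j = k
      · subst hjk; rw [e0.2.2.2.2, e0.2.2.2.1, e1.2.2.2.1, hd]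
      by_cases hjk' : j = k + 1
      · subst hjk'
        rw [e1.2.2.2.2, e1.2.2.2.1, hd₁, (e2 (k + 1 + 1) (by omega) (by omega)).2.2.2.1]
        simp [DecorationGraph.dag₀_zero]
      rw [(e2 j hjk hjk').2.2.2.2, (e2 j hjk hjk').2.2.2.1, DecorationGraph.dag₁_zero]
      by_cases hjk2 : j + 1 = k
      · subst hjk2
        rw [e0.2.2.2.1, hd₀.resolve_left (by omega)]; simp
      · rw [(e2 (j + 1) hjk2 (by omega)).2.2.2.1]; simp [DecorationGraph.dag₀_zero]
  set s : Finset (GraphEdge Γ n) := Finset.sigma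
    {(⟨k, hk⟩ : Ioi n), (⟨k + 1, hk.trans k.lt_succ_self⟩ : Ioi n)} (fun _ => Finset.univ)
  obtain ⟨F, hF, hF1, hF2⟩ := exists_mem_hamiltonianGraph_of_finset hH2 s (by
    rintro ⟨⟨j, hj⟩, e⟩ hx
    have hne : j ≠ k ∧ j ≠ k + 1 := ⟨fun h => hx (by subst h; simp [s]), fun h => hx (by subst h; simp [s])⟩
    exact ⟨congrFun (e2 j hne.1 hne.2).1 e, congrFun (e2 j hne.1 hne.2).2.1 e⟩)
  have hz : ∀ x ∉ s, F.1 x = 0 ∧ F.2 x = 0 := by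
    rintro ⟨⟨j, hj⟩, e⟩ hx
    have hne : j ≠ k ∧ j ≠ k + 1 := ⟨fun h => hx (by subst h; simp [s]), fun h => hx (by subst h; simp [s])⟩
    rw [hF1, hF2]
    exact ⟨congrFun (e2 j hne.1 hne.2).1 e,
      neg_eq_zero.2 (congrFun (e2 j hne.1 hne.2).2.1 e)⟩
  have := H s F hF hz
  simp only [hF1, hF2, s, Finset.sum_sigma] at this
  have hne : (⟨k, hk⟩ : Ioi n) ≠ ⟨k + 1, hk.trans k.lt_succ_self⟩ := fun h =>
    hk1.symm (congrArg Subtype.val h)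
  rw [Finset.sum_pair hne, Finset.sum_pair hne] at this
  simp only [e0, e1, inner_neg_left, Finset.sum_neg_distrib] at this
  simp only [inner_neg_right, Finset.sum_neg_distrib]
  linear_combination -this

/-- A weak solution on a line-like graph, tested with the finitely supported elements of the
domain of the Hamiltonian, satisfies all local conditions of the domain. -/
theorem exists_isH2_of_weak (hb : ∀ k, n < k → 1 ≤ b k)
    {g h : ∀ x : GraphEdge Γ n, EdgeL2 ((Γ x.1).len x.2)}
    (H : ∀ (s : Finset (GraphEdge Γ n)), ∀ F ∈ hamiltonianGraph b Γ n,
      (∀ x ∉ s, F.1 x = 0 ∧ F.2 x = 0) → ∑ x ∈ s, ⟪F.2 x, g x⟫ = ∑ x ∈ s, ⟪F.1 x, h x⟫) :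
    ∃ p p' c, IsH2 b Γ n g (fun x => -h x) p p' c := by
  have hdeco : ∀ k, ∃ p p' c, ∀ hk : n < k,
      (Γ k).IsH2 (fun e => g ⟨⟨k, hk⟩, e⟩) (fun e => -h ⟨⟨k, hk⟩, e⟩) p p' c := by
    intro k
    by_cases hk : n < k
    · obtain ⟨p, p', c, hp⟩ := (Γ k).exists_isH2_of_weak (g := fun e => g ⟨⟨k, hk⟩, e⟩)
        (k := fun e => -h ⟨⟨k, hk⟩, e⟩) (fun f w u u' a hf h0 h0' h1 h1' => by
          have := sum_inner_eq_of_weak H hk hf (DecorationGraph.IsH2.zero (Γ (k + 1))) h0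
            (Or.inr h0') rfl (DecorationGraph.dag₁_zero _) (by simp [h1])
            (by simp [h1', DecorationGraph.dag₀_zero])
          simpa using this)
      exact ⟨p, p', c, fun _ => hp⟩
    · exact ⟨0, 0, 0, fun hk' => absurd hk' hk⟩
  choose p p' c hp using hdeco
  -- The boundary form at the junction of `G_k` and `G_{k+1}` vanishes for all test data obeying the
  -- junction conditions; at the starting vertex the derivative datum `D₀` is free. Suitable choices
  -- of data then isolate the Dirichlet condition and each of the two weighted conditions.
  have junction : ∀ k (hk : n < k) (D₀ A₁ D₁ A D : ℂ), (k = n + 1 ∨ D₀ = 0) →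
      A₁ = ((Real.sqrt (b k))⁻¹ : ℝ) * A → D₁ = (Real.sqrt (b k) : ℝ) * D →
      conj D₁ * c k (Γ k).o₁ - conj A₁ * (Γ k).dag₁ (p' k) (c k) - conj D₀ * c k (Γ k).o₀ -
        (conj D * c (k + 1) (Γ (k + 1)).o₀ - conj A * (Γ (k + 1)).dag₀ (p' (k + 1))) = 0 := by
    intro k hk D₀ A₁ D₁ A D hD₀ hA hD
    obtain ⟨f₀, w₀, u₀, u₀', a₀, h₀, r1, r2, r3, r4⟩ := (Γ k).exists_isH2_of_boundary 0 D₀ A₁ D₁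
    obtain ⟨f₁, w₁, u₁, u₁', a₁, h₁, t1, t2, t3, t4⟩ :=
      (Γ (k + 1)).exists_isH2_of_boundary A D 0 0
    have e := sum_inner_eq_of_weak H hk h₀ h₁ r1 (by rwa [r2]) t3 t4 (by rw [r3, t1, hA])
      (by rw [r4, t2, hD])
    have g1 := h₀.green (hp k hk)
    have g2 := h₁.green (hp (k + 1) (hk.trans k.lt_succ_self))
    rw [r1, r2, r3, r4] at g1
    rw [t1, t2, t3, t4] at g2
    simp only [map_zero, zero_mul] at g1 g2
    linear_combination e - g1 - g2
  have hsq : ∀ k, n < k → (Real.sqrt (b k) : ℂ) ≠ 0 := fun k hk => by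
    have : 0 < Real.sqrt (b k) := Real.sqrt_pos.2 (by exact_mod_cast hb k hk)
    exact_mod_cast this.ne'
  refine ⟨p, p', c, fun k => hp k.1 k.2, ?_, fun k hk => ?_, fun k hk => ?_⟩
  · have := junction (n + 1) n.lt_succ_self 1 0 0 0 0 (Or.inl rfl) (by simp) (by simp)
    simpa using this
  · have := junction k hk 0 0 (Real.sqrt (b k) : ℝ) 0 1 (Or.inr rfl) (by simp) (by simp)
    simp only [Complex.conj_ofReal, map_zero, map_one] at this
    have h0 := hsq k hk
    push_cast
    field_simp
    linear_combination this
  · have := junction k hk 0 ((Real.sqrt (b k))⁻¹ : ℝ) 0 1 0 (Or.inr rfl) (by simp) (by simp)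
    simp only [Complex.conj_ofReal, map_zero, map_one] at this
    have h0 := hsq k hk
    push_cast at this ⊢
    field_simp at this
    linear_combination -this

end LineLike

/-! ### Self-adjoint relations and self-adjoint operators. -/

/-- A linear relation which coincides with its adjoint. -/
def IsSelfAdjointRelation {K : Type*} [NormedAddCommGroup K] [InnerProductSpace ℂ K]
    (G : Submodule ℂ (K × K)) : Prop :=
  ∀ x y, (x, y) ∈ G ↔ ∀ p q, (p, q) ∈ G → ⟪q, x⟫ = ⟪p, y⟫

/-- Density of the domain is automatic: if `y` is orthogonal to the domain, then `(0, y)` belongs to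
the adjoint relation, hence to the graph, and so `y = 0`. -/
theorem isSelfAdjoint_of_graph {K : Type*} [NormedAddCommGroup K] [InnerProductSpace ℂ K]
    [CompleteSpace K] {A : K →ₗ.[ℂ] K} (h : IsSelfAdjointRelation A.graph) :
    IsSelfAdjoint A := by
  have hd : Dense (A.domain : Set K) := by
    rw [Submodule.dense_iff_topologicalClosure_eq_top, Submodule.topologicalClosure_eq_top_iff,
      Submodule.eq_bot_iff]
    intro y hy
    have : ((0 : K), y) ∈ A.graph := (h 0 y).2 fun p q hpq => by
      rw [inner_zero_right, (Submodule.mem_orthogonal _ _).1 hy p (LinearPMap.mem_domain_of_mem_graph hpq)]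
    exact LinearPMap.graph_fst_eq_zero_snd A this rfl
  rw [LinearPMap.isSelfAdjoint_def]
  refine LinearPMap.eq_of_eq_graph ?_
  rw [LinearPMap.adjoint_graph_eq_graph_adjoint hd]
  ext ⟨x, y⟩
  rw [Submodule.mem_adjoint_iff, h x y]
  simp only [sub_eq_zero]

/-! ### Boundary estimates and self-adjointness of uniform line-like Hamiltonians. -/

namespace UniformDecoration

variable {Γ : ℕ → DecorationGraph} {ℓm ℓp κ qm qp : ℝ}

/-- The boundary values at `o₀` are controlled by the `L²` norms on the edge at `o₀`. -/
theorem exists_first_edge (hU : UniformDecoration Γ ℓm ℓp κ qm qp) (hℓm : 0 < ℓm) (hκ : 0 < κ)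
    {k : ℕ} (hk : 1 ≤ k) : ∃ e : (Γ k).E, ∀ f w u u' a, (Γ k).IsH2 f w u u' a →
      ‖a (Γ k).o₀‖ ≤ traceConst (κ * ℓm) ℓp * (‖f e‖ + ‖w e‖) ∧
      ‖(Γ k).dag₀ u'‖ ≤ traceConst (κ * ℓm) ℓp * (‖f e‖ + ‖w e‖) := by
  classical
  have hdeg := hU.degree_eq k hk
  have hlen : ∀ e, (Γ k).len e ≤ ℓp := fun e =>
    (Finset.single_le_sum (fun e _ => ((Γ k).len_pos e).le) (Finset.mem_univ e)).trans
      (hU.volume_le k hk)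
  have hpos : 0 < κ * ℓm := mul_pos hκ hℓm
  -- Exactly one edge end meets `o₀`, so `dag₀` is, up to sign, one edge derivative. The two cases
  -- are the orientations of that edge.
  rw [FiniteMetricGraph.degree, Nat.add_eq_one_iff] at hdeg
  rcases hdeg with ⟨h0, h1⟩ | ⟨h1, h0⟩
  · obtain ⟨⟨e, he⟩, hu⟩ := Nat.card_eq_one_iff_exists.1 h1
    have hs : ∀ e', (Γ k).src e' ≠ (Γ k).o₀ := fun e' h' => by
      rw [Nat.card_eq_zero] at h0
      rcases h0 with h0 | h0
      · exact h0.false ⟨e', h'⟩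
      · exact h0.not_finite inferInstance
    have ht : ∀ e', (Γ k).tgt e' = (Γ k).o₀ → e' = e := fun e' h' =>
      congrArg Subtype.val (hu ⟨e', h'⟩)
    refine ⟨e, fun f w u u' a h => ?_⟩
    have hb := ((h.edge e).norm_boundary_le hpos (hU.len_ge k hk e (Or.inr he)) (hlen e)).2
    rw [h.tgt, he] at hb
    refine ⟨hb.1, ?_⟩
    have : (Γ k).dag₀ u' = -u' e ((Γ k).len e) := by
      simp only [DecorationGraph.dag₀, FiniteMetricGraph.flux, hs, if_false,
        Finset.sum_const_zero, sub_zero]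
      rw [Finset.sum_eq_single_of_mem e (Finset.mem_univ _)
        (fun e' _ hne => if_neg fun h' => hne (ht e' h')), if_pos he]
    rw [this, norm_neg]
    exact hb.2
  · obtain ⟨⟨e, he⟩, hu⟩ := Nat.card_eq_one_iff_exists.1 h1
    have hs : ∀ e', (Γ k).tgt e' ≠ (Γ k).o₀ := fun e' h' => by
      rw [Nat.card_eq_zero] at h0
      rcases h0 with h0 | h0
      · exact h0.false ⟨e', h'⟩
      · exact h0.not_finite inferInstance
    have ht : ∀ e', (Γ k).src e' = (Γ k).o₀ → e' = e := fun e' h' =>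
      congrArg Subtype.val (hu ⟨e', h'⟩)
    refine ⟨e, fun f w u u' a h => ?_⟩
    have hb := ((h.edge e).norm_boundary_le hpos (hU.len_ge k hk e (Or.inl he)) (hlen e)).1
    rw [h.src, he] at hb
    refine ⟨hb.1, ?_⟩
    have : (Γ k).dag₀ u' = u' e 0 := by
      simp only [DecorationGraph.dag₀, FiniteMetricGraph.flux, hs, if_false,
        Finset.sum_const_zero, zero_sub, neg_neg]
      rw [Finset.sum_eq_single_of_mem e (Finset.mem_univ _)
        (fun e' _ hne => if_neg fun h' => hne (ht e' h')), if_pos he]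
    rw [this]
    exact hb.2

end UniformDecoration

namespace LineLike

variable {b : ℕ → ℕ} {Γ : ℕ → DecorationGraph} {n : ℕ} {ℓm ℓp κ qm qp : ℝ}

/-- The decoration graphs of `L_n`, counted from `0`. -/
def natEquivIoi (n : ℕ) : ℕ ≃ Ioi n where
  toFun j := ⟨n + 1 + j, by simp only [mem_Ioi]; omega⟩
  invFun k := k.1 - (n + 1)
  left_inv j := by simp
  right_inv k := Subtype.ext (by have := k.2; simp only [mem_Ioi] at this; simp only; omega)

theorem traceConst_nonneg {L₀ L₁ : ℝ} (h : 0 ≤ L₁) : 0 ≤ traceConst L₀ L₁ := by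
  unfold traceConst; positivity

/-- The Hamiltonian of a uniform line-like graph is symmetric. -/
theorem inner_eq_inner_of_mem (hb : ∀ k, n < k → 1 ≤ b k)
    (hU : UniformDecoration Γ ℓm ℓp κ qm qp) (hℓm : 0 < ℓm) (hℓp : 0 < ℓp) (hκ : 0 < κ)
    {F F' : L2 Γ n × L2 Γ n} (hF : F ∈ hamiltonianGraph b Γ n)
    (hF' : F' ∈ hamiltonianGraph b Γ n) : ⟪F.2, F'.1⟫ = ⟪F.1, F'.2⟫ := by
  obtain ⟨u, u', a, h⟩ := hF
  obtain ⟨p, p', c, h'⟩ := hF'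
  set K := traceConst (κ * ℓm) ℓp
  have hK : 0 ≤ K := traceConst_nonneg hℓp.le
  set φ : Ioi n → ℂ := fun k => ∑ e, ⟪F.2 ⟨k, e⟩, F'.1 ⟨k, e⟩⟫ - ∑ e, ⟪F.1 ⟨k, e⟩, F'.2 ⟨k, e⟩⟫
  have hs : HasSum φ (⟪F.2, F'.1⟫ - ⟪F.1, F'.2⟫) := by
    have h1 : HasSum (fun x : GraphEdge Γ n => ⟪F.2 x, F'.1 x⟫ - ⟪F.1 x, F'.2 x⟫)
        (⟪F.2, F'.1⟫ - ⟪F.1, F'.2⟫) := by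
      have h1 : HasSum (fun x : GraphEdge Γ n => ⟪F.2 x, F'.1 x⟫) ⟪F.2, F'.1⟫ :=
        lp.hasSum_inner F.2 F'.1
      have h2 : HasSum (fun x : GraphEdge Γ n => ⟪F.1 x, F'.2 x⟫) ⟪F.1, F'.2⟫ :=
        lp.hasSum_inner F.1 F'.2
      exact h1.sub h2
    refine HasSum.sigma h1 fun k => ?_
    simp only [φ, ← Finset.sum_sub_distrib]
    exact hasSum_fintype _
  -- The Wronskian at `o₀` of `G_k`. The factors `(b k)^(-1/2)` and `(b k)^(1/2)` cancel in it
  -- across a junction, so Green's identity telescopes.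
  set W : ℕ → ℂ := fun k => conj ((Γ k).dag₀ (u' k)) * c k (Γ k).o₀ -
    conj (a k (Γ k).o₀) * (Γ k).dag₀ (p' k)
  have hsq : ∀ k, n < k → (Real.sqrt (b k) : ℂ) ≠ 0 := fun k hk => by
    have : 0 < Real.sqrt (b k) := Real.sqrt_pos.2 (by exact_mod_cast hb k hk)
    exact_mod_cast this.ne'
  have hφ : ∀ k : Ioi n, φ k = W k - W (k + 1) := by
    intro k
    have g := (h.deco k).green (h'.deco k)
    simp only [inner_neg_left, inner_neg_right, Finset.sum_neg_distrib, sub_neg_eq_add] at g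
    rw [h.value k k.2, h.deriv k k.2, h'.value k k.2, h'.deriv k k.2] at g
    simp only [φ, W]
    simp only [map_mul, Complex.conj_ofReal] at g
    have h0 := hsq k k.2
    push_cast at g
    field_simp at g
    linear_combination -g
  have hW0 : W (n + 1) = 0 := by simp only [W, h.start, h'.start]; simp
  have hsum : ∀ N, ∑ j ∈ Finset.range N, φ (natEquivIoi n j) = -W (n + 1 + N) := by
    intro N
    induction N with
    | zero => simp [hW0]
    | succ N ih =>
      rw [Finset.sum_range_succ, ih, hφ]
      simp only [natEquivIoi, Equiv.coe_fn_mk]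
      rw [show n + 1 + (N + 1) = n + 1 + N + 1 by ring]
      ring
  have ht := ((natEquivIoi n).hasSum_iff.2 hs).tendsto_sum_nat
  simp only [Function.comp_apply, hsum] at ht
  choose e he using fun k : Ioi n => hU.exists_first_edge hℓm hκ (Nat.one_le_of_lt k.2)
  have hinj : Function.Injective fun j : ℕ =>
      (⟨natEquivIoi n j, e (natEquivIoi n j)⟩ : GraphEdge Γ n) := fun j j' hjj =>
    (natEquivIoi n).injective (congrArg Sigma.fst hjj)
  have hz : ∀ f : L2 Γ n, Filter.Tendsto
      (fun j => ‖f ⟨natEquivIoi n j, e (natEquivIoi n j)⟩‖) Filter.atTop (nhds 0) := by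
    intro f
    have h1 := ((lp.memℓp f).summable (by norm_num)).comp_injective hinj
    have h2 := h1.tendsto_atTop_zero
    simp only [ENNReal.toReal_ofNat, Real.rpow_two] at h2
    simpa [Real.sqrt_sq] using h2.sqrt
  -- The Wronskian is bounded by norms on the edges at `o₀`, which tend to zero along the line
  -- because they are square summable.
  have hlim : Filter.Tendsto (fun j => W (n + 1 + j)) Filter.atTop (nhds 0) := by
    have hA := (((hz F.1).add (hz F.2)).const_mul K).mul (((hz F'.1).add (hz F'.2)).const_mul K)
    have hB := hA.const_mul 2
    simp only [add_zero, mul_zero] at hB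
    refine squeeze_zero_norm (fun j => ?_) hB
    have b1 := he (natEquivIoi n j) _ _ _ _ _ (h.deco (natEquivIoi n j))
    have b2 := he (natEquivIoi n j) _ _ _ _ _ (h'.deco (natEquivIoi n j))
    simp only [norm_neg] at b1 b2
    change ‖W (natEquivIoi n j)‖ ≤ _
    simp only [W]
    calc _ ≤ _ := norm_sub_le _ _
      _ ≤ K * (‖F.1 ⟨natEquivIoi n j, e (natEquivIoi n j)⟩‖ +
            ‖F.2 ⟨natEquivIoi n j, e (natEquivIoi n j)⟩‖) *
          (K * (‖F'.1 ⟨natEquivIoi n j, e (natEquivIoi n j)⟩‖ +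
            ‖F'.2 ⟨natEquivIoi n j, e (natEquivIoi n j)⟩‖)) +
          K * (‖F.1 ⟨natEquivIoi n j, e (natEquivIoi n j)⟩‖ +
            ‖F.2 ⟨natEquivIoi n j, e (natEquivIoi n j)⟩‖) *
          (K * (‖F'.1 ⟨natEquivIoi n j, e (natEquivIoi n j)⟩‖ +
            ‖F'.2 ⟨natEquivIoi n j, e (natEquivIoi n j)⟩‖)) := by
          rw [norm_mul, norm_mul, RCLike.norm_conj, RCLike.norm_conj]
          exact add_le_add
            (mul_le_mul b1.2 b2.1 (norm_nonneg _) (by positivity))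
            (mul_le_mul b1.1 b2.2 (norm_nonneg _) (by positivity))
      _ = _ := by ring
  have := tendsto_nhds_unique ht (by simpa using hlim.neg)
  exact sub_eq_zero.1 this

/-- Symmetry gives one inclusion. For the other, finitely supported tests already force the local
conditions, and square integrability is part of the ambient space. -/
theorem isSelfAdjointRelation_hamiltonianGraph (hb : ∀ k, n < k → 1 ≤ b k)
    (hU : UniformDecoration Γ ℓm ℓp κ qm qp) (hℓm : 0 < ℓm) (hℓp : 0 < ℓp) (hκ : 0 < κ) :
    IsSelfAdjointRelation (hamiltonianGraph b Γ n) := by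
  intro x y
  refine ⟨fun h p q hpq => inner_eq_inner_of_mem hb hU hℓm hℓp hκ hpq h, fun H => ?_⟩
  refine exists_isH2_of_weak hb fun s F hF hs => ?_
  have h1 : ∀ (f g : L2 Γ n), (∀ x ∉ s, f x = 0) → ⟪f, g⟫ = ∑ x ∈ s, ⟪f x, g x⟫ := by
    intro f g hf
    rw [lp.inner_eq_tsum, tsum_eq_sum]
    intro x hx
    rw [hf x hx, inner_zero_left]
  rw [← h1 _ _ fun x hx => (hs x hx).2, ← h1 _ _ fun x hx => (hs x hx).1]
  exact H F.1 F.2 hF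

end LineLike

/-! ### Uniform boundedness of domain elements. -/

namespace LineLike

variable {b : ℕ → ℕ} {Γ : ℕ → DecorationGraph} {n : ℕ} {ℓm ℓp κ qm qp : ℝ}

theorem sum_sq_norm_le (F : L2 Γ n) (k : Ioi n) : ∑ e, ‖F ⟨k, e⟩‖ ^ 2 ≤ ‖F‖ ^ 2 := by
  have h1 := lp.sum_rpow_le_norm_rpow (p := 2) (by norm_num) F
    (Finset.univ.map ⟨fun e : (Γ k).E => (⟨k, e⟩ : GraphEdge Γ n), fun _ _ h =>
      eq_of_heq (Sigma.mk.inj h).2⟩)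
  rw [Finset.sum_map] at h1
  simp only [ENNReal.toReal_ofNat, Real.rpow_two] at h1
  exact h1

theorem norm_apply_le (F : L2 Γ n) (x : GraphEdge Γ n) : ‖F x‖ ≤ ‖F‖ :=
  lp.norm_apply_le_norm (by norm_num) F x

/-- The energy of an element of the domain on one decoration graph. -/
theorem exists_energy_bound (hb : ∀ k, n < k → 1 ≤ b k)
    (hU : UniformDecoration Γ ℓm ℓp κ qm qp) (hℓm : 0 < ℓm) (hℓp : 0 < ℓp) (hκ : 0 < κ) :
    ∃ C, 0 ≤ C ∧ ∀ (F : L2 Γ n × L2 Γ n) (u u' : ∀ k, (Γ k).E → ℝ → ℂ) (a : ∀ k, (Γ k).V → ℂ),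
      IsH2 b Γ n (fun x => F.1 x) (fun x => -F.2 x) u u' a → ∀ k, n < k →
        ‖a k (Γ k).o₀‖ ≤ C * (‖F.1‖ + ‖F.2‖) ∧
        ∑ e, ∫ x in (0 : ℝ)..(Γ k).len e, ‖u' k e x‖ ^ 2 ≤ C * (‖F.1‖ + ‖F.2‖) ^ 2 := by
  set K := traceConst (κ * ℓm) ℓp
  have hK : 0 ≤ K := traceConst_nonneg hℓp.le
  set Q := max |qm| |qp|
  have hQ : 0 ≤ Q := (abs_nonneg _).trans (le_max_left _ _)
  -- `K` bounds the value at `o₀`. In the energy, `2 * K ^ 2` covers the two boundary terms, `Q * K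
  -- ^ 2` the vertex potential, and `1` the inner product of the function with its image.
  refine ⟨K + (2 * K ^ 2 + Q * K ^ 2 + 1), by positivity, fun F u u' a h k hk => ?_⟩
  set N := ‖F.1‖ + ‖F.2‖ with hN
  have hN0 : 0 ≤ N := by positivity
  have tr : ∀ j, n < j → ‖a j (Γ j).o₀‖ ≤ K * N ∧ ‖(Γ j).dag₀ (u' j)‖ ≤ K * N := by
    intro j hj
    obtain ⟨e, he⟩ := hU.exists_first_edge hℓm hκ (Nat.one_le_of_lt hj)
    have := he _ _ _ _ _ (h.deco ⟨j, hj⟩)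
    simp only [norm_neg] at this
    have hle : ‖F.1 ⟨⟨j, hj⟩, e⟩‖ + ‖F.2 ⟨⟨j, hj⟩, e⟩‖ ≤ N :=
      add_le_add (norm_apply_le _ _) (norm_apply_le _ _)
    exact ⟨this.1.trans (by gcongr), this.2.trans (by gcongr)⟩
  obtain ⟨t1, t2⟩ := tr k hk
  obtain ⟨t3, t4⟩ := tr (k + 1) (hk.trans k.lt_succ_self)
  refine ⟨t1.trans (by gcongr; linarith [show 0 ≤ 2 * K ^ 2 + Q * K ^ 2 + 1 by positivity]), ?_⟩
  have hs1 : 1 ≤ Real.sqrt (b k) := Real.one_le_sqrt.2 (by exact_mod_cast hb k hk)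
  have hs0 : (Real.sqrt (b k) : ℂ) ≠ 0 := by exact_mod_cast (zero_lt_one.trans_le hs1).ne'
  have en := (h.deco ⟨k, hk⟩).sum_integral_deriv
  have hlhs : ∑ e, ∫ x in (0 : ℝ)..(Γ k).len e, conj (u' k e x) * u' k e x =
      ((∑ e, ∫ x in (0 : ℝ)..(Γ k).len e, ‖u' k e x‖ ^ 2 : ℝ) : ℂ) := by
    push_cast
    refine Finset.sum_congr rfl fun e _ => ?_
    rw [← intervalIntegral.integral_ofReal]
    congr 1; funext x
    rw [Complex.conj_mul']; push_cast; rfl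
  -- The product of `f†` and `f` is continuous across the junction, so the terms at `o₁` are
  -- estimated at `o₀` of the next decoration graph, where the trace estimate is available.
  have hprod : conj ((Γ k).dag₁ (u' k) (a k)) * a k (Γ k).o₁ =
      conj ((Γ (k + 1)).dag₀ (u' (k + 1))) * a (k + 1) (Γ (k + 1)).o₀ := by
    rw [h.value k hk, h.deriv k hk, map_mul, Complex.conj_ofReal]
    push_cast
    field_simp
  have ha1 : ‖a k (Γ k).o₁‖ ≤ K * N := by
    rw [h.value k hk, norm_mul, Complex.norm_real, norm_inv,
      Real.norm_of_nonneg (Real.sqrt_nonneg _)]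
    calc _ ≤ 1 * ‖a (k + 1) (Γ (k + 1)).o₀‖ := by
          gcongr; exact inv_le_one_of_one_le₀ hs1
      _ ≤ _ := by rwa [one_mul]
  have hq : ‖((Γ k).q : ℂ)‖ ≤ Q := by
    rw [Complex.norm_real, Real.norm_eq_abs]
    have h1 := hU.potential_ge k (Nat.one_le_of_lt hk)
    have h2 := hU.potential_le k (Nat.one_le_of_lt hk)
    exact abs_le_max_abs_abs h1 h2
  have hin : ‖∑ e, ⟪F.2 ⟨⟨k, hk⟩, e⟩, F.1 ⟨⟨k, hk⟩, e⟩⟫‖ ≤ N ^ 2 := by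
    calc _ ≤ ∑ e, ‖F.2 ⟨⟨k, hk⟩, e⟩‖ * ‖F.1 ⟨⟨k, hk⟩, e⟩‖ :=
          norm_sum_le_of_le _ fun e _ => norm_inner_le_norm _ _
      _ ≤ ∑ e, (‖F.2 ⟨⟨k, hk⟩, e⟩‖ ^ 2 + ‖F.1 ⟨⟨k, hk⟩, e⟩‖ ^ 2) := by
          refine Finset.sum_le_sum fun e _ => ?_
          nlinarith [sq_nonneg (‖F.2 ⟨⟨k, hk⟩, e⟩‖ - ‖F.1 ⟨⟨k, hk⟩, e⟩‖),
            sq_nonneg ‖F.2 ⟨⟨k, hk⟩, e⟩‖, sq_nonneg ‖F.1 ⟨⟨k, hk⟩, e⟩‖]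
      _ ≤ ‖F.2‖ ^ 2 + ‖F.1‖ ^ 2 := by
          rw [Finset.sum_add_distrib]
          exact add_le_add (sum_sq_norm_le F.2 ⟨k, hk⟩) (sum_sq_norm_le F.1 ⟨k, hk⟩)
      _ ≤ _ := by rw [hN]; nlinarith [mul_nonneg (norm_nonneg F.1) (norm_nonneg F.2)]
  have hE0 : 0 ≤ ∑ e, ∫ x in (0 : ℝ)..(Γ k).len e, ‖u' k e x‖ ^ 2 :=
    Finset.sum_nonneg fun e _ => intervalIntegral.integral_nonneg ((Γ k).len_pos e).le
      fun x _ => by positivity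
  have hE := congrArg norm (hlhs.symm.trans en)
  rw [Complex.norm_real, Real.norm_of_nonneg hE0] at hE
  rw [hE]
  simp only [inner_neg_left, Finset.sum_neg_distrib, map_sub, sub_mul, hprod, map_mul,
    Complex.conj_ofReal, sub_neg_eq_add]
  calc _ ≤ ‖conj ((Γ (k + 1)).dag₀ (u' (k + 1))) * a (k + 1) (Γ (k + 1)).o₀‖ +
        ‖((Γ k).q : ℂ) * conj (a k (Γ k).o₁) * a k (Γ k).o₁‖ +
        ‖conj ((Γ k).dag₀ (u' k)) * a k (Γ k).o₀‖ +
        ‖∑ e, ⟪F.2 ⟨⟨k, hk⟩, e⟩, F.1 ⟨⟨k, hk⟩, e⟩⟫‖ := by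
        refine (norm_add_le _ _).trans (add_le_add_left ?_ _)
        refine (norm_sub_le _ _).trans (add_le_add_left ?_ _)
        exact norm_sub_le _ _
    _ ≤ (K * N) * (K * N) + Q * (K * N) * (K * N) + (K * N) * (K * N) + N ^ 2 := by
        simp only [norm_mul, RCLike.norm_conj]
        gcongr
    _ = (2 * K ^ 2 + Q * K ^ 2 + 1) * N ^ 2 := by ring
    _ ≤ _ := mul_le_mul_of_nonneg_right (by linarith) (sq_nonneg _)

/-- Elements of the domain are uniformly bounded by their graph norm. -/
theorem exists_sup_bound (hb : ∀ k, n < k → 1 ≤ b k)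
    (hU : UniformDecoration Γ ℓm ℓp κ qm qp) (hℓm : 0 < ℓm) (hℓp : 0 < ℓp) (hκ : 0 < κ) :
    ∃ C, 0 ≤ C ∧ ∀ F ∈ hamiltonianGraph b Γ n, ∀ x : GraphEdge Γ n,
      ∀ᵐ s ∂edgeMeasure ((Γ x.1).len x.2), ‖F.1 x s‖ ≤ C * (‖F.1‖ + ‖F.2‖) := by
  obtain ⟨C, hC, H⟩ := exists_energy_bound hb hU hℓm hℓp hκ
  refine ⟨C + 2 * (ℓp + C), by positivity, ?_⟩
  rintro F ⟨u, u', a, h⟩ ⟨⟨k, hk⟩, e⟩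
  have hk1 := Nat.one_le_of_lt hk
  obtain ⟨ha, hE⟩ := H F u u' a h k hk
  set N := ‖F.1‖ + ‖F.2‖ with hN
  have hdeco := h.deco ⟨k, hk⟩
  have hlen := fun e => ((Γ k).len_pos e).le
  -- Any `M > N` replaces `N`, so that division by `M` is legitimate also when `N = 0`; at the end
  -- `M` decreases to `N`. The number of edges is not bounded, but `∫ |u'| ≤ M * len + M⁻¹ * ∫
  -- |u'|²` sums up by the bounds on total length and energy.
  have key : ∀ M, N < M → ∀ s ∈ Icc 0 ((Γ k).len e), ‖u k e s‖ ≤ (C + 2 * (ℓp + C)) * M := by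
    intro M hM s hs
    have hN0 : 0 ≤ N := by positivity
    have hM0 : 0 < M := hN0.trans_lt hM
    have hcont : ∀ e, ContinuousOn (u' k e) (uIcc 0 ((Γ k).len e)) := fun e => by
      rw [uIcc_of_le (hlen e)]
      exact (hdeco.edge e).continuousOn_deriv (hlen e)
    set d : (Γ k).E → ℝ := fun e => ∫ x in (0 : ℝ)..(Γ k).len e, ‖u' k e x‖
    have hd0 : ∀ e, 0 ≤ d e := fun e =>
      intervalIntegral.integral_nonneg (hlen e) fun x _ => norm_nonneg _
    have hosc : ∀ e, ∀ s ∈ Icc 0 ((Γ k).len e), ‖u k e s - u k e 0‖ ≤ d e := by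
      intro e s hs
      rw [(hdeco.edge e).fst s hs, add_sub_cancel_left]
      refine (intervalIntegral.norm_integral_le_integral_norm hs.1).trans ?_
      exact intervalIntegral.integral_mono_interval le_rfl hs.1 hs.2
        (Filter.Eventually.of_forall fun x => norm_nonneg _) (hcont e).norm.intervalIntegrable
    have hd : ∀ e, d e ≤ M * (Γ k).len e + M⁻¹ * ∫ x in (0 : ℝ)..(Γ k).len e, ‖u' k e x‖ ^ 2 := by
      intro e
      have i1 : IntervalIntegrable (fun x => ‖u' k e x‖ ^ 2) volume 0 ((Γ k).len e) :=
        ((hcont e).norm.pow 2).intervalIntegrable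
      calc d e ≤ ∫ x in (0 : ℝ)..(Γ k).len e, (M + M⁻¹ * ‖u' k e x‖ ^ 2) := by
            refine intervalIntegral.integral_mono_on (hlen e) (hcont e).norm.intervalIntegrable
              (intervalIntegrable_const.add (i1.const_mul _)) fun x _ => ?_
            have h1 : 0 ≤ M⁻¹ * (M - ‖u' k e x‖) ^ 2 := by positivity
            have h2 : M⁻¹ * (M - ‖u' k e x‖) ^ 2 = M - 2 * ‖u' k e x‖ + M⁻¹ * ‖u' k e x‖ ^ 2 := by
              field_simp; ring
            have := norm_nonneg (u' k e x)
            linarith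
        _ = _ := by
            rw [intervalIntegral.integral_add intervalIntegrable_const (i1.const_mul _),
              intervalIntegral.integral_const_mul, intervalIntegral.integral_const]
            simp [mul_comm]
    have hsum : ∑ e, d e ≤ (ℓp + C) * M := by
      calc _ ≤ ∑ e, (M * (Γ k).len e + M⁻¹ * ∫ x in (0 : ℝ)..(Γ k).len e, ‖u' k e x‖ ^ 2) :=
            Finset.sum_le_sum fun e _ => hd e
        _ = M * ∑ e, (Γ k).len e + M⁻¹ * ∑ e, ∫ x in (0 : ℝ)..(Γ k).len e, ‖u' k e x‖ ^ 2 := by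
            rw [Finset.sum_add_distrib, Finset.mul_sum, Finset.mul_sum]
        _ ≤ M * ℓp + M⁻¹ * (C * M ^ 2) := by
            gcongr
            · exact hU.volume_le k hk1
            · exact hE.trans (by gcongr)
        _ = _ := by field_simp
    -- From `o₀` to the source of the edge the oscillation is controlled through the vertices, and
    -- then along the edge; this accounts for the two terms `ℓp + C` in the constant.
    have h1 := (Γ k).norm_sub_le_sum (a := a k) (d := d) (fun e => by
      rw [← hdeco.tgt, ← hdeco.src]
      exact hosc e _ ⟨hlen e, le_rfl⟩) (Γ k).o₀ ((Γ k).src e)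
    have h2 := hosc e s hs
    have h3 : d e ≤ ∑ e, d e := Finset.single_le_sum (fun e _ => hd0 e) (Finset.mem_univ e)
    rw [hdeco.src] at h2
    calc ‖u k e s‖ = ‖(u k e s - a k ((Γ k).src e)) + (a k ((Γ k).src e) - a k (Γ k).o₀) +
          a k (Γ k).o₀‖ := by congr 1; ring
      _ ≤ _ := norm_add₃_le
      _ ≤ (ℓp + C) * M + (ℓp + C) * M + C * M := by
          have h4 : C * N ≤ C * M := by gcongr
          exact add_le_add (add_le_add (h2.trans (h3.trans hsum)) (h1.trans hsum)) (ha.trans h4)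
      _ = _ := by ring
  filter_upwards [(hdeco.edge e).ae_eq, ae_restrict_mem measurableSet_Ioo] with s hs hsI
  rw [hs]
  have hpos : 0 < C + 2 * (ℓp + C) := by positivity
  rw [← div_le_iff₀' hpos]
  refine le_of_forall_gt_imp_ge_of_dense fun M hM => ?_
  rw [div_le_iff₀' hpos]
  exact key M hM s (Ioo_subset_Icc_self hsI)

end LineLike

/-! ### Combinatorics of the radial tree. -/

namespace RadialTree

variable {V : Type*} {b : ℕ → ℕ} (T : RadialTree V b)

/-- Two edges with the same end extend shortest walks from the root to paths with the same end
points. Paths in a tree are unique, so their last edges agree. -/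
theorem Edge.ext_of_tgt {T : RadialTree V b} {s t : T.Edge} (h : s.tgt = t.tgt) : s = t := by
  obtain ⟨v₁, w, h₁, d₁⟩ := s
  obtain ⟨v₂, w', h₂, d₂⟩ := t
  simp only at h
  subst h
  obtain ⟨p₁, hp₁⟩ := T.isTree.1.exists_walk_length_eq_dist T.root v₁
  obtain ⟨p₂, hp₂⟩ := T.isTree.1.exists_walk_length_eq_dist T.root v₂
  have q₁ : (p₁.concat h₁).IsPath :=
    SimpleGraph.Walk.isPath_of_length_eq_dist _ (by rw [SimpleGraph.Walk.length_concat, hp₁, d₁])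
  have q₂ : (p₂.concat h₂).IsPath :=
    SimpleGraph.Walk.isPath_of_length_eq_dist _ (by rw [SimpleGraph.Walk.length_concat, hp₂, d₂])
  have := congrArg Subtype.val ((T.isTree.2.subsingleton_path _ _).elim ⟨_, q₁⟩ ⟨_, q₂⟩)
  obtain ⟨hv, -⟩ := SimpleGraph.Walk.concat_inj this
  subst hv
  rfl

/-- The parent is the first vertex after `v` on a shortest walk to the root. -/
theorem exists_edge_of_pos {v : V} (hv : 0 < T.graph.dist T.root v) : ∃ t : T.Edge, t.tgt = v := by
  obtain ⟨p, hp⟩ := T.isTree.1.exists_walk_length_eq_dist v T.root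
  cases p with
  | nil => simp at hv
  | @cons _ w _ h q =>
    refine ⟨⟨w, v, h.symm, ?_⟩, rfl⟩
    have h1 : T.graph.dist w T.root ≤ q.length := SimpleGraph.dist_le q
    have h2 : q.length + 1 = T.graph.dist v T.root := by simpa using hp
    have h3 := T.isTree.1.dist_triangle (u := v) (v := w) (w := T.root)
    have h4 : T.graph.dist v w ≤ 1 := by simpa using SimpleGraph.dist_le (SimpleGraph.Walk.cons h .nil)
    rw [SimpleGraph.dist_comm (u := T.root) (v := v), SimpleGraph.dist_comm (u := T.root) (v := w)]
    omega

/-- The edges succeeding a tree edge. -/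
def succ (t : T.Edge) : Finset T.Edge := (T.finite_edge_src t.tgt).toFinset

@[simp] theorem mem_succ {s t : T.Edge} : s ∈ T.succ t ↔ s.src = t.tgt := by simp [succ]

theorem gen_eq (t : T.Edge) : t.gen = T.graph.dist T.root t.src + 1 := t.away

theorem gen_of_src_eq {s t : T.Edge} (h : s.src = t.tgt) : s.gen = t.gen + 1 := by
  rw [gen_eq, h]; rfl

theorem card_src (v : V) : (T.finite_edge_src v).toFinset.card = b (T.graph.dist T.root v) := by
  rw [← T.card_succ v, ← Set.ncard_eq_toFinset_card _ (T.finite_edge_src v)]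
  refine Set.ncard_congr (fun t _ => t.tgt) ?_ ?_ ?_
  · rintro t rfl
    exact ⟨t.adj, t.away⟩
  · intro s t _ _ h
    exact Edge.ext_of_tgt h
  · rintro w ⟨h1, h2⟩
    exact ⟨⟨v, w, h1, h2⟩, rfl, rfl⟩

theorem card_succ_edge (t : T.Edge) : (T.succ t).card = b t.gen := T.card_src t.tgt

theorem root_iff (t : T.Edge) : t.src = T.root ↔ t.gen = 1 := by
  rw [gen_eq]
  constructor
  · intro h; rw [h]; simp
  · intro h
    have : T.graph.dist T.root t.src = 0 := by omega
    exact ((T.isTree.1.dist_eq_zero_iff).1 this).symm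

theorem exists_parent {s : T.Edge} {k : ℕ} (hk : 1 ≤ k) (hs : s.gen = k + 1) :
    ∃ t : T.Edge, t.gen = k ∧ s.src = t.tgt := by
  rw [gen_eq] at hs
  obtain ⟨t, ht⟩ := T.exists_edge_of_pos (v := s.src) (by omega)
  exact ⟨t, by rw [Edge.gen, ht]; omega, ht.symm⟩

theorem gen_pos (t : T.Edge) : 1 ≤ t.gen := by rw [gen_eq]; omega

theorem finite_gen (k : ℕ) : {t : T.Edge | t.gen = k}.Finite := by
  induction k with
  | zero =>
    convert Set.finite_empty
    ext t
    have := T.gen_pos t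
    simp only [mem_ofPred_eq, mem_empty_iff_false, iff_false]
    omega
  | succ k ih =>
    by_cases hk : 1 ≤ k
    · refine (ih.biUnion fun t _ => T.finite_edge_src t.tgt).subset fun s hs => ?_
      obtain ⟨t, ht, hst⟩ := T.exists_parent hk hs
      exact mem_biUnion ht hst
    · obtain rfl : k = 0 := by omega
      refine (T.finite_edge_src T.root).subset fun s hs => (T.root_iff s).2 hs

/-- The tree edges of generation `k`. -/
def level (k : ℕ) : Finset T.Edge := (T.finite_gen k).toFinset

@[simp] theorem mem_level {k : ℕ} {t : T.Edge} : t ∈ T.level k ↔ t.gen = k := by simp [level]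

theorem sum_level_succ {M : Type*} [AddCommMonoid M] {k : ℕ} (hk : 1 ≤ k) (f : T.Edge → M) :
    ∑ s ∈ T.level (k + 1), f s = ∑ t ∈ T.level k, ∑ s ∈ T.succ t, f s := by
  classical
  rw [← Finset.sum_biUnion]
  · refine Finset.sum_congr ?_ fun _ _ => rfl
    ext s
    simp only [mem_level, Finset.mem_biUnion, mem_succ]
    constructor
    · exact fun hs => T.exists_parent hk hs
    · rintro ⟨t, rfl, h⟩
      exact T.gen_of_src_eq h
  · intro t _ t' _ hne
    refine Finset.disjoint_left.2 fun s hs hs' => hne ?_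
    rw [mem_succ] at hs hs'
    exact Edge.ext_of_tgt (hs.symm.trans hs')

theorem card_level_one : (T.level 1).card = b 0 := by
  have : T.level 1 = (T.finite_edge_src T.root).toFinset := by
    ext t; simp [T.root_iff]
  rw [this, T.card_src]; simp

theorem card_level (k : ℕ) : (T.level (k + 1)).card = ∏ i ∈ Finset.range (k + 1), b i := by
  induction k with
  | zero => rw [T.card_level_one]; simp
  | succ k ih =>
    rw [Finset.card_eq_sum_ones, T.sum_level_succ (by omega), Finset.prod_range_succ, ← ih,
      Finset.sum_congr rfl (g := fun _ => b (k + 1)) fun t ht => by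
        rw [← Finset.card_eq_sum_ones, T.card_succ_edge, T.mem_level.1 ht]]
    simp

end RadialTree

/-! ### Adapted orthonormal modes on the generations. -/

/-- The index set of the summands in the reduction. -/
abbrev ModeIndex (b : ℕ → ℕ) : Type := Σ m : ℕ, Fin (reductionMultiplicity b m)

/-- The summands which are supported on generation `k`. -/
def modesBelow (b : ℕ → ℕ) (k : ℕ) : Finset (ModeIndex b) :=
  (Finset.range k).sigma fun _ => Finset.univ

@[simp] theorem mem_modesBelow {b : ℕ → ℕ} {k : ℕ} {i : ModeIndex b} :
    i ∈ modesBelow b k ↔ i.1 < k := by simp [modesBelow]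

/-- The multiplicities telescope, starting from `1 = b 0`. So a generation carries as many modes as
it has edges, which lets orthonormal systems be bases. -/
theorem card_modesBelow {b : ℕ → ℕ} (hb0 : b 0 = 1) (hb : ∀ n, 1 ≤ b n) (k : ℕ) :
    (modesBelow b (k + 1)).card = ∏ i ∈ Finset.range (k + 1), b i := by
  rw [modesBelow, Finset.card_sigma]
  simp only [Finset.card_univ, Fintype.card_fin]
  induction k with
  | zero => simp [reductionMultiplicity, hb0]
  | succ k ih =>
    rw [Finset.sum_range_succ, ih, Finset.prod_range_succ _ (k + 1)]
    simp only [reductionMultiplicity, Nat.succ_ne_zero, if_false]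
    obtain ⟨c, hc⟩ := Nat.exists_eq_add_of_le (hb (k + 1))
    rw [hc]; simp; ring

namespace RadialTree

variable {V : Type*} {b : ℕ → ℕ} (T : RadialTree V b)

open scoped Classical in
/-- Orthonormal systems of functions on the generations of the tree, adapted to the decomposition
of the tree-like graph into line-like graphs. -/
structure IsModeSystem (c : ModeIndex b → T.Edge → ℝ) : Prop where
  orthonormal : ∀ k, ∀ i ∈ modesBelow b k, ∀ j ∈ modesBelow b k,
    ∑ t ∈ T.level k, c i t * c j t = if i = j then 1 else 0
  complete : ∀ k, ∀ s ∈ T.level k, ∀ t ∈ T.level k,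
    ∑ i ∈ modesBelow b k, c i s * c i t = if s = t then 1 else 0
  succ : ∀ (s t : T.Edge), s.src = t.tgt → ∀ i : ModeIndex b, i.1 < t.gen →
    c i s = (Real.sqrt (b t.gen))⁻¹ * c i t

/-- The factor `(b k)^(-1/2)` compensates for the `b k` successors of each edge, so extended modes
stay orthonormal. By the dimension count they can be completed to a basis indexed by all modes below
`k + 1`; the added vectors are the modes born at generation `k + 1`. -/
theorem exists_modes_step (hb0 : b 0 = 1) (hb : ∀ n, 1 ≤ b n) (k : ℕ)
    (c : ModeIndex b → T.Edge → ℝ)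
    (hc : ∀ i ∈ modesBelow b k, ∀ j ∈ modesBelow b k,
      ∑ t ∈ T.level k, c i t * c j t = if i = j then 1 else 0) :
    ∃ c' : ModeIndex b → T.Edge → ℝ,
      (∀ i ∈ modesBelow b (k + 1), ∀ j ∈ modesBelow b (k + 1),
        ∑ t ∈ T.level (k + 1), c' i t * c' j t = if i = j then 1 else 0) ∧
      ∀ t ∈ T.level k, ∀ s ∈ T.succ t, ∀ i ∈ modesBelow b k,
        c' i s = (Real.sqrt (b k))⁻¹ * c i t := by
  classical
  set r := (Real.sqrt (b k))⁻¹
  have hr : (b k : ℝ) * (r * r) = 1 := by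
    have h0 : (0 : ℝ) < b k := by exact_mod_cast hb k
    rw [← mul_inv, Real.mul_self_sqrt h0.le, mul_inv_cancel₀ h0.ne']
  -- The sum selects the unique parent of `s`.
  let ext : ModeIndex b → T.Edge → ℝ := fun i s =>
    ∑ t ∈ (T.level k).filter fun t => s.src = t.tgt, r * c i t
  have hext : ∀ t ∈ T.level k, ∀ s ∈ T.succ t, ∀ i, ext i s = r * c i t := by
    intro t ht s hs i
    have : (T.level k).filter (fun t => s.src = t.tgt) = {t} := by
      ext t'
      simp only [Finset.mem_filter, Finset.mem_singleton]
      constructor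
      · rintro ⟨_, h⟩
        exact Edge.ext_of_tgt (h.symm.trans (T.mem_succ.1 hs))
      · rintro rfl
        exact ⟨ht, T.mem_succ.1 hs⟩
    simp only [ext, this, Finset.sum_singleton]
  let v : modesBelow b (k + 1) → EuclideanSpace ℝ (T.level (k + 1)) := fun i =>
    WithLp.toLp 2 fun s => ext i s
  let S : Set (modesBelow b (k + 1)) := {i | i.1.1 < k}
  have hv : Orthonormal ℝ (S.domRestrict v) := by
    rw [orthonormal_iff_ite]
    rintro ⟨i, hi⟩ ⟨j, hj⟩
    have hk : 1 ≤ k := Nat.one_le_of_lt (show i.1.1 < k from hi)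
    have h1 : ∑ s ∈ T.level (k + 1), ext i s * ext j s =
        ∑ t ∈ T.level k, c i t * c j t := by
      rw [T.sum_level_succ hk]
      refine Finset.sum_congr rfl fun t ht => ?_
      rw [Finset.sum_congr rfl (g := fun _ => (r * r) * (c i t * c j t)) fun s hs => by
        rw [hext t ht s hs, hext t ht s hs]; ring]
      rw [Finset.sum_const, T.card_succ_edge, T.mem_level.1 ht, nsmul_eq_mul, ← mul_assoc, hr,
        one_mul]
    have h2 : inner ℝ (v i) (v j) = ∑ s ∈ T.level (k + 1), ext i s * ext j s := by
      rw [PiLp.inner_apply, ← Finset.sum_coe_sort (T.level (k + 1))]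
      refine Finset.sum_congr rfl fun s _ => ?_
      simp only [RCLike.inner_apply, conj_trivial, v]; ring
    change inner ℝ (v i) (v j) = _
    rw [h2, h1, hc i (mem_modesBelow.2 hi) j (mem_modesBelow.2 hj)]
    simp only [Subtype.mk.injEq, Subtype.coe_inj]
  obtain ⟨B, hB⟩ := hv.exists_orthonormalBasis_extension_of_card_eq (by
    rw [finrank_euclideanSpace, Fintype.card_coe, Fintype.card_coe, T.card_level,
      card_modesBelow hb0 hb])
  refine ⟨fun i s => if h : i ∈ modesBelow b (k + 1) ∧ s ∈ T.level (k + 1) then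
    B ⟨i, h.1⟩ ⟨s, h.2⟩ else 0, fun i hi j hj => ?_, fun t ht s hs i hi => ?_⟩
  · have h1 := orthonormal_iff_ite.1 B.orthonormal ⟨i, hi⟩ ⟨j, hj⟩
    rw [PiLp.inner_apply] at h1
    rw [← Finset.sum_coe_sort]
    simp only [Subtype.mk.injEq] at h1
    rw [← h1]
    refine Finset.sum_congr rfl fun s _ => ?_
    simp only [hi, hj, s.2, and_self, dif_pos, Subtype.coe_eta]
    simp only [RCLike.inner_apply, conj_trivial]; ring
  · have hi' : i ∈ modesBelow b (k + 1) := by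
      rw [mem_modesBelow] at hi ⊢; omega
    have hs' : s ∈ T.level (k + 1) := by
      rw [mem_level, T.gen_of_src_eq (T.mem_succ.1 hs), T.mem_level.1 ht]
    beta_reduce
    rw [dif_pos ⟨hi', hs'⟩, hB ⟨i, hi'⟩ (mem_modesBelow.1 hi : i.1 < k), ← hext t ht s hs]

/-- The extension step is iterated from generation `0`, where no mode lives and the zero function
serves. Earlier coefficients are never changed, so each edge reads off the stage of its own
generation. -/
theorem exists_isModeSystem (hb0 : b 0 = 1) (hb : ∀ n, 1 ≤ b n) : ∃ c, T.IsModeSystem c := by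
  classical
  let Q : ℕ → Type _ := fun k => {c : ModeIndex b → T.Edge → ℝ //
    ∀ i ∈ modesBelow b k, ∀ j ∈ modesBelow b k,
      ∑ t ∈ T.level k, c i t * c j t = if i = j then 1 else 0}
  choose! next hnext using fun (k : ℕ) (c : ModeIndex b → T.Edge → ℝ) =>
    T.exists_modes_step hb0 hb k c
  let seq : ∀ k, Q k := fun k => Nat.rec ⟨0, fun i hi => by simp at hi⟩
    (fun k c => ⟨next k c.1, (hnext k c.1 c.2).1⟩) k
  have hseq : ∀ k, ∀ t ∈ T.level k, ∀ s ∈ T.succ t, ∀ i ∈ modesBelow b k,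
      (seq (k + 1)).1 i s = (Real.sqrt (b k))⁻¹ * (seq k).1 i t := fun k =>
    (hnext k (seq k).1 (seq k).2).2
  have horth : ∀ k, ∀ i ∈ modesBelow b k, ∀ j ∈ modesBelow b k,
      ∑ t ∈ T.level k, (seq t.gen).1 i t * (seq t.gen).1 j t = if i = j then 1 else 0 := by
    intro k i hi j hj
    rw [← (seq k).2 i hi j hj]
    refine Finset.sum_congr rfl fun t ht => ?_
    rw [T.mem_level.1 ht]
  refine ⟨fun i t => (seq t.gen).1 i t, horth, fun k s hs t ht => ?_, fun s t hst i hi => ?_⟩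
  · obtain ⟨k, rfl⟩ : ∃ j, k = j + 1 := ⟨k - 1, by have := T.gen_pos s; have := T.mem_level.1 hs; omega⟩
    -- Orthonormal rows of a square matrix imply orthonormal columns, which is completeness.
    let M : Matrix (modesBelow b (k + 1)) (T.level (k + 1)) ℝ := fun i t => (seq t.1.gen).1 i t
    have hM : M * M.transpose = 1 := by
      ext i j
      rw [Matrix.mul_apply, Matrix.one_apply]
      have := horth (k + 1) i i.2 j j.2
      rw [← Finset.sum_coe_sort] at this
      simp only [Subtype.coe_inj] at this
      exact this
    have hM' : M.transpose * M = 1 := by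
      refine (Matrix.mul_eq_one_comm_of_card_eq _ _ _ ?_).1 hM
      rw [Fintype.card_coe, Fintype.card_coe, T.card_level, card_modesBelow hb0 hb]
    have := congrFun (congrFun hM' ⟨s, hs⟩) ⟨t, ht⟩
    rw [Matrix.mul_apply, Matrix.one_apply] at this
    rw [← Finset.sum_coe_sort]
    simp only [Subtype.mk.injEq] at this
    exact this
  · have := hseq t.gen t (by simp) s (by simpa using hst) i (by simpa using hi)
    rwa [← T.gen_of_src_eq hst] at this

end RadialTree

/-! ### Analysis and synthesis in the modes. -/

theorem memℓp_two_iff_tsum {ι : Type*} {E : ι → Type*} [∀ i, NormedAddCommGroup (E i)]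
    {f : ∀ i, E i} : Memℓp f 2 ↔ ∑' i, ‖f i‖ₑ ^ 2 ≠ ∞ := by
  rw [memℓp_gen_iff (by norm_num)]
  have h : ∀ i, ‖f i‖ₑ ^ 2 = ((‖f i‖₊ ^ 2 : NNReal) : ℝ≥0∞) := fun i => by
    rw [ENNReal.coe_pow]; rfl
  simp only [h]
  rw [ENNReal.tsum_coe_ne_top_iff_summable, ← NNReal.summable_coe]
  simp

theorem lp.enorm_sq_eq_tsum {ι : Type*} {E : ι → Type*} [∀ i, NormedAddCommGroup (E i)]
    (f : lp E 2) : ‖f‖ₑ ^ 2 = ∑' i, ‖f i‖ₑ ^ 2 := by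
  have h1 : HasSum (fun i => ‖f i‖ ^ 2) (‖f‖ ^ 2) := by
    simpa using lp.hasSum_norm (p := 2) (by norm_num) f
  have h : ∀ i, ‖f i‖ₑ ^ 2 = ENNReal.ofReal (‖f i‖ ^ 2) := fun i => by
    rw [ENNReal.ofReal_pow (norm_nonneg _), ofReal_norm]
  simp only [h]
  rw [← ENNReal.ofReal_tsum_of_nonneg (fun i => by positivity) h1.summable, h1.tsum_eq,
    ENNReal.ofReal_pow (norm_nonneg _), ofReal_norm]

open scoped Classical in
-- Expanding the squares, the completeness relation removes all cross terms. Stated with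
-- `ℝ≥0∞`-valued norms so that it can be summed over generations without a summability assumption.
theorem sum_norm_sq_of_complete {ι τ E : Type*} [NormedAddCommGroup E] [InnerProductSpace ℂ E]
    (I : Finset ι) (S : Finset τ) (c : ι → τ → ℝ) (x : τ → E)
    (hc : ∀ s ∈ S, ∀ t ∈ S, ∑ i ∈ I, c i s * c i t = if s = t then 1 else 0) :
    ∑ i ∈ I, ‖∑ t ∈ S, (c i t : ℂ) • x t‖ₑ ^ 2 = ∑ t ∈ S, ‖x t‖ₑ ^ 2 := by
  have key : ∑ i ∈ I, ‖∑ t ∈ S, (c i t : ℂ) • x t‖ ^ 2 = ∑ t ∈ S, ‖x t‖ ^ 2 := by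
    have h : ∀ y : E, ((‖y‖ ^ 2 : ℝ) : ℂ) = ⟪y, y⟫ := fun y => by
      rw [inner_self_eq_norm_sq_to_K]; simp
    rw [← Complex.ofReal_inj, Complex.ofReal_sum, Complex.ofReal_sum]
    simp only [h, sum_inner, inner_sum, inner_smul_left, inner_smul_right, Complex.conj_ofReal]
    simp only [Finset.mul_sum]
    rw [Finset.sum_comm]
    refine Finset.sum_congr rfl fun s hs => ?_
    rw [Finset.sum_comm, Finset.sum_congr rfl (g := fun t => if s = t then ⟪x t, x s⟫ else 0)]
    · rw [Finset.sum_ite_eq S s, if_pos hs]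
    · intro t ht
      have := congrArg (fun r : ℝ => (r : ℂ)) (hc s hs t ht)
      simp only [Complex.ofReal_sum, Complex.ofReal_mul] at this
      rw [Finset.sum_congr rfl (g := fun i => ((c i s : ℂ) * c i t) * ⟪x t, x s⟫)
        (fun i _ => by ring), ← Finset.sum_mul, this]
      split_ifs <;> simp
  have h : ∀ y : E, ‖y‖ₑ ^ 2 = ENNReal.ofReal (‖y‖ ^ 2) := fun y => by
    rw [ENNReal.ofReal_pow (norm_nonneg _), ofReal_norm]
  simp only [h]
  rw [← ENNReal.ofReal_sum_of_nonneg (fun _ _ => by positivity), key,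
    ENNReal.ofReal_sum_of_nonneg (fun _ _ => by positivity)]

namespace DecorationGraph

variable {Γ : DecorationGraph} {ι : Type*}

theorem IsH2.sum (S : Finset ι) (c : ι → ℂ) {f w : ι → ∀ e : Γ.E, EdgeL2 (Γ.len e)}
    {u u' : ι → Γ.E → ℝ → ℂ} {a : ι → Γ.V → ℂ}
    (h : ∀ t ∈ S, Γ.IsH2 (f t) (w t) (u t) (u' t) (a t)) :
    Γ.IsH2 (∑ t ∈ S, c t • f t) (∑ t ∈ S, c t • w t) (∑ t ∈ S, c t • u t) (∑ t ∈ S, c t • u' t)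
      (∑ t ∈ S, c t • a t) := by
  classical
  induction S using Finset.induction_on with
  | empty => simpa using IsH2.zero Γ
  | insert t S ht ih =>
    simp only [Finset.sum_insert ht]
    exact ((h t (Finset.mem_insert_self _ _)).smul (c t)).add
      (ih fun s hs => h s (Finset.mem_insert_of_mem hs))

theorem dag₀_sum (S : Finset ι) (c : ι → ℂ) (p : ι → Γ.E → ℝ → ℂ) :
    Γ.dag₀ (∑ t ∈ S, c t • p t) = ∑ t ∈ S, c t * Γ.dag₀ (p t) := by
  classical
  induction S using Finset.induction_on with
  | empty => simp [dag₀_zero]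
  | insert t S ht ih => rw [Finset.sum_insert ht, Finset.sum_insert ht, dag₀_add, dag₀_smul, ih]

theorem dag₁_sum (S : Finset ι) (c : ι → ℂ) (p : ι → Γ.E → ℝ → ℂ) (a : ι → Γ.V → ℂ) :
    Γ.dag₁ (∑ t ∈ S, c t • p t) (∑ t ∈ S, c t • a t) = ∑ t ∈ S, c t * Γ.dag₁ (p t) (a t) := by
  classical
  induction S using Finset.induction_on with
  | empty => simp [dag₁_zero]
  | insert t S ht ih =>
    rw [Finset.sum_insert ht, Finset.sum_insert ht, Finset.sum_insert ht, dag₁_add, dag₁_smul, ih]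

end DecorationGraph

namespace RadialTree

variable {V : Type*} {b : ℕ → ℕ} (T : RadialTree V b) {β : ℕ → Type*}

open scoped Classical in
/-- The value of a function on tree edges at an edge of generation `k`. -/
def lev [∀ k, Zero (β k)] (x : ∀ t : T.Edge, β t.gen) (k : ℕ) (t : T.Edge) : β k :=
  if h : t.gen = k then h ▸ x t else 0

@[simp] theorem lev_self [∀ k, Zero (β k)] (x : ∀ t : T.Edge, β t.gen) (t : T.Edge) :
    T.lev x t.gen t = x t := by simp [lev]

variable [∀ k, AddCommGroup (β k)] [∀ k, Module ℂ (β k)] {c : ModeIndex b → T.Edge → ℝ}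

/-- The component of `x` in the mode `i`. -/
def analysis (c : ModeIndex b → T.Edge → ℝ) (x : ∀ t : T.Edge, β t.gen) (i : ModeIndex b)
    (k : ℕ) : β k :=
  ∑ t ∈ T.level k, (c i t : ℂ) • T.lev x k t

/-- The function with prescribed components. -/
def synthesis (c : ModeIndex b → T.Edge → ℝ) (g : ModeIndex b → ∀ k, β k) (t : T.Edge) :
    β t.gen :=
  ∑ i ∈ modesBelow b t.gen, (c i t : ℂ) • g i t.gen

theorem lev_synthesis (g : ModeIndex b → ∀ k, β k) {k : ℕ} {t : T.Edge} (ht : t ∈ T.level k) :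
    T.lev (T.synthesis c g) k t = ∑ i ∈ modesBelow b k, (c i t : ℂ) • g i k := by
  obtain rfl := T.mem_level.1 ht
  rw [lev_self]; rfl

theorem synthesis_analysis (hc : T.IsModeSystem c) (x : ∀ t : T.Edge, β t.gen) :
    T.synthesis c (T.analysis c x) = x := by
  funext t
  simp only [synthesis, analysis, Finset.smul_sum, smul_smul]
  rw [Finset.sum_comm, Finset.sum_eq_single_of_mem t (by simp)]
  · rw [← Finset.sum_smul, lev_self]
    have := hc.complete t.gen t (by simp) t (by simp)
    rw [if_pos rfl] at this
    have h2 : ∑ i ∈ modesBelow b t.gen, (c i t : ℂ) * (c i t : ℂ) = 1 := by exact_mod_cast this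
    rw [h2, one_smul]
  · intro s hs hst
    rw [← Finset.sum_smul]
    have := hc.complete t.gen t (by simp) s hs
    rw [if_neg hst.symm] at this
    have h2 : ∑ i ∈ modesBelow b t.gen, (c i t : ℂ) * (c i s : ℂ) = 0 := by exact_mod_cast this
    rw [h2, zero_smul]

theorem analysis_synthesis (hc : T.IsModeSystem c) (g : ModeIndex b → ∀ k, β k) {i : ModeIndex b}
    {k : ℕ} (hi : i.1 < k) : T.analysis c (T.synthesis c g) i k = g i k := by
  have hi' : i ∈ modesBelow b k := mem_modesBelow.2 hi
  rw [analysis, Finset.sum_congr rfl fun t ht => by rw [T.lev_synthesis g ht]]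
  simp only [Finset.smul_sum, smul_smul]
  rw [Finset.sum_comm, Finset.sum_eq_single_of_mem i hi']
  · rw [← Finset.sum_smul]
    have := hc.orthonormal k i hi' i hi'
    rw [if_pos rfl] at this
    have h2 : ∑ t ∈ T.level k, (c i t : ℂ) * (c i t : ℂ) = 1 := by exact_mod_cast this
    rw [h2, one_smul]
  · intro j hj hij
    rw [← Finset.sum_smul]
    have := hc.orthonormal k i hi' j hj
    rw [if_neg hij.symm] at this
    have h2 : ∑ t ∈ T.level k, (c i t : ℂ) * (c j t : ℂ) = 0 := by exact_mod_cast this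
    rw [h2, zero_smul]

theorem tsum_edge_eq (φ : T.Edge → ℝ≥0∞) : ∑' t, φ t = ∑' k, ∑ t ∈ T.level k, φ t := by
  rw [← (Equiv.sigmaFiberEquiv (Edge.gen (T := T))).tsum_eq, ENNReal.tsum_sigma']
  refine tsum_congr fun k => ?_
  rw [← Finset.tsum_subtype (T.level k) φ]
  simp only [Equiv.sigmaFiberEquiv_apply]
  refine Equiv.tsum_eq (Equiv.subtypeEquivRight fun t => (T.mem_level (k := k)).symm)
    (fun t : {t // t ∈ T.level k} => φ t)

/-- A mode `i` lives on the generations after `i.1`; the double sum is rearranged by generation. -/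
theorem tsum_modes_eq (ψ : ModeIndex b → ℕ → ℝ≥0∞) :
    ∑' i, ∑' k : Ioi i.1, ψ i k = ∑' k, ∑ i ∈ modesBelow b k, ψ i k := by
  have h1 : ∀ i : ModeIndex b, ∑' k : Ioi i.1, ψ i k = ∑' k, if i.1 < k then ψ i k else 0 := by
    intro i
    rw [tsum_subtype (Ioi i.1) (ψ i)]
    refine tsum_congr fun k => ?_
    simp [indicator]
  simp only [h1]
  rw [ENNReal.tsum_comm]
  refine tsum_congr fun k => ?_
  rw [tsum_eq_sum (s := modesBelow b k) fun i hi => if_neg (by simpa using hi)]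
  exact Finset.sum_congr rfl fun i hi => if_pos (by simpa using hi)

variable (Γ : ℕ → DecorationGraph)

/-- Parseval's identity on each generation and each edge of its decoration graph, summed over all of
them. -/
theorem tsum_analysis (hc : T.IsModeSystem c)
    (x : ∀ t : T.Edge, ∀ e : (Γ t.gen).E, EdgeL2 ((Γ t.gen).len e)) :
    ∑' i, ∑' y : LineLike.GraphEdge Γ i.1,
      ‖T.analysis (β := fun k => ∀ e : (Γ k).E, EdgeL2 ((Γ k).len e)) c x i y.1 y.2‖ₑ ^ 2 =
      ∑' y : T.GraphEdge Γ, ‖x y.1 y.2‖ₑ ^ 2 := by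
  rw [ENNReal.tsum_sigma' (fun y : T.GraphEdge Γ => ‖x y.1 y.2‖ₑ ^ 2)]
  simp only [tsum_fintype]
  rw [T.tsum_edge_eq, tsum_congr fun i => ENNReal.tsum_sigma' _]
  simp only [tsum_fintype]
  rw [tsum_modes_eq (fun i k => ∑ e : (Γ k).E,
    ‖T.analysis (β := fun k => ∀ e : (Γ k).E, EdgeL2 ((Γ k).len e)) c x i k e‖ₑ ^ 2)]
  refine tsum_congr fun k => ?_
  have h1 : ∀ t ∈ T.level k, ∑ e : (Γ t.gen).E, ‖x t e‖ₑ ^ 2 = ∑ e : (Γ k).E,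
      ‖T.lev (β := fun k => ∀ e : (Γ k).E, EdgeL2 ((Γ k).len e)) x k t e‖ₑ ^ 2 := by
    intro t ht
    obtain rfl := T.mem_level.1 ht
    rw [lev_self]
  rw [Finset.sum_congr rfl h1, Finset.sum_comm, Finset.sum_comm (s := T.level k)]
  refine Finset.sum_congr rfl fun e _ => ?_
  simp only [analysis, Finset.sum_apply, Pi.smul_apply]
  exact sum_norm_sq_of_complete _ _ _ _ (hc.complete k)

end RadialTree

/-! ### Correspondence of vertex conditions on the tree and on the lines. -/

theorem sum_modesBelow_succ {b : ℕ → ℕ} {M : Type*} [AddCommMonoid M] (k : ℕ)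
    (f : ModeIndex b → M) :
    ∑ i ∈ modesBelow b (k + 1), f i = ∑ i ∈ modesBelow b k, f i + ∑ j, f ⟨k, j⟩ := by
  simp only [modesBelow, Finset.sum_sigma, Finset.sum_range_succ]

/-- The functions on the edges of a decoration graph. -/
abbrev DecorationGraph.EdgeFun (Γ : DecorationGraph) : Type :=
  ∀ e : Γ.E, EdgeL2 (Γ.len e)

namespace RadialTree

variable {V : Type*} {b : ℕ → ℕ} (T : RadialTree V b)

theorem lev_add {β : ℕ → Type*} [∀ k, AddCommGroup (β k)] (x y : ∀ t : T.Edge, β t.gen) (k : ℕ) (t : T.Edge) :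
    T.lev (x + y) k t = T.lev x k t + T.lev y k t := by
  by_cases h : t.gen = k
  · subst h; simp
  · simp [lev, h]

section linear

variable {β : ℕ → Type*} [∀ k, AddCommGroup (β k)] [∀ k, Module ℂ (β k)]
  {c : ModeIndex b → T.Edge → ℝ}

theorem lev_smul (r : ℂ) (x : ∀ t : T.Edge, β t.gen) (k : ℕ) (t : T.Edge) :
    T.lev (r • x) k t = r • T.lev x k t := by
  by_cases h : t.gen = k
  · subst h; simp
  · simp [lev, h]

theorem analysis_add (x y : ∀ t : T.Edge, β t.gen) (i : ModeIndex b) (k : ℕ) :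
    T.analysis c (x + y) i k = T.analysis c x i k + T.analysis c y i k := by
  simp only [analysis, lev_add, smul_add, Finset.sum_add_distrib]

theorem analysis_smul (r : ℂ) (x : ∀ t : T.Edge, β t.gen) (i : ModeIndex b) (k : ℕ) :
    T.analysis c (r • x) i k = r • T.analysis c x i k := by
  simp only [analysis, lev_smul, Finset.smul_sum, smul_comm r]

end linear

namespace IsModeSystem

variable {T} {c : ModeIndex b → T.Edge → ℝ}

/-- A mode born after `t` is orthogonal to all older modes, which are constant on sets of
successors. Hence its sums over successors, as a function on the generation of `t`, are orthogonal
to all modes living there, and these form a basis. This is the origin of the Dirichlet condition at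
the start of each line. -/
theorem sum_succ_eq_zero (hc : T.IsModeSystem c) (t : T.Edge) {i : ModeIndex b}
    (hi : i.1 = t.gen) : ∑ s ∈ T.succ t, c i s = 0 := by
  classical
  obtain ⟨k, hk⟩ : ∃ k, k = t.gen := ⟨_, rfl⟩
  rw [← hk] at hi
  have hk1 : 1 ≤ k := hk ▸ T.gen_pos t
  set y : T.Edge → ℝ := fun t => ∑ s ∈ T.succ t, c i s
  have h1 : ∀ l ∈ modesBelow b k, (Real.sqrt (b k))⁻¹ * ∑ t ∈ T.level k, c l t * y t = 0 := by
    intro l hl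
    have hl' := mem_modesBelow.1 hl
    have := hc.orthonormal (k + 1) i (by simp [hi]) l (by simp; omega)
    rw [if_neg (fun h => by rw [← h] at hl'; omega), T.sum_level_succ hk1] at this
    rw [← this, Finset.mul_sum]
    refine Finset.sum_congr rfl fun t ht => ?_
    have htk := T.mem_level.1 ht
    simp only [y, Finset.mul_sum]
    refine Finset.sum_congr rfl fun s hs => ?_
    rw [hc.succ s t (T.mem_succ.1 hs) l (by omega), htk]
    ring
  have hr : (Real.sqrt (b k))⁻¹ ≠ 0 ∨ b k = 0 := by
    by_cases h : b k = 0
    · exact Or.inr h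
    · exact Or.inl (inv_ne_zero (Real.sqrt_pos.2 (by exact_mod_cast Nat.pos_of_ne_zero h)).ne')
  rcases hr with hr | hr
  · have ht : t ∈ T.level k := by simp [hk]
    have h2 : y t = ∑ t' ∈ T.level k, (∑ l ∈ modesBelow b k, c l t * c l t') * y t' := by
      rw [Finset.sum_congr rfl (g := fun t' => if t = t' then y t' else 0) fun t' ht' => by
        rw [hc.complete k t ht t' ht']; split_ifs <;> simp]
      rw [Finset.sum_ite_eq, if_pos ht]
    change y t = 0
    rw [h2]
    simp only [Finset.sum_mul]
    rw [Finset.sum_comm]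
    refine Finset.sum_eq_zero fun l hl => ?_
    have := (mul_eq_zero.1 (h1 l hl)).resolve_left hr
    rw [Finset.sum_congr rfl (g := fun t' => c l t * (c l t' * y t')) fun _ _ => by ring,
      ← Finset.mul_sum, this, mul_zero]
  · have : T.succ t = ∅ := by rw [← Finset.card_eq_zero, T.card_succ_edge, ← hk, hr]
    rw [this, Finset.sum_empty]

theorem sum_level_succ_of_lt (hc : T.IsModeSystem c) {i : ModeIndex b} {k : ℕ} (hi : i.1 < k)
    (X : T.Edge → ℂ) : ∑ s ∈ T.level (k + 1), (c i s : ℂ) * X s =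
      ((Real.sqrt (b k))⁻¹ : ℝ) * ∑ t ∈ T.level k, (c i t : ℂ) * ∑ s ∈ T.succ t, X s := by
  rw [T.sum_level_succ (by omega), Finset.mul_sum]
  refine Finset.sum_congr rfl fun t ht => ?_
  have htk := T.mem_level.1 ht
  rw [Finset.mul_sum, Finset.mul_sum]
  refine Finset.sum_congr rfl fun s hs => ?_
  rw [hc.succ s t (T.mem_succ.1 hs) i (by omega), htk]
  push_cast; ring

end IsModeSystem

section H2

variable {Γ : ℕ → DecorationGraph} {c : ModeIndex b → T.Edge → ℝ}

theorem analysis_o₀ (a : ∀ t : T.Edge, (Γ t.gen).V → ℂ) (i : ModeIndex b) (k : ℕ) :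
    T.analysis (β := fun k => (Γ k).V → ℂ) c a i k (Γ k).o₀ =
      ∑ t ∈ T.level k, (c i t : ℂ) * a t (Γ t.gen).o₀ := by
  simp only [analysis, Finset.sum_apply, Pi.smul_apply, smul_eq_mul]
  refine Finset.sum_congr rfl fun t ht => ?_
  obtain rfl := T.mem_level.1 ht
  rw [lev_self]

theorem analysis_o₁ (a : ∀ t : T.Edge, (Γ t.gen).V → ℂ) (i : ModeIndex b) (k : ℕ) :
    T.analysis (β := fun k => (Γ k).V → ℂ) c a i k (Γ k).o₁ =
      ∑ t ∈ T.level k, (c i t : ℂ) * a t (Γ t.gen).o₁ := by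
  simp only [analysis, Finset.sum_apply, Pi.smul_apply, smul_eq_mul]
  refine Finset.sum_congr rfl fun t ht => ?_
  obtain rfl := T.mem_level.1 ht
  rw [lev_self]

theorem dag₀_analysis (p : ∀ t : T.Edge, (Γ t.gen).E → ℝ → ℂ) (i : ModeIndex b) (k : ℕ) :
    (Γ k).dag₀ (T.analysis (β := fun k => (Γ k).E → ℝ → ℂ) c p i k) =
      ∑ t ∈ T.level k, (c i t : ℂ) * (Γ t.gen).dag₀ (p t) := by
  simp only [analysis, DecorationGraph.dag₀_sum]
  refine Finset.sum_congr rfl fun t ht => ?_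
  obtain rfl := T.mem_level.1 ht
  rw [lev_self]

theorem dag₁_analysis (p : ∀ t : T.Edge, (Γ t.gen).E → ℝ → ℂ)
    (a : ∀ t : T.Edge, (Γ t.gen).V → ℂ) (i : ModeIndex b) (k : ℕ) :
    (Γ k).dag₁ (T.analysis (β := fun k => (Γ k).E → ℝ → ℂ) c p i k)
      (T.analysis (β := fun k => (Γ k).V → ℂ) c a i k) =
      ∑ t ∈ T.level k, (c i t : ℂ) * (Γ t.gen).dag₁ (p t) (a t) := by
  simp only [analysis, DecorationGraph.dag₁_sum]
  refine Finset.sum_congr rfl fun t ht => ?_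
  obtain rfl := T.mem_level.1 ht
  rw [lev_self, lev_self]

/-- The components of a function satisfying the conditions of `H_G` satisfy those of the
line-like graphs. -/
theorem isH2_analysis (hb : ∀ n, 1 ≤ b n) (hc : T.IsModeSystem c)
    {f w : ∀ t : T.Edge, (Γ t.gen).EdgeFun}
    {u u' : ∀ t : T.Edge, (Γ t.gen).E → ℝ → ℂ} {a : ∀ t : T.Edge, (Γ t.gen).V → ℂ}
    (h : T.IsH2 Γ (fun x => f x.1 x.2) (fun x => w x.1 x.2) u u' a) (i : ModeIndex b) :
    LineLike.IsH2 b Γ i.1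
      (fun x => T.analysis (β := fun k => (Γ k).EdgeFun) c f i x.1 x.2)
      (fun x => T.analysis (β := fun k => (Γ k).EdgeFun) c w i x.1 x.2)
      (T.analysis (β := fun k => (Γ k).E → ℝ → ℂ) c u i)
      (T.analysis (β := fun k => (Γ k).E → ℝ → ℂ) c u' i)
      (T.analysis (β := fun k => (Γ k).V → ℂ) c a i) := by
  have hsq : ∀ k, (Real.sqrt (b k) : ℂ) ≠ 0 := fun k => by
    have : 0 < Real.sqrt (b k) := Real.sqrt_pos.2 (by exact_mod_cast hb k)
    exact_mod_cast this.ne'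
  have hsq2 : ∀ k, (Real.sqrt (b k) : ℂ) * (Real.sqrt (b k) : ℂ) = b k := fun k => by
    rw [← Complex.ofReal_mul, Real.mul_self_sqrt (by positivity)]; simp
  refine ⟨fun k => ?_, ?_, fun k hk => ?_, fun k hk => ?_⟩
  · refine DecorationGraph.IsH2.sum (T.level k) (fun t => (c i t : ℂ))
      (f := T.lev (β := fun k => (Γ k).EdgeFun) f k) (w := T.lev (β := fun k => (Γ k).EdgeFun) w k)
      (u := T.lev (β := fun k => (Γ k).E → ℝ → ℂ) u k)
      (u' := T.lev (β := fun k => (Γ k).E → ℝ → ℂ) u' k)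
      (a := T.lev (β := fun k => (Γ k).V → ℂ) a k) fun t ht => ?_
    obtain ⟨k, hk⟩ := k
    obtain rfl : t.gen = k := T.mem_level.1 ht
    simp only [lev_self]
    exact h.deco t
  -- For `m = 0` this is the Dirichlet condition at the root. For `m > 0`, continuity makes the
  -- starting values agree on siblings, and the mode has zero sum over them.
  · rw [analysis_o₀]
    obtain ⟨m, j⟩ := i
    rcases Nat.eq_zero_or_pos m with rfl | hm
    · refine Finset.sum_eq_zero fun t ht => ?_
      rw [h.root t ((T.root_iff t).2 (T.mem_level.1 ht)), mul_zero]
    · rw [T.sum_level_succ hm]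
      refine Finset.sum_eq_zero fun t ht => ?_
      obtain rfl := T.mem_level.1 ht
      rw [Finset.sum_congr rfl fun s hs => by rw [h.continuity t s (T.mem_succ.1 hs)],
        ← Finset.sum_mul, ← Complex.ofReal_sum, hc.sum_succ_eq_zero t rfl]
      simp
  -- The sum over `b k` equal sibling values and the factor `(b k)^(-1/2)` of the mode together
  -- produce `(b k)^(1/2)`, the inverse of the junction weight.
  · rw [analysis_o₀, analysis_o₁, hc.sum_level_succ_of_lt hk, ← mul_assoc, Finset.mul_sum]
    refine Finset.sum_congr rfl fun t ht => ?_
    obtain rfl := T.mem_level.1 ht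
    rw [Finset.sum_congr rfl fun s hs => by rw [h.continuity t s (T.mem_succ.1 hs)],
      Finset.sum_const, T.card_succ_edge, nsmul_eq_mul, ← hsq2]
    have := hsq t.gen
    push_cast
    field_simp
  · rw [dag₀_analysis, dag₁_analysis, hc.sum_level_succ_of_lt hk, ← mul_assoc]
    have := hsq k
    push_cast
    rw [mul_inv_cancel₀ this, one_mul]
    refine Finset.sum_congr rfl fun t ht => ?_
    rw [← h.kirchhoff t]; rfl

/-- A function on the tree-like graph whose components satisfy the conditions of the line-like
graphs satisfies those of `H_G`. -/
theorem isH2_synthesis (hb : ∀ n, 1 ≤ b n) (hc : T.IsModeSystem c)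
    {f w : ModeIndex b → ∀ k, (Γ k).EdgeFun}
    {u u' : ModeIndex b → ∀ k, (Γ k).E → ℝ → ℂ} {a : ModeIndex b → ∀ k, (Γ k).V → ℂ}
    (h : ∀ i, LineLike.IsH2 b Γ i.1 (fun x => f i x.1 x.2) (fun x => w i x.1 x.2)
      (u i) (u' i) (a i)) :
    T.IsH2 Γ (fun x => T.synthesis (β := fun k => (Γ k).EdgeFun) c f x.1 x.2)
      (fun x => T.synthesis (β := fun k => (Γ k).EdgeFun) c w x.1 x.2)
      (T.synthesis (β := fun k => (Γ k).E → ℝ → ℂ) c u)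
      (T.synthesis (β := fun k => (Γ k).E → ℝ → ℂ) c u')
      (T.synthesis (β := fun k => (Γ k).V → ℂ) c a) := by
  have hsq : ∀ k, (Real.sqrt (b k) : ℂ) ≠ 0 := fun k => by
    have : 0 < Real.sqrt (b k) := Real.sqrt_pos.2 (by exact_mod_cast hb k)
    exact_mod_cast this.ne'
  have hsq2 : ∀ k, (Real.sqrt (b k) : ℂ) * (Real.sqrt (b k) : ℂ) = b k := fun k => by
    rw [← Complex.ofReal_mul, Real.mul_self_sqrt (by positivity)]; simp
  have ho₀ : ∀ t, T.synthesis (β := fun k => (Γ k).V → ℂ) c a t (Γ t.gen).o₀ =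
      ∑ i ∈ modesBelow b t.gen, (c i t : ℂ) * a i t.gen (Γ t.gen).o₀ := fun t => by
    simp [synthesis, Finset.sum_apply]
  have ho₁ : ∀ t, T.synthesis (β := fun k => (Γ k).V → ℂ) c a t (Γ t.gen).o₁ =
      ∑ i ∈ modesBelow b t.gen, (c i t : ℂ) * a i t.gen (Γ t.gen).o₁ := fun t => by
    simp [synthesis, Finset.sum_apply]
  refine ⟨fun t => ?_, fun t ht => ?_, fun t s hst => ?_, fun t => ?_⟩
  · exact DecorationGraph.IsH2.sum (modesBelow b t.gen) (fun i => (c i t : ℂ))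
      (f := fun i => f i t.gen) (w := fun i => w i t.gen) (u := fun i => u i t.gen)
      (u' := fun i => u' i t.gen) (a := fun i => a i t.gen)
      fun i hi => (h i).deco ⟨t.gen, mem_modesBelow.1 hi⟩
  · rw [ho₀, (T.root_iff t).1 ht]
    refine Finset.sum_eq_zero fun i hi => ?_
    obtain ⟨m, j⟩ := i
    obtain rfl : m = 0 := by simpa using hi
    rw [show a ⟨0, j⟩ 1 (Γ 1).o₀ = 0 from (h ⟨0, j⟩).start, mul_zero]
  · rw [ho₀, ho₁, T.gen_of_src_eq hst, sum_modesBelow_succ]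
    -- Modes born at this generation vanish at their starting vertex, so only the older ones
    -- contribute to the value.
    rw [Finset.sum_eq_zero (s := Finset.univ) fun j _ => by
      rw [show a ⟨t.gen, j⟩ (t.gen + 1) (Γ (t.gen + 1)).o₀ = 0 from (h ⟨t.gen, j⟩).start, mul_zero],
      add_zero]
    refine Finset.sum_congr rfl fun i hi => ?_
    have hi' := mem_modesBelow.1 hi
    rw [hc.succ s t hst i hi', (h i).value t.gen hi']
    push_cast; ring
  · have e1 : ∀ s, (Γ s.gen).dag₀ (T.synthesis (β := fun k => (Γ k).E → ℝ → ℂ) c u' s) =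
        ∑ i ∈ modesBelow b s.gen, (c i s : ℂ) * (Γ s.gen).dag₀ (u' i s.gen) := fun s => by
      simp only [synthesis, DecorationGraph.dag₀_sum]
    have e2 : (Γ t.gen).dag₁ (T.synthesis (β := fun k => (Γ k).E → ℝ → ℂ) c u' t)
        (T.synthesis (β := fun k => (Γ k).V → ℂ) c a t) =
        ∑ i ∈ modesBelow b t.gen, (c i t : ℂ) * (Γ t.gen).dag₁ (u' i t.gen) (a i t.gen) := by
      simp only [synthesis, DecorationGraph.dag₁_sum]
    rw [e2]
    change ∑ s ∈ T.succ t, _ = _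
    rw [Finset.sum_congr rfl (g := fun s => ∑ i ∈ modesBelow b (t.gen + 1),
      (c i s : ℂ) * (Γ (t.gen + 1)).dag₀ (u' i (t.gen + 1))) fun s hs => by
        rw [e1, T.gen_of_src_eq (T.mem_succ.1 hs)], Finset.sum_comm, sum_modesBelow_succ]
    -- Newborn modes have zero sum over siblings and drop out of the Kirchhoff condition, whatever
    -- their derivatives are.
    simp only [← Finset.sum_mul, ← Complex.ofReal_sum, fun j => hc.sum_succ_eq_zero t (i := ⟨t.gen, j⟩) rfl]
    simp only [Complex.ofReal_zero, zero_mul, Finset.sum_const_zero, add_zero]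
    refine Finset.sum_congr rfl fun i hi => ?_
    have hi' := mem_modesBelow.1 hi
    rw [(h i).deriv t.gen hi', Finset.sum_congr rfl fun s hs =>
      hc.succ s t (T.mem_succ.1 hs) i hi', Finset.sum_const, T.card_succ_edge, nsmul_eq_mul]
    push_cast
    rw [← hsq2]
    have := hsq t.gen
    field_simp

end H2

end RadialTree

/-! ### Direct sums and unitary equivalence preserve self-adjointness. -/

theorem mem_graph_directSumOperator {ι : Type*} {K : ι → Type*} [∀ i, NormedAddCommGroup (K i)]
    [∀ i, InnerProductSpace ℂ (K i)] {A : ∀ i, K i →ₗ.[ℂ] K i} {f g : lp K 2} :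
    (f, g) ∈ (directSumOperator A).graph ↔ ∀ i, (f i, g i) ∈ (A i).graph := by
  rw [LinearPMap.mem_graph_iff]
  constructor
  · rintro ⟨y, rfl, rfl⟩ i
    exact y.2.choose_spec i
  · intro h
    refine ⟨⟨f, g, h⟩, rfl, ?_⟩
    ext1
    funext i
    exact LinearPMap.mem_graph_snd_inj' (A i)
      ((⟨f, g, h⟩ : (directSumOperator A).domain).2.choose_spec i) (h i) rfl

/-- Vectors supported in a single summand test each component of the adjoint separately. -/
theorem isSelfAdjointRelation_directSum {ι : Type*} {K : ι → Type*}
    [∀ i, NormedAddCommGroup (K i)] [∀ i, InnerProductSpace ℂ (K i)] {A : ∀ i, K i →ₗ.[ℂ] K i}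
    (hA : ∀ i, IsSelfAdjointRelation (A i).graph) :
    IsSelfAdjointRelation (directSumOperator A).graph := by
  classical
  intro x y
  constructor
  · intro h p q hpq
    rw [mem_graph_directSumOperator] at h hpq
    rw [lp.inner_eq_tsum, lp.inner_eq_tsum]
    exact tsum_congr fun i => (hA i _ _).1 (h i) _ _ (hpq i)
  · intro H
    rw [mem_graph_directSumOperator]
    intro i
    refine (hA i _ _).2 fun p q hpq => ?_
    have := H (lp.single 2 i p) (lp.single 2 i q) (mem_graph_directSumOperator.2 fun j => ?_)
    · rwa [lp.inner_single_left, lp.inner_single_left] at this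
    · by_cases hj : j = i
      · subst hj; simpa using hpq
      · rw [lp.single_apply_ne _ _ _ hj, lp.single_apply_ne _ _ _ hj]
        exact (A j).graph.zero_mem

theorem isSelfAdjointRelation_of_unitarilyEquivalent {K L : Type*} [NormedAddCommGroup K]
    [InnerProductSpace ℂ K] [NormedAddCommGroup L] [InnerProductSpace ℂ L] {A : K →ₗ.[ℂ] K}
    {B : L →ₗ.[ℂ] L} (h : UnitarilyEquivalent A B) (hB : IsSelfAdjointRelation B.graph) :
    IsSelfAdjointRelation A.graph := by
  obtain ⟨U, hU⟩ := h
  intro x y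
  rw [hU, hB]
  constructor
  · intro H p q hpq
    have := H (U p) (U q) ((hU p q).1 hpq)
    rwa [U.inner_map_map, U.inner_map_map] at this
  · intro H p q hpq
    have := H (U.symm p) (U.symm q) ((hU _ _).2 (by simpa using hpq))
    rw [← U.inner_map_map, ← U.inner_map_map] at this
    simpa using this

theorem norm_eq_of_enorm_sq_eq {E F : Type*} [NormedAddCommGroup E] [NormedAddCommGroup F]
    {x : E} {y : F} (h : ‖x‖ₑ ^ 2 = ‖y‖ₑ ^ 2) : ‖x‖ = ‖y‖ := by
  have := (ENNReal.pow_right_strictMono two_ne_zero).injective h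
  rw [← toReal_enorm, this, toReal_enorm]

/-! ### The unitary reduction of the Hamiltonian. -/

namespace RadialTree

variable {V : Type*} {b : ℕ → ℕ} (T : RadialTree V b) (Γ : ℕ → DecorationGraph)
  {c : ModeIndex b → T.Edge → ℝ}

/-- The decomposition of functions on the tree-like graph into components on line-like graphs. -/
abbrev component (c : ModeIndex b → T.Edge → ℝ) (F : T.L2 Γ) (i : ModeIndex b) (k : ℕ) :
    (Γ k).EdgeFun :=
  T.analysis (β := fun k => (Γ k).EdgeFun) c (fun t e => F ⟨t, e⟩) i k

theorem tsum_component (hc : T.IsModeSystem c) (F : T.L2 Γ) :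
    ∑' i, ∑' y : LineLike.GraphEdge Γ i.1, ‖T.component Γ c F i y.1 y.2‖ₑ ^ 2 = ‖F‖ₑ ^ 2 := by
  rw [lp.enorm_sq_eq_tsum, ← T.tsum_analysis Γ hc fun t e => F ⟨t, e⟩]

theorem memℓp_component (hc : T.IsModeSystem c) (F : T.L2 Γ) (i : ModeIndex b) :
    Memℓp (fun y : LineLike.GraphEdge Γ i.1 => T.component Γ c F i y.1 y.2) 2 := by
  rw [memℓp_two_iff_tsum]
  refine ne_top_of_le_ne_top (ENNReal.pow_ne_top enorm_ne_top) ?_ (b := ‖F‖ₑ ^ 2)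
  rw [← T.tsum_component Γ hc F]
  exact ENNReal.le_tsum i

/-- The unitary map of the reduction, as an isometry. -/
def reduction (hc : T.IsModeSystem c) :
    T.L2 Γ →ₗᵢ[ℂ] lp (fun i : ModeIndex b => LineLike.L2 Γ i.1) 2 where
  toFun F := ⟨fun i => ⟨_, T.memℓp_component Γ hc F i⟩, memℓp_two_iff_tsum.2 <| by
    simp only [lp.enorm_sq_eq_tsum]
    rw [T.tsum_component Γ hc F]
    exact ENNReal.pow_ne_top enorm_ne_top⟩
  map_add' F G := by
    ext1; funext i; ext1; funext y
    exact congrFun (T.analysis_add (β := fun k => (Γ k).EdgeFun) _ _ i y.1) y.2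
  map_smul' r F := by
    ext1; funext i; ext1; funext y
    exact congrFun (T.analysis_smul (β := fun k => (Γ k).EdgeFun) r _ i y.1) y.2
  norm_map' F := by
    refine norm_eq_of_enorm_sq_eq ?_
    rw [lp.enorm_sq_eq_tsum]
    simp only [lp.enorm_sq_eq_tsum (ι := LineLike.GraphEdge Γ _)]
    exact T.tsum_component Γ hc F

theorem reduction_apply (hc : T.IsModeSystem c) (F : T.L2 Γ) (i : ModeIndex b)
    (y : LineLike.GraphEdge Γ i.1) :
    T.reduction Γ hc F i y = T.component Γ c F i y.1 y.2 := rfl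

/-- Extension by zero of the components on the line-like graphs. -/
def extendComponent (G : lp (fun i : ModeIndex b => LineLike.L2 Γ i.1) 2) (i : ModeIndex b)
    (k : ℕ) : (Γ k).EdgeFun :=
  if h : i.1 < k then fun e => G i ⟨⟨k, h⟩, e⟩ else 0

theorem analysis_synthesis_extendComponent (hc : T.IsModeSystem c)
    (G : lp (fun i : ModeIndex b => LineLike.L2 Γ i.1) 2) (i : ModeIndex b)
    (y : LineLike.GraphEdge Γ i.1) :
    T.analysis (β := fun k => (Γ k).EdgeFun) c
      (T.synthesis (β := fun k => (Γ k).EdgeFun) c (extendComponent Γ G)) i y.1 y.2 = G i y := by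
  obtain ⟨⟨k, hk⟩, e⟩ := y
  have h := T.analysis_synthesis (β := fun k => (Γ k).EdgeFun) hc (extendComponent Γ G)
    (i := i) (k := k) hk
  rw [extendComponent, dif_pos (show i.1 < k from hk)] at h
  exact congrFun h e

theorem memℓp_synthesis (hc : T.IsModeSystem c)
    (G : lp (fun i : ModeIndex b => LineLike.L2 Γ i.1) 2) :
    Memℓp (fun x : T.GraphEdge Γ =>
      T.synthesis (β := fun k => (Γ k).EdgeFun) c (extendComponent Γ G) x.1 x.2) 2 := by
  rw [memℓp_two_iff_tsum, ← T.tsum_analysis Γ hc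
    (T.synthesis (β := fun k => (Γ k).EdgeFun) c (extendComponent Γ G))]
  have h : ∀ i : ModeIndex b, ∑' y : LineLike.GraphEdge Γ i.1,
      ‖T.analysis (β := fun k => (Γ k).EdgeFun) c
        (T.synthesis (β := fun k => (Γ k).EdgeFun) c (extendComponent Γ G)) i y.1 y.2‖ₑ ^ 2 =
      ‖G i‖ₑ ^ 2 := fun i => by
    rw [lp.enorm_sq_eq_tsum]
    exact tsum_congr fun y => by rw [T.analysis_synthesis_extendComponent Γ hc]
  rw [tsum_congr h, ← lp.enorm_sq_eq_tsum]
  exact ENNReal.pow_ne_top enorm_ne_top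

theorem reduction_surjective (hc : T.IsModeSystem c) :
    Function.Surjective (T.reduction Γ hc) := by
  intro G
  refine ⟨⟨_, T.memℓp_synthesis Γ hc G⟩, ?_⟩
  ext1; funext i; ext1; funext y
  rw [reduction_apply]
  exact T.analysis_synthesis_extendComponent Γ hc G i y

/-- The unitary map of the reduction. -/
def reductionEquiv (hc : T.IsModeSystem c) :
    T.L2 Γ ≃ₗᵢ[ℂ] lp (fun i : ModeIndex b => LineLike.L2 Γ i.1) 2 :=
  LinearIsometryEquiv.ofSurjective (T.reduction Γ hc) (T.reduction_surjective Γ hc)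

theorem component_neg (F : T.L2 Γ) (i : ModeIndex b) (k : ℕ) :
    T.analysis (β := fun k => (Γ k).EdgeFun) c (fun t e => -F ⟨t, e⟩) i k =
      -T.component Γ c F i k := by
  have := T.analysis_smul (β := fun k => (Γ k).EdgeFun) (c := c) (-1) (fun t e => F ⟨t, e⟩) i k
  simp only [neg_one_smul] at this
  exact this

theorem isH2_component (hb : ∀ n, 1 ≤ b n) (hc : T.IsModeSystem c) {x y : T.L2 Γ}
    (h : (x, y) ∈ T.hamiltonianGraph Γ) (i : ModeIndex b) :
    (T.reductionEquiv Γ hc x i, T.reductionEquiv Γ hc y i) ∈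
      LineLike.hamiltonianGraph b Γ i.1 := by
  obtain ⟨u, u', a, h⟩ := h
  have h1 := T.isH2_analysis hb hc (f := fun t e => x ⟨t, e⟩) (w := fun t e => -y ⟨t, e⟩) h i
  simp only [component_neg] at h1
  exact ⟨_, _, _, h1⟩

theorem isH2_of_component (hb : ∀ n, 1 ≤ b n) (hc : T.IsModeSystem c) {x y : T.L2 Γ}
    (H : ∀ i, (T.reductionEquiv Γ hc x i, T.reductionEquiv Γ hc y i) ∈
      LineLike.hamiltonianGraph b Γ i.1) :
    (x, y) ∈ T.hamiltonianGraph Γ := by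
  choose u u' a h using H
  have h1 := T.isH2_synthesis hb hc (f := T.component Γ c x)
    (w := fun i k => -T.component Γ c y i k) h
  have h2 : T.synthesis (β := fun k => (Γ k).EdgeFun) c (T.component Γ c x) =
    fun t e => x ⟨t, e⟩ := T.synthesis_analysis (β := fun k => (Γ k).EdgeFun) hc _
  have h3 : T.synthesis (β := fun k => (Γ k).EdgeFun) c
      (fun i k => -T.component Γ c y i k) = fun t e => -y ⟨t, e⟩ := by
    rw [← T.synthesis_analysis (β := fun k => (Γ k).EdgeFun) hc fun t e => -y ⟨t, e⟩]
    congr 1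
    funext i k
    exact (T.component_neg Γ y i k).symm
  rw [h2, h3] at h1
  exact ⟨_, _, _, h1⟩

theorem unitarilyEquivalent_hamiltonian (hb0 : b 0 = 1) (hb : ∀ n, 1 ≤ b n) :
    UnitarilyEquivalent (T.hamiltonian Γ)
      (directSumOperator fun i : ModeIndex b => LineLike.hamiltonian b Γ i.1) := by
  obtain ⟨c, hc⟩ := T.exists_isModeSystem hb0 hb
  refine ⟨T.reductionEquiv Γ hc, fun x y => ?_⟩
  rw [mem_graph_directSumOperator, T.graph_hamiltonian]
  simp only [LineLike.graph_hamiltonian]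
  exact ⟨fun h i => T.isH2_component Γ hb hc h i, T.isH2_of_component Γ hb hc⟩

end RadialTree

/-! ### Resolvent kernels and uniqueness of the Borel transform. -/

open Filter Topology BoundedContinuousFunction

theorem abs_im_le_norm_ofReal_sub (t : ℝ) (z : ℂ) : |z.im| ≤ ‖(t : ℂ) - z‖ := by
  simpa using Complex.abs_im_le_norm ((t : ℂ) - z)

theorem ofReal_sub_ne_zero {z : ℂ} (hz : z.im ≠ 0) (t : ℝ) : (t : ℂ) - z ≠ 0 := by
  rw [← norm_pos_iff]
  exact (abs_pos.2 hz).trans_le (abs_im_le_norm_ofReal_sub t z)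

theorem norm_inv_ofReal_sub_le {z : ℂ} (hz : z.im ≠ 0) (t : ℝ) :
    ‖((t : ℂ) - z)⁻¹‖ ≤ |z.im|⁻¹ := by
  rw [norm_inv]
  exact inv_anti₀ (abs_pos.2 hz) (abs_im_le_norm_ofReal_sub t z)

/-- The nonreal complex numbers. -/
abbrev Nonreal : Type := {z : ℂ // z.im ≠ 0}

namespace Nonreal

/-- Complex conjugation of nonreal numbers. -/
def star (z : Nonreal) : Nonreal := ⟨conj z.1, by simpa using z.2⟩

/-- The resolvent kernel `t ↦ (t - z)⁻¹`. -/
def kernel (z : Nonreal) : ℝ →ᵇ ℂ :=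
  BoundedContinuousFunction.ofNormedAddCommGroup (fun t : ℝ => ((t : ℂ) - z.1)⁻¹)
    ((Complex.continuous_ofReal.sub continuous_const).inv₀ fun t => ofReal_sub_ne_zero z.2 t)
    |z.1.im|⁻¹ (norm_inv_ofReal_sub_le z.2)

@[simp]
theorem kernel_apply (z : Nonreal) (t : ℝ) : z.kernel t = ((t : ℂ) - z.1)⁻¹ := rfl

theorem star_kernel (z : Nonreal) : Star.star z.kernel = z.star.kernel := by
  ext t
  simp [star]

theorem conj_kernel (z : Nonreal) (t : ℝ) : conj (z.kernel t) = z.star.kernel t := by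
  simp [star]

theorem norm_kernel_le (z : Nonreal) : ‖z.kernel‖ ≤ |z.1.im|⁻¹ :=
  BoundedContinuousFunction.norm_ofNormedAddCommGroup_le _ (by positivity) _

theorem kernel_sub_kernel (z w : Nonreal) :
    z.kernel - w.kernel = (z.1 - w.1) • (z.kernel * w.kernel) := by
  ext t
  have h1 := ofReal_sub_ne_zero z.2 t
  have h2 := ofReal_sub_ne_zero w.2 t
  simp
  field_simp
  ring

/-- A sequence of nonreal numbers different from `z` and converging to `z`. -/
def approx (z : Nonreal) (n : ℕ) : Nonreal := ⟨z.1 + ((1 / ((n : ℝ) + 1) : ℝ) : ℂ), by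
  rw [Complex.add_im, Complex.ofReal_im, add_zero]; exact z.2⟩

theorem approx_sub (z : Nonreal) (n : ℕ) :
    (z.approx n).1 - z.1 = ((1 / ((n : ℝ) + 1) : ℝ) : ℂ) := by
  simp [approx]

theorem approx_ne (z : Nonreal) (n : ℕ) : (z.approx n).1 - z.1 ≠ 0 := by
  rw [approx_sub, Complex.ofReal_ne_zero]
  positivity

theorem approx_im (z : Nonreal) (n : ℕ) : (z.approx n).1.im = z.1.im := by
  rw [approx, Complex.add_im, Complex.ofReal_im, add_zero]

/-- A function on the nonreal numbers which is Lipschitz on horizontal lines converges along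
the approximating sequence. -/
theorem tendsto_approx {E : Type*} [NormedAddCommGroup E] {F : Nonreal → E} {C : ℝ}
    (z : Nonreal) (h : ∀ n, ‖F (z.approx n) - F z‖ ≤ ‖(z.approx n).1 - z.1‖ * C) :
    Tendsto (fun n => F (z.approx n)) atTop (𝓝 (F z)) := by
  rw [tendsto_iff_norm_sub_tendsto_zero]
  refine squeeze_zero (fun _ => norm_nonneg _) h ?_
  have h1 : ∀ n : ℕ, ‖(z.approx n).1 - z.1‖ = 1 / ((n : ℝ) + 1) := fun n => by
    rw [approx_sub, Complex.norm_real, Real.norm_of_nonneg (by positivity)]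
  simp only [h1]
  simpa using tendsto_one_div_add_atTop_nhds_zero_nat.mul_const C

theorem tendsto_kernel (z : Nonreal) :
    Tendsto (fun n => (z.approx n).kernel) atTop (𝓝 z.kernel) := by
  refine z.tendsto_approx (C := |z.1.im|⁻¹ * |z.1.im|⁻¹) fun n => ?_
  rw [kernel_sub_kernel, norm_smul]
  gcongr
  refine (norm_mul_le _ _).trans ?_
  gcongr
  · exact (norm_kernel_le _).trans_eq (by rw [approx_im])
  · exact norm_kernel_le _

end Nonreal

/-- The constants and the resolvent kernels. -/
def kernelSet : Set (ℝ →ᵇ ℂ) := insert 1 (range Nonreal.kernel)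

/-- For `z ≠ w` the resolvent identity writes the product of two kernels as a linear combination of
them. Squares are limits of such products, which is why the closure is needed. -/
theorem mul_mem_closure_span_kernelSet {f g : ℝ →ᵇ ℂ} (hf : f ∈ kernelSet) (hg : g ∈ kernelSet) :
    f * g ∈ (Submodule.span ℂ kernelSet).topologicalClosure := by
  have hs : Submodule.span ℂ kernelSet ≤ (Submodule.span ℂ kernelSet).topologicalClosure :=
    Submodule.le_topologicalClosure _
  rcases hf with rfl | ⟨z, rfl⟩
  · rw [one_mul]; exact hs (Submodule.subset_span hg)
  rcases hg with rfl | ⟨w, rfl⟩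
  · rw [mul_one]; exact hs (Submodule.subset_span (Or.inr ⟨z, rfl⟩))
  have key : ∀ z w : Nonreal, z.1 - w.1 ≠ 0 →
      z.kernel * w.kernel ∈ Submodule.span ℂ kernelSet := by
    intro z w h
    have h1 : z.kernel * w.kernel = (z.1 - w.1)⁻¹ • (z.kernel - w.kernel) := by
      rw [Nonreal.kernel_sub_kernel, smul_smul, inv_mul_cancel₀ h, one_smul]
    rw [h1]
    exact Submodule.smul_mem _ _ (Submodule.sub_mem _ (Submodule.subset_span (Or.inr ⟨z, rfl⟩))
      (Submodule.subset_span (Or.inr ⟨w, rfl⟩)))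
  by_cases h : z = w
  · subst h
    refine (Submodule.isClosed_topologicalClosure _).mem_of_tendsto
      ((z.tendsto_kernel).mul_const z.kernel) (Eventually.of_forall fun n => ?_)
    exact hs (key _ _ (z.approx_ne n))
  · exact hs (key z w (sub_ne_zero.2 fun h' => h (Subtype.ext h')))

/-- The closed star algebra generated by the resolvent kernels. -/
def kernelAlgebra : StarSubalgebra ℂ (ℝ →ᵇ ℂ) where
  carrier := (Submodule.span ℂ kernelSet).topologicalClosure
  add_mem' := Submodule.add_mem _
  zero_mem' := Submodule.zero_mem _
  one_mem' := Submodule.le_topologicalClosure _ (Submodule.subset_span (Or.inl rfl))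
  algebraMap_mem' r := by
    rw [Algebra.algebraMap_eq_smul_one]
    exact Submodule.smul_mem _ _
      (Submodule.le_topologicalClosure _ (Submodule.subset_span (Or.inl rfl)))
  mul_mem' {f g} hf hg := by
    set M := (Submodule.span ℂ kernelSet).topologicalClosure
    have hM : IsClosed (M : Set (ℝ →ᵇ ℂ)) := Submodule.isClosed_topologicalClosure _
    have h1 : ∀ f ∈ Submodule.span ℂ kernelSet, ∀ g ∈ Submodule.span ℂ kernelSet, f * g ∈ M := by
      intro f hf g hg
      induction hf using Submodule.span_induction with
      | mem f hf =>
        induction hg using Submodule.span_induction with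
        | mem g hg => exact mul_mem_closure_span_kernelSet hf hg
        | zero => rw [mul_zero]; exact M.zero_mem
        | add a b _ _ ha hb => rw [mul_add]; exact M.add_mem ha hb
        | smul c a _ ha => rw [mul_smul_comm]; exact M.smul_mem c ha
      | zero => rw [zero_mul]; exact M.zero_mem
      | add a b _ _ ha hb => rw [add_mul]; exact M.add_mem ha hb
      | smul c a _ ha => rw [smul_mul_assoc]; exact M.smul_mem c ha
    have h2 := map_mem_closure₂ (f := fun f g : ℝ →ᵇ ℂ => f * g) (u := (M : Set (ℝ →ᵇ ℂ)))
      continuous_mul (show f ∈ closure (Submodule.span ℂ kernelSet : Set _) from hf)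
      (show g ∈ closure (Submodule.span ℂ kernelSet : Set _) from hg) h1
    rwa [hM.closure_eq] at h2
  star_mem' {f} hf := by
    set M := (Submodule.span ℂ kernelSet).topologicalClosure
    have hM : IsClosed (M : Set (ℝ →ᵇ ℂ)) := Submodule.isClosed_topologicalClosure _
    have h1 : MapsTo Star.star (Submodule.span ℂ kernelSet : Set (ℝ →ᵇ ℂ)) (M : Set _) := by
      intro f hf
      induction hf using Submodule.span_induction with
      | mem f hf =>
        refine Submodule.le_topologicalClosure _ (Submodule.subset_span ?_)
        rcases hf with rfl | ⟨z, rfl⟩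
        · rw [star_one]; exact Or.inl rfl
        · rw [z.star_kernel]; exact Or.inr ⟨_, rfl⟩
      | zero => rw [star_zero]; exact M.zero_mem
      | add a b _ _ ha hb => rw [star_add]; exact M.add_mem ha hb
      | smul c a _ ha => rw [star_smul]; exact M.smul_mem _ ha
    have h2 := map_mem_closure (f := Star.star) continuous_star
      (show f ∈ closure (Submodule.span ℂ kernelSet : Set _) from hf) h1
    rwa [hM.closure_eq] at h2

theorem separatesPoints_kernelAlgebra :
    (kernelAlgebra.map (toContinuousMapStarₐ ℂ)).SeparatesPoints := by
  intro s t hst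
  have hI : (Complex.I).im ≠ 0 := by simp
  refine ⟨_, ⟨_, ⟨Nonreal.kernel ⟨Complex.I, hI⟩, ?_, rfl⟩, rfl⟩, ?_⟩
  · exact Submodule.le_topologicalClosure _ (Submodule.subset_span (Or.inr ⟨_, rfl⟩))
  · intro h
    have h' : ((s : ℂ) - Complex.I)⁻¹ = ((t : ℂ) - Complex.I)⁻¹ := h
    rw [inv_inj, sub_left_inj] at h'
    exact hst (by exact_mod_cast h')

theorem integrable_bcf_mul {μ : Measure ℝ} {h : ℝ → ℂ} (hh : Integrable h μ) (m : ℝ →ᵇ ℂ) :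
    Integrable (fun t => m t * h t) μ :=
  hh.bdd_mul m.continuous.aestronglyMeasurable (c := ‖m‖) (ae_of_all _ fun t => m.norm_coe_le_norm t)

/-- An integrable function whose Borel transform vanishes is zero. -/
theorem ae_eq_zero_of_integral_kernel {μ : Measure ℝ} [IsFiniteMeasure μ] {h : ℝ → ℂ}
    (hh : Integrable h μ) (H : ∀ z : Nonreal, ∫ t, z.kernel t * h t ∂μ = 0) : h =ᵐ[μ] 0 := by
  -- The integral of `h` itself is the limit of its integrals against `-z / (t - z)` along `z = (n +
  -- 1) * I`, by dominated convergence.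
  have h1 : ∫ t, h t ∂μ = 0 := by
    set y : ℕ → Nonreal := fun n => ⟨((n : ℝ) + 1 : ℝ) * Complex.I, by
      simp only [Complex.im_ofReal_mul, Complex.I_im, mul_one]; positivity⟩
    have hy : ∀ n, ‖(y n).1‖ = (n : ℝ) + 1 := fun n => by
      simp only [y, norm_mul, Complex.norm_I, mul_one, Complex.norm_real]
      exact Real.norm_of_nonneg (by positivity)
    have hk : ∀ n t, ‖-(y n).1 * (y n).kernel t‖ ≤ 1 := fun n t => by
      rw [norm_mul, norm_neg, hy]
      have h3 := norm_inv_ofReal_sub_le (y n).2 t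
      have h4 : |(y n).1.im| = (n : ℝ) + 1 := by
        simp only [y, Complex.im_ofReal_mul, Complex.I_im, mul_one]
        exact abs_of_nonneg (by positivity)
      rw [h4] at h3
      calc ((n : ℝ) + 1) * ‖(y n).kernel t‖ ≤ ((n : ℝ) + 1) * ((n : ℝ) + 1)⁻¹ := by
            gcongr; exact h3
        _ = 1 := mul_inv_cancel₀ (by positivity)
    have hlim : Tendsto (fun n => ∫ t, -(y n).1 * (y n).kernel t * h t ∂μ) atTop
        (𝓝 (∫ t, h t ∂μ)) := by
      refine tendsto_integral_of_dominated_convergence (fun t => ‖h t‖) (fun n => ?_) hh.norm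
        (fun n => ae_of_all _ fun t => ?_) (ae_of_all _ fun t => ?_)
      · exact ((continuous_const.mul (y n).kernel.continuous).aestronglyMeasurable).mul hh.1
      · rw [norm_mul]
        exact mul_le_of_le_one_left (norm_nonneg _) (hk n t)
      · have h5 : Tendsto (fun n => -(y n).1 * (y n).kernel t) atTop (𝓝 1) := by
          have h6 : ∀ n, -(y n).1 * (y n).kernel t - 1 = -(t : ℂ) * (y n).kernel t := fun n => by
            have := ofReal_sub_ne_zero (y n).2 t
            rw [Nonreal.kernel_apply]
            field_simp
            ring
          rw [tendsto_iff_norm_sub_tendsto_zero]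
          refine squeeze_zero (g := fun n : ℕ => |t| * (1 / ((n : ℝ) + 1)))
            (fun _ => norm_nonneg _) (fun n => ?_) ?_
          · have h4 : |(y n).1.im| = (n : ℝ) + 1 := by
              simp only [y, Complex.im_ofReal_mul, Complex.I_im, mul_one]
              exact abs_of_nonneg (by positivity)
            rw [h6, norm_mul, norm_neg, Complex.norm_real, Real.norm_eq_abs, one_div]
            gcongr
            exact h4 ▸ norm_inv_ofReal_sub_le (y n).2 t
          · simpa using tendsto_one_div_add_atTop_nhds_zero_nat.const_mul |t|
        simpa using h5.mul_const (h t)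
    refine tendsto_nhds_unique hlim ?_
    simp only [mul_assoc, integral_const_mul, H, mul_zero]
    exact tendsto_const_nhds
  have h2 : ∀ m ∈ kernelAlgebra, ∫ t, m t * h t ∂μ = 0 := by
    intro m hm
    have hcl : IsClosed {m : ℝ →ᵇ ℂ | ∫ t, m t * h t ∂μ = 0} := by
      refine isClosed_eq ?_ continuous_const
      refine LipschitzWith.continuous (K := (∫ t, ‖h t‖ ∂μ).toNNReal) ?_
      refine LipschitzWith.of_dist_le_mul fun m m' => ?_
      rw [dist_eq_norm, dist_eq_norm, ← integral_sub (integrable_bcf_mul hh m)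
        (integrable_bcf_mul hh m'), Real.coe_toNNReal _ (integral_nonneg fun _ => norm_nonneg _),
        mul_comm, ← integral_const_mul]
      refine norm_integral_le_of_norm_le (hh.norm.const_mul _) (ae_of_all _ fun t => ?_)
      rw [← sub_mul, norm_mul]
      gcongr
      exact (m - m').norm_coe_le_norm t
    refine closure_minimal (s := (Submodule.span ℂ kernelSet : Set (ℝ →ᵇ ℂ))) ?_ hcl hm
    intro m hm
    induction hm using Submodule.span_induction with
    | mem f hf =>
      rcases hf with rfl | ⟨z, rfl⟩
      · simpa using h1
      · exact H z
    | zero => simp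
    | add a b _ _ ha hb =>
      simp only [mem_ofPred_eq] at ha hb ⊢
      simp only [BoundedContinuousFunction.coe_add, Pi.add_apply, add_mul]
      rw [integral_add (integrable_bcf_mul hh a) (integrable_bcf_mul hh b), ha, hb, add_zero]
    | smul c a _ ha =>
      simp only [mem_ofPred_eq] at ha ⊢
      simp only [BoundedContinuousFunction.coe_smul, smul_eq_mul, mul_assoc]
      rw [integral_const_mul, ha, mul_zero]
  -- The measures with densities the positive and negative parts of `g` have equal integrals on a
  -- separating star subalgebra, so they coincide and `g` vanishes almost everywhere.
  have real : ∀ g : ℝ → ℝ, Integrable g μ →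
      (∀ m ∈ kernelAlgebra, ∫ t, m t * (g t : ℂ) ∂μ = 0) → g =ᵐ[μ] 0 := by
    intro g hg Hg
    have hp : ∀ g : ℝ → ℝ, Integrable g μ →
        IsFiniteMeasure (μ.withDensity fun t => ENNReal.ofReal (g t)) := fun g hg =>
      isFiniteMeasure_withDensity_ofReal hg.2
    have i1 := hp g hg
    have i2 := hp (-g) hg.neg
    have hint : ∀ g : ℝ → ℝ, Integrable g μ → ∀ m : ℝ →ᵇ ℂ,
        ∫ t, m t ∂(μ.withDensity fun t => ENNReal.ofReal (g t)) =
          ∫ t, m t * ((max (g t) 0 : ℝ) : ℂ) ∂μ := by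
      intro g hg m
      rw [integral_withDensity_eq_integral_toReal_smul₀ hg.1.aemeasurable.ennreal_ofReal
        (ae_of_all _ fun t => ENNReal.ofReal_lt_top)]
      refine integral_congr_ae (ae_of_all _ fun t => ?_)
      simp only [ENNReal.toReal_ofReal']
      rw [Complex.real_smul, mul_comm]
    have heq := ext_of_forall_mem_subalgebra_integral_eq_of_polish (𝕜 := ℂ)
      (P := μ.withDensity fun t => ENNReal.ofReal (g t))
      (P' := μ.withDensity fun t => ENNReal.ofReal ((-g) t))
      separatesPoints_kernelAlgebra fun m hm => by
        rw [hint g hg, hint (-g) hg.neg, ← sub_eq_zero, ← integral_sub, ← Hg m hm]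
        · refine integral_congr_ae (ae_of_all _ fun t => ?_)
          simp only [Pi.neg_apply]
          rw [← mul_sub, ← Complex.ofReal_sub]
          congr 2
          rcases le_total 0 (g t) with h | h
          · rw [max_eq_left h, max_eq_right (by linarith)]; ring
          · rw [max_eq_right h, max_eq_left (by linarith)]; ring
        · exact integrable_bcf_mul (hg.pos_part.ofReal) m
        · exact integrable_bcf_mul (hg.neg.pos_part.ofReal) m
    rw [withDensity_eq_iff hg.1.aemeasurable.ennreal_ofReal
      hg.neg.1.aemeasurable.ennreal_ofReal] at heq
    · filter_upwards [heq] with t ht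
      simp only [Pi.neg_apply] at ht
      rcases lt_trichotomy (g t) 0 with h | h | h
      · rw [ENNReal.ofReal_of_nonpos h.le] at ht
        exact absurd ht.symm (by simpa using h)
      · exact h
      · rw [ENNReal.ofReal_of_nonpos (p := -g t) (by linarith)] at ht
        exact absurd ht (by simpa using h)
    · exact hg.lintegral_lt_top.ne
  have h3 : ∀ m ∈ kernelAlgebra, ∫ t, m t * conj (h t) ∂μ = 0 := by
    intro m hm
    have := h2 (Star.star m) (star_mem hm)
    rw [← map_eq_zero (starRingEnd ℂ), ← integral_conj] at this
    rw [← this]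
    refine integral_congr_ae (ae_of_all _ fun t => ?_)
    simp
  have hc : Integrable (fun t => conj (h t)) μ :=
    hh.mono (Complex.continuous_conj.comp_aestronglyMeasurable hh.1) (ae_of_all _ fun t => by simp)
  have hre := real (fun t => (h t).re) hh.re fun m hm => by
    have : ∀ t, m t * (((h t).re : ℝ) : ℂ) = (1 / 2) * (m t * h t) + (1 / 2) * (m t * conj (h t)) :=
      fun t => by rw [Complex.re_eq_add_conj]; ring
    simp only [this]
    rw [integral_add ((integrable_bcf_mul hh m).const_mul _) ((integrable_bcf_mul hc m).const_mul _),
      integral_const_mul, integral_const_mul, h2 m hm, h3 m hm]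
    simp
  have him := real (fun t => (h t).im) hh.im fun m hm => by
    have : ∀ t, m t * (((h t).im : ℝ) : ℂ) =
        (1 / (2 * Complex.I)) * (m t * h t) - (1 / (2 * Complex.I)) * (m t * conj (h t)) :=
      fun t => by rw [Complex.im_eq_sub_conj]; field_simp
    simp only [this]
    rw [integral_sub ((integrable_bcf_mul hh m).const_mul _) ((integrable_bcf_mul hc m).const_mul _),
      integral_const_mul, integral_const_mul, h2 m hm, h3 m hm]
    simp
  filter_upwards [hre, him] with t h1 h2
  exact Complex.ext h1 h2

/-! ### The cyclic subspace and diagonalization. -/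

/-- A family of vectors with the same Gram matrix as a total family is its image under a linear
isometry. -/
theorem exists_linearIsometry_of_inner_eq {ι E F : Type*} [NormedAddCommGroup E]
    [InnerProductSpace ℂ E] [NormedAddCommGroup F] [InnerProductSpace ℂ F] [CompleteSpace F]
    {u : ι → E} {v : ι → F} (h : ∀ i j, ⟪v i, v j⟫ = ⟪u i, u j⟫)
    (hd : (Submodule.span ℂ (range u)).topologicalClosure = ⊤) :
    ∃ W : E →ₗᵢ[ℂ] F, ∀ i, W (u i) = v i := by
  set e := Finsupp.linearCombination ℂ u
  set f := Finsupp.linearCombination ℂ v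
  have hin : ∀ c, ⟪f c, f c⟫ = ⟪e c, e c⟫ := fun c => by
    simp only [e, f, Finsupp.linearCombination_apply, Finsupp.sum, sum_inner, inner_sum,
      inner_smul_left, inner_smul_right, h]
  have hn : ∀ c, ‖f c‖ = ‖e c‖ := fun c => by
    rw [@norm_eq_sqrt_re_inner ℂ, @norm_eq_sqrt_re_inner ℂ E, hin]
  have hdense : DenseRange e := by
    rw [DenseRange, ← LinearMap.coe_range, Finsupp.range_linearCombination]
    exact Submodule.dense_iff_topologicalClosure_eq_top.2 hd
  have hb : ∃ C, ∀ c, ‖f c‖ ≤ C * ‖e c‖ := ⟨1, fun c => by rw [hn, one_mul]⟩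
  set W := f.extendOfNorm e
  have hW : ∀ c, W (e c) = f c := LinearMap.extendOfNorm_eq hdense hb
  have hWn : ∀ x, ‖W x‖ = ‖x‖ := by
    intro x
    refine hdense.induction_on (p := fun x => ‖W x‖ = ‖x‖) x
      (isClosed_eq (by fun_prop) (by fun_prop)) fun c => ?_
    rw [hW, hn]
  refine ⟨⟨W.toLinearMap, hWn⟩, fun i => ?_⟩
  have := hW (Finsupp.single i 1)
  simpa [e, f] using this

/-- The resolvent kernel as a square integrable function. -/
def Nonreal.kernelLp (μ : Measure ℝ) [IsFiniteMeasure μ] (z : Nonreal) : Lp ℂ 2 μ :=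
  BoundedContinuousFunction.toLp 2 μ ℂ z.kernel

section kernelLp

variable {μ : Measure ℝ} [IsFiniteMeasure μ]

theorem Nonreal.coeFn_kernelLp (z : Nonreal) : z.kernelLp μ =ᵐ[μ] z.kernel :=
  BoundedContinuousFunction.coeFn_toLp 2 μ ℂ z.kernel

theorem Nonreal.tendsto_kernelLp (z : Nonreal) :
    Tendsto (fun n => (z.approx n).kernelLp μ) atTop (𝓝 (z.kernelLp μ)) :=
  ((BoundedContinuousFunction.toLp 2 μ ℂ).continuous.tendsto _).comp z.tendsto_kernel

theorem Nonreal.inner_kernelLp (z : Nonreal) (g : Lp ℂ 2 μ) :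
    ⟪z.kernelLp μ, g⟫ = ∫ t, z.star.kernel t * g t ∂μ := by
  rw [L2.inner_def]
  refine integral_congr_ae ?_
  filter_upwards [z.coeFn_kernelLp (μ := μ)] with t ht
  rw [ht, RCLike.inner_apply, ← Nonreal.conj_kernel, mul_comm]

/-- A vector orthogonal to all kernels has vanishing Borel transform. -/
theorem span_kernelLp :
    (Submodule.span ℂ (range (Nonreal.kernelLp μ))).topologicalClosure = ⊤ := by
  rw [Submodule.topologicalClosure_eq_top_iff, Submodule.eq_bot_iff]
  intro g hg
  have h : ∀ z : Nonreal, ∫ t, z.kernel t * g t ∂μ = 0 := fun z => by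
    have h1 := (Submodule.mem_orthogonal _ _).1 hg (z.star.kernelLp μ)
      (Submodule.subset_span ⟨_, rfl⟩)
    rw [Nonreal.inner_kernelLp] at h1
    rwa [show z.star.star = z from Subtype.ext (by simp [Nonreal.star])] at h1
  exact Lp.ext ((ae_eq_zero_of_integral_kernel ((Lp.memLp g).integrable (by norm_num)) h).trans
    (Lp.coeFn_zero _ _ _).symm)

theorem Nonreal.inner_kernelLp_kernelLp (z w : Nonreal) :
    (conj z.1 - w.1) * ⟪z.kernelLp μ, w.kernelLp μ⟫ =
      ∫ t, z.star.kernel t ∂μ - ∫ t, w.kernel t ∂μ := by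
  rw [z.inner_kernelLp, ← integral_const_mul, ← integral_sub (z.star.kernel.integrable μ)
    (w.kernel.integrable μ)]
  refine integral_congr_ae ?_
  filter_upwards [w.coeFn_kernelLp (μ := μ)] with t ht
  rw [ht]
  have := congrFun (congrArg (fun f : ℝ →ᵇ ℂ => (f : ℝ → ℂ)) (kernel_sub_kernel z.star w)) t
  simp only [BoundedContinuousFunction.coe_sub, Pi.sub_apply, BoundedContinuousFunction.coe_smul,
    BoundedContinuousFunction.coe_mul, Pi.mul_apply, smul_eq_mul] at this
  exact this.symm

end kernelLp

section symmetric

variable {K : Type*} [NormedAddCommGroup K] [InnerProductSpace ℂ K] {G : Submodule ℂ (K × K)}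

/-- The resolvent bound for a symmetric relation. -/
theorem IsSelfAdjointRelation.norm_le (hG : IsSelfAdjointRelation G) {z : ℂ} {x k : K}
    (h : (x, z • x + k) ∈ G) : |z.im| * ‖x‖ ≤ ‖k‖ := by
  have h1 := (hG _ _).1 h _ _ h
  rw [inner_add_left, inner_add_right, inner_smul_left, inner_smul_right] at h1
  have h2 : (conj z - z) * ⟪x, x⟫ = ⟪x, k⟫ - ⟪k, x⟫ := by linear_combination h1
  have h3 : ‖(conj z - z) * ⟪x, x⟫‖ = 2 * |z.im| * ‖x‖ ^ 2 := by
    rw [norm_mul, ← neg_sub, norm_neg, Complex.sub_conj, inner_self_eq_norm_sq_to_K]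
    simp
  have h4 : ‖⟪x, k⟫ - ⟪k, x⟫‖ ≤ 2 * ‖x‖ * ‖k‖ := by
    refine (norm_sub_le _ _).trans ?_
    have := norm_inner_le_norm (𝕜 := ℂ) x k
    have := norm_inner_le_norm (𝕜 := ℂ) k x
    linarith
  rw [h2] at h3
  rcases (norm_nonneg x).eq_or_lt with h0 | h0
  · rw [← h0, mul_zero]; exact norm_nonneg _
  · refine le_of_mul_le_mul_right ?_ h0
    linarith

variable {μ : Measure ℝ} [IsFiniteMeasure μ] {f : K} {x : Nonreal → K}

/-- The Gram matrix of the resolvent vectors is that of the resolvent kernels. -/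
theorem IsSelfAdjointRelation.inner_resolvent (hG : IsSelfAdjointRelation G)
    (hx : ∀ z : Nonreal, (x z, z.1 • x z + f) ∈ G)
    (hμ : ∀ z : Nonreal, ⟪f, x z⟫ = ∫ t, z.kernel t ∂μ) (z w : Nonreal) :
    ⟪x z, x w⟫ = ⟪z.kernelLp μ, w.kernelLp μ⟫ := by
  have hstar : ∀ z : Nonreal, ⟪x z, f⟫ = ∫ t, z.star.kernel t ∂μ := fun z => by
    rw [← inner_conj_symm, hμ, ← integral_conj]
    simp only [Nonreal.conj_kernel]
  have key : ∀ z w : Nonreal, conj z.1 - w.1 ≠ 0 →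
      ⟪x z, x w⟫ = ⟪z.kernelLp μ, w.kernelLp μ⟫ := by
    intro z w h
    have h1 := (hG _ _).1 (hx w) _ _ (hx z)
    rw [inner_add_left, inner_add_right, inner_smul_left, inner_smul_right, hμ, hstar] at h1
    refine mul_left_cancel₀ h ?_
    rw [Nonreal.inner_kernelLp_kernelLp z w]
    linear_combination h1
  -- For `w = conj z` the resolvent identity cannot be divided by `conj z - w`; both sides are
  -- limits along points with the same imaginary part.
  by_cases h : conj z.1 - w.1 = 0
  · have hcont : Tendsto (fun n => x (w.approx n)) atTop (𝓝 (x w)) := by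
      refine w.tendsto_approx (C := |w.1.im|⁻¹ * (|w.1.im|⁻¹ * ‖f‖)) fun n => ?_
      have hpos := abs_pos.2 w.2
      have h1 : |w.1.im| * ‖x w‖ ≤ ‖f‖ := hG.norm_le (hx w)
      have h2 := hG.norm_le (x := x (w.approx n) - x w) (z := (w.approx n).1)
        (k := ((w.approx n).1 - w.1) • x w) (by
          have := G.sub_mem (hx (w.approx n)) (hx w)
          convert this using 1
          rw [Prod.mk_sub_mk]
          congr 1
          rw [smul_sub, sub_smul]
          abel)
      rw [Nonreal.approx_im, norm_smul] at h2
      calc ‖x (w.approx n) - x w‖ ≤ |w.1.im|⁻¹ * (‖(w.approx n).1 - w.1‖ * ‖x w‖) := by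
            rw [inv_mul_eq_div, le_div_iff₀ hpos, mul_comm]; exact h2
        _ ≤ |w.1.im|⁻¹ * (‖(w.approx n).1 - w.1‖ * (|w.1.im|⁻¹ * ‖f‖)) := by
            gcongr
            rw [inv_mul_eq_div, le_div_iff₀ hpos, mul_comm]; exact h1
        _ = _ := by ring
    have l1 : Tendsto (fun n => ⟪x z, x (w.approx n)⟫) atTop (𝓝 ⟪x z, x w⟫) :=
      tendsto_const_nhds.inner hcont
    have l2 : Tendsto (fun n => ⟪z.kernelLp μ, (w.approx n).kernelLp μ⟫) atTop
        (𝓝 ⟪z.kernelLp μ, w.kernelLp μ⟫) := tendsto_const_nhds.inner w.tendsto_kernelLp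
    refine tendsto_nhds_unique (l1.congr fun n => key _ _ ?_) l2
    intro h'
    exact w.approx_ne n (by linear_combination h - h')
  · exact key z w h

end symmetric

section spectral

variable {K : Type*} [NormedAddCommGroup K] [InnerProductSpace ℂ K] [CompleteSpace K]
  {G : Submodule ℂ (K × K)} {μ : Measure ℝ} [IsFiniteMeasure μ] {f : K}

/-- The adjoint of the canonical isometry of the cyclic subspace diagonalizes the operator. -/
theorem IsSelfAdjointRelation.adjoint_ae_eq (hG : IsSelfAdjointRelation G)
    {W : Lp ℂ 2 μ →L[ℂ] K}
    (hW : ∀ z : Nonreal, (W (z.kernelLp μ), z.1 • W (z.kernelLp μ) + f) ∈ G) {ψ η : K}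
    (h : (ψ, η) ∈ G) : ∀ᵐ t ∂μ, W.adjoint η t = t * W.adjoint ψ t := by
  set y := W.adjoint ψ
  set y' := W.adjoint η
  have h0 : ∀ z : Nonreal, ⟪z.kernelLp μ, y'⟫ = conj z.1 * ⟪z.kernelLp μ, y⟫ + ⟪f, ψ⟫ := fun z => by
    have h1 := (hG _ _).1 h _ _ (hW z)
    rw [inner_add_left, inner_smul_left] at h1
    rw [ContinuousLinearMap.adjoint_inner_right, ContinuousLinearMap.adjoint_inner_right]
    exact h1.symm
  set w : Nonreal := ⟨Complex.I, by simp⟩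
  -- This is `(y' - t * y) / (t - conj w)` with `w = I`, written without the product `t * y`, whose
  -- integrability is not known. Subtracting `h0` for `z` and `w` removes `⟪f, ψ⟫` and shows that
  -- its Borel transform vanishes.
  set g : ℝ → ℂ := fun t => w.star.kernel t * y' t - y t - conj w.1 * (w.star.kernel t * y t)
  have iy : Integrable y μ := (Lp.memLp y).integrable (by norm_num)
  have iy' : Integrable y' μ := (Lp.memLp y').integrable (by norm_num)
  have ig : Integrable g μ := ((integrable_bcf_mul iy' _).sub iy).sub
    ((integrable_bcf_mul iy _).const_mul _)
  have key : ∀ z : Nonreal, z.star.1 - w.star.1 ≠ 0 → ∫ t, z.star.kernel t * g t ∂μ = 0 := by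
    intro z hz
    have e1 : ∀ t, z.star.kernel t * w.star.kernel t =
        (z.star.1 - w.star.1)⁻¹ * (z.star.kernel t - w.star.kernel t) := fun t => by
      have := congrFun (congrArg (fun f : ℝ →ᵇ ℂ => (f : ℝ → ℂ))
        (Nonreal.kernel_sub_kernel z.star w.star)) t
      simp only [BoundedContinuousFunction.coe_sub, Pi.sub_apply,
        BoundedContinuousFunction.coe_smul, BoundedContinuousFunction.coe_mul, Pi.mul_apply,
        smul_eq_mul] at this
      rw [this, inv_mul_cancel_left₀ hz]
    have e2 : ∀ t, z.star.kernel t * g t =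
        (z.star.1 - w.star.1)⁻¹ * ((z.star.kernel t * y' t - w.star.kernel t * y' t) -
          conj w.1 * (z.star.kernel t * y t - w.star.kernel t * y t)) - z.star.kernel t * y t :=
      fun t => by
        simp only [g]
        linear_combination (y' t - conj w.1 * y t) * e1 t
    have j1 := integrable_bcf_mul iy' z.star.kernel
    have j2 := integrable_bcf_mul iy' w.star.kernel
    have j3 := integrable_bcf_mul iy z.star.kernel
    have j4 := integrable_bcf_mul iy w.star.kernel
    have j5 : Integrable (fun t => z.star.kernel t * y' t - w.star.kernel t * y' t) μ := j1.sub j2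
    have j6 : Integrable (fun t => conj w.1 * (z.star.kernel t * y t - w.star.kernel t * y t)) μ :=
      (j3.sub j4).const_mul _
    have j7 : Integrable (fun t => (z.star.1 - w.star.1)⁻¹ *
        ((z.star.kernel t * y' t - w.star.kernel t * y' t) -
          conj w.1 * (z.star.kernel t * y t - w.star.kernel t * y t))) μ := (j5.sub j6).const_mul _
    simp only [e2]
    rw [integral_sub j7 j3, integral_const_mul, integral_sub j5 j6, integral_const_mul,
      integral_sub j1 j2, integral_sub j3 j4, ← z.inner_kernelLp, ← z.inner_kernelLp,
      ← w.inner_kernelLp, ← w.inner_kernelLp, h0 z, h0 w]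
    have : conj z.1 - conj w.1 ≠ 0 := hz
    change (conj z.1 - conj w.1)⁻¹ * _ - _ = 0
    field_simp
    ring
  have mg : MemLp g 2 μ := by
    have mb : ∀ (m : ℝ →ᵇ ℂ) (y : Lp ℂ 2 μ), MemLp (fun t => m t * y t) 2 μ := fun m y =>
      (Lp.memLp y).of_le_mul (c := ‖m‖)
        (m.continuous.aestronglyMeasurable.mul (Lp.aestronglyMeasurable y)) (ae_of_all _ fun t => by
          rw [norm_mul]; gcongr; exact m.norm_coe_le_norm t)
    exact ((mb _ y').sub (Lp.memLp y)).sub ((mb _ y).const_mul _)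
  have hg : g =ᵐ[μ] 0 := by
    refine ae_eq_zero_of_integral_kernel ig fun z => ?_
    have hz : z.star.star = z := Subtype.ext (by simp [Nonreal.star])
    have hin : ∀ z : Nonreal, ⟪z.kernelLp μ, mg.toLp g⟫ = ∫ t, z.star.kernel t * g t ∂μ :=
      fun z => by
        rw [z.inner_kernelLp]
        refine integral_congr_ae ?_
        filter_upwards [mg.coeFn_toLp] with t ht
        rw [ht]
    by_cases h : z.1 - w.star.1 = 0
    · have l1 : Tendsto (fun n => ⟪(z.star.approx n).kernelLp μ, mg.toLp g⟫) atTop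
          (𝓝 ⟪z.star.kernelLp μ, mg.toLp g⟫) := z.star.tendsto_kernelLp.inner tendsto_const_nhds
      rw [hin, hz] at l1
      refine tendsto_nhds_unique l1 (tendsto_const_nhds.congr fun n => ?_)
      rw [hin, key]
      have h2 := z.star.approx_ne n
      intro h3
      have h4 : conj (z.star.approx n).1 = conj z.star.1 := by
        have : conj z.star.1 = z.1 := by simp [Nonreal.star]
        rw [this]
        exact (sub_eq_zero.1 h3).trans (sub_eq_zero.1 h).symm
      exact h2 (sub_eq_zero.2 ((starRingEnd ℂ).injective h4))
    · have := key z.star (by rwa [hz])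
      rwa [hz] at this
  filter_upwards [hg] with t ht
  have h1 := ofReal_sub_ne_zero w.star.2 t
  have h2 : ((t : ℂ) - w.star.1) * w.star.kernel t = 1 := by
    rw [Nonreal.kernel_apply]; exact mul_inv_cancel₀ h1
  simp only [g, Pi.zero_apply] at ht
  have h3 : conj w.1 = w.star.1 := rfl
  rw [h3] at ht
  linear_combination ((t : ℂ) - w.star.1) * ht - (y' t - w.star.1 * y t) * h2
end spectral

/-! ### Multiplication operators and the resolvent on the cyclic subspace. -/

theorem Lp.enorm_sq_eq_lintegral {α : Type*} [MeasurableSpace α] {ν : Measure α} (y : Lp ℂ 2 ν) :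
    ‖y‖ₑ ^ 2 = ∫⁻ t, ‖y t‖ₑ ^ 2 ∂ν := by
  have h := eLpNorm_nnreal_pow_eq_lintegral (f := y) (μ := ν) (p := 2) two_ne_zero
  rw [Lp.enorm_def]
  simpa using h

theorem enorm_sq_eq_ofReal {E : Type*} [NormedAddCommGroup E] (y : E) :
    ‖y‖ₑ ^ 2 = ENNReal.ofReal (‖y‖ ^ 2) := by
  rw [ENNReal.ofReal_pow (norm_nonneg _), ofReal_norm]

theorem memLp_bcf_mul {μ : Measure ℝ} (m : ℝ →ᵇ ℂ) (y : Lp ℂ 2 μ) :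
    MemLp (fun t => m t * y t) 2 μ :=
  (Lp.memLp y).of_le_mul (c := ‖m‖)
    (m.continuous.aestronglyMeasurable.mul (Lp.aestronglyMeasurable y)) (ae_of_all _ fun t => by
      rw [norm_mul]; gcongr; exact m.norm_coe_le_norm t)

/-- The multiplication by a bounded continuous function. -/
def mulLp (μ : Measure ℝ) (m : ℝ →ᵇ ℂ) : Lp ℂ 2 μ →L[ℂ] Lp ℂ 2 μ :=
  LinearMap.mkContinuous
    { toFun := fun y => (memLp_bcf_mul m y).toLp _
      map_add' := fun y z => by
        refine Lp.ext ?_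
        filter_upwards [(memLp_bcf_mul m (y + z)).coeFn_toLp, Lp.coeFn_add ((memLp_bcf_mul m y).toLp _) ((memLp_bcf_mul m z).toLp _),
          (memLp_bcf_mul m y).coeFn_toLp, (memLp_bcf_mul m z).coeFn_toLp, Lp.coeFn_add y z] with t h1 h2 h3 h4 h5
        rw [h1, h2, Pi.add_apply, h3, h4, h5, Pi.add_apply, mul_add]
      map_smul' := fun c y => by
        refine Lp.ext ?_
        filter_upwards [(memLp_bcf_mul m (c • y)).coeFn_toLp, Lp.coeFn_smul c ((memLp_bcf_mul m y).toLp _),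
          (memLp_bcf_mul m y).coeFn_toLp, Lp.coeFn_smul c y] with t h1 h2 h3 h5
        rw [h1, RingHom.id_apply, h2, Pi.smul_apply, h3, h5, Pi.smul_apply, smul_eq_mul,
          smul_eq_mul, mul_left_comm] }
    ‖m‖ fun y => by
      refine Lp.norm_le_mul_norm_of_ae_le_mul ?_
      filter_upwards [(memLp_bcf_mul m y).coeFn_toLp] with t h1
      change ‖(memLp_bcf_mul m y).toLp _ t‖ ≤ _
      rw [h1, norm_mul]
      gcongr
      exact m.norm_coe_le_norm t

theorem coeFn_mulLp {μ : Measure ℝ} (m : ℝ →ᵇ ℂ) (y : Lp ℂ 2 μ) :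
    mulLp μ m y =ᵐ[μ] fun t => m t * y t :=
  (memLp_bcf_mul m y).coeFn_toLp

theorem norm_mulLp_le {μ : Measure ℝ} (m : ℝ →ᵇ ℂ) (y : Lp ℂ 2 μ) :
    ‖mulLp μ m y‖ ≤ ‖m‖ * ‖y‖ :=
  Lp.norm_le_mul_norm_of_ae_le_mul <| by
    filter_upwards [coeFn_mulLp m y] with t h1
    rw [h1, norm_mul]
    gcongr
    exact m.norm_coe_le_norm t

theorem inner_mulLp {μ : Measure ℝ} (m : ℝ →ᵇ ℂ) (y z : Lp ℂ 2 μ) :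
    ⟪y, mulLp μ m z⟫ = ⟪mulLp μ (star m) y, z⟫ := by
  rw [L2.inner_def, L2.inner_def]
  refine integral_congr_ae ?_
  filter_upwards [coeFn_mulLp m z, coeFn_mulLp (star m) y] with t h1 h2
  rw [h1, h2]
  simp only [RCLike.inner_apply, map_mul, BoundedContinuousFunction.star_apply, RCLike.star_def,
    Complex.conj_conj]
  ring

section operator

variable {K : Type*} [NormedAddCommGroup K] [InnerProductSpace ℂ K] [CompleteSpace K]

/-- A spectral measure yields an isometry diagonalizing the operator. -/
theorem IsSpectralMeasureAt.exists_isometry {A : K →ₗ.[ℂ] K} {f : K} {μ : Measure ℝ}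
    [IsFiniteMeasure μ] (hμ : IsSpectralMeasureAt A f μ) (hA : IsSelfAdjointRelation A.graph) :
    ∃ W : Lp ℂ 2 μ →ₗᵢ[ℂ] K, ∀ ψ η, (ψ, η) ∈ A.graph →
      ∀ᵐ t ∂μ, W.toContinuousLinearMap.adjoint η t = t * W.toContinuousLinearMap.adjoint ψ t := by
  choose x hx hin using fun z : Nonreal => hμ.resolvent z.1 z.2
  have hx' : ∀ z, ((x z : K), z.1 • (x z : K) + f) ∈ A.graph := fun z => by
    rw [← hx z, add_sub_cancel]
    exact A.mem_graph (x z)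
  obtain ⟨W, hW⟩ := exists_linearIsometry_of_inner_eq (u := Nonreal.kernelLp μ)
    (v := fun z => (x z : K)) (hA.inner_resolvent hx' hin) span_kernelLp
  refine ⟨W, fun ψ η h => hA.adjoint_ae_eq (f := f) (fun z => ?_) h⟩
  rw [show W.toContinuousLinearMap (z.kernelLp μ) = x z from hW z]
  exact hx' z

/-- The imaginary unit as a nonreal number. -/
def Nonreal.I : Nonreal := ⟨Complex.I, by simp⟩

theorem Nonreal.norm_kernel_I_le : ‖Nonreal.I.kernel‖ ≤ 1 :=
  (Nonreal.norm_kernel_le _).trans_eq (by simp [Nonreal.I])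

/-- The resolvent on the cyclic subspace. -/
theorem IsSelfAdjointRelation.map_mulLp_mem {G : Submodule ℂ (K × K)} {μ : Measure ℝ}
    (hG : IsSelfAdjointRelation G) {W : Lp ℂ 2 μ →L[ℂ] K}
    (hW : ∀ ψ η, (ψ, η) ∈ G → ∀ᵐ t ∂μ, W.adjoint η t = t * W.adjoint ψ t) (g : Lp ℂ 2 μ) :
    (W (mulLp μ Nonreal.I.kernel g),
      W (g + Complex.I • mulLp μ Nonreal.I.kernel g)) ∈ G := by
  refine (hG _ _).2 fun p q hpq => ?_
  rw [← ContinuousLinearMap.adjoint_inner_left W, ← ContinuousLinearMap.adjoint_inner_left W,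
    L2.inner_def, L2.inner_def]
  refine integral_congr_ae ?_
  filter_upwards [hW p q hpq, coeFn_mulLp Nonreal.I.kernel g,
    Lp.coeFn_add g (Complex.I • mulLp μ Nonreal.I.kernel g),
    Lp.coeFn_smul Complex.I (mulLp μ Nonreal.I.kernel g)] with t h1 h2 h3 h4
  have h5 : ((t : ℂ) - Complex.I) * Nonreal.I.kernel t = 1 := by
    rw [Nonreal.kernel_apply]; exact mul_inv_cancel₀ (ofReal_sub_ne_zero Nonreal.I.2 t)
  rw [h1, h3, Pi.add_apply, h4, Pi.smul_apply, h2]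
  simp only [RCLike.inner_apply, map_mul, Complex.conj_ofReal, smul_eq_mul]
  linear_combination g t * conj (W.adjoint p t) * h5

end operator

/-! ### Hilbert–Schmidt bounds from sup bounds. -/

section HilbertSchmidt

variable {H α : Type*} [NormedAddCommGroup H] [InnerProductSpace ℂ H]
  [MeasurableSpace α] {ν : Measure α}

/-- The pointwise evaluations of an operator into bounded functions, on an orthonormal family. -/
theorem ae_sum_norm_sq_le_of_ae_bound {S : H →L[ℂ] Lp ℂ 2 ν} {C : ℝ}
    (hS : ∀ g, ∀ᵐ s ∂ν, ‖S g s‖ ≤ C * ‖g‖) {n : ℕ} {o : Fin n → H} (ho : Orthonormal ℂ o) :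
    ∀ᵐ s ∂ν, ∑ j, ‖S (o j) s‖ ^ 2 ≤ C ^ 2 := by
  -- The sup bound for a linear combination holds off a null set depending on the coefficients. A
  -- countable dense set of coefficients gives one null set, and continuity then permits
  -- coefficients depending on `s`, namely the conjugates of the values.
  obtain ⟨D, hDc, hD⟩ := TopologicalSpace.exists_countable_dense (EuclideanSpace ℂ (Fin n))
  have hnorm : ∀ c : EuclideanSpace ℂ (Fin n), ‖∑ j, c j • o j‖ = ‖c‖ := fun c => by
    have h1 : ⟪∑ j, c j • o j, ∑ j, c j • o j⟫ = ⟪c, c⟫ := by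
      rw [ho.inner_sum, PiLp.inner_apply]
      refine Finset.sum_congr rfl fun j _ => ?_
      rw [RCLike.inner_apply, mul_comm]
    rw [@norm_eq_sqrt_re_inner ℂ, h1, ← @norm_eq_sqrt_re_inner ℂ]
  have h1 : ∀ᵐ s ∂ν, ∀ c ∈ D, ‖∑ j, c j * S (o j) s‖ ≤ C * ‖c‖ := by
    rw [ae_ball_iff hDc]
    intro c _
    have hsm : ∀ᵐ s ∂ν, ∀ j, (c j • S (o j) : Lp ℂ 2 ν) s = c j * S (o j) s := by
      rw [ae_all_iff]
      intro j
      filter_upwards [Lp.coeFn_smul (c j) (S (o j))] with s hs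
      rw [hs, Pi.smul_apply, smul_eq_mul]
    filter_upwards [hS (∑ j, c j • o j),
      Lp.coeFn_fun_finsetSum Finset.univ fun j => c j • S (o j), hsm] with s h2 h3 h4
    rw [hnorm, map_sum] at h2
    simp only [map_smul] at h2
    rw [h3] at h2
    simpa only [h4] using h2
  filter_upwards [h1] with s hs
  have h2 : ∀ c : EuclideanSpace ℂ (Fin n), ‖∑ j, c j * S (o j) s‖ ≤ C * ‖c‖ := fun c =>
    hD.induction hs (isClosed_le (by fun_prop) (by fun_prop)) c
  set c : EuclideanSpace ℂ (Fin n) := WithLp.toLp 2 fun j => conj (S (o j) s)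
  have h3 : ‖c‖ ^ 2 = ∑ j, ‖S (o j) s‖ ^ 2 := by
    rw [EuclideanSpace.norm_sq_eq]
    simp [c]
  have h4 : ∑ j, c j * S (o j) s = ((∑ j, ‖S (o j) s‖ ^ 2 : ℝ) : ℂ) := by
    push_cast
    exact Finset.sum_congr rfl fun j _ => Complex.conj_mul' _
  have h5 := h2 c
  rw [h4, ← h3, Complex.norm_real, Real.norm_of_nonneg (by positivity)] at h5
  rw [← h3]
  rcases (norm_nonneg c).eq_or_lt with h0 | h0
  · rw [← h0, zero_pow two_ne_zero]; positivity
  · have : ‖c‖ ≤ C := by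
      rw [pow_two] at h5
      exact le_of_mul_le_mul_right h5 h0
    gcongr

/-- Operators from a Hilbert space into bounded functions on a finite measure space are
Hilbert–Schmidt. -/
theorem tsum_enorm_adjoint_sq_le [CompleteSpace H] {S : H →L[ℂ] Lp ℂ 2 ν} {C : ℝ}
    (hS : ∀ g, ∀ᵐ s ∂ν, ‖S g s‖ ≤ C * ‖g‖) {ι : Type*} {e : ι → Lp ℂ 2 ν}
    (he : Orthonormal ℂ e) :
    ∑' i, ‖S.adjoint (e i)‖ₑ ^ 2 ≤ ENNReal.ofReal (C ^ 2) * ν univ := by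
  classical
  rw [ENNReal.tsum_eq_iSup_sum]
  refine iSup_le fun F => ?_
  -- In an orthonormal basis of this finite-dimensional span the sum becomes a double sum of squared
  -- matrix entries, which Bessel's inequality bounds by the norms of the images of the basis.
  set U := Submodule.span ℂ ((F.image fun i => S.adjoint (e i) : Finset H) : Set H)
  have hU : ∀ i ∈ F, S.adjoint (e i) ∈ U := fun i hi =>
    Submodule.subset_span (Finset.mem_coe.2 (Finset.mem_image_of_mem _ hi))
  set o := stdOrthonormalBasis ℂ U
  have ho : Orthonormal ℂ fun j => (o j : H) := o.orthonormal.comp_linearIsometry U.subtypeₗᵢ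
  have h1 : ∀ i ∈ F, ‖S.adjoint (e i)‖ ^ 2 = ∑ j, ‖⟪e i, S (o j)⟫‖ ^ 2 := fun i hi => by
    have := o.sum_sq_norm_inner_left ⟨_, hU i hi⟩
    change _ = ‖S.adjoint (e i)‖ ^ 2 at this
    rw [← this]
    refine Finset.sum_congr rfl fun j _ => ?_
    rw [Submodule.coe_inner, ContinuousLinearMap.adjoint_inner_left]
  have h2 : ∑ i ∈ F, ‖S.adjoint (e i)‖ ^ 2 ≤ ∑ j, ‖S (o j)‖ ^ 2 := by
    rw [Finset.sum_congr rfl h1, Finset.sum_comm]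
    exact Finset.sum_le_sum fun j _ => he.sum_inner_products_le _
  simp only [enorm_sq_eq_ofReal (S.adjoint _)]
  rw [← ENNReal.ofReal_sum_of_nonneg fun _ _ => by positivity]
  refine (ENNReal.ofReal_le_ofReal h2).trans ?_
  rw [ENNReal.ofReal_sum_of_nonneg fun _ _ => by positivity]
  simp only [← enorm_sq_eq_ofReal, Lp.enorm_sq_eq_lintegral]
  rw [← lintegral_finsetSum' _ fun j _ =>
    (Lp.aestronglyMeasurable (S (o j))).enorm.pow_const 2, ← lintegral_const]
  refine lintegral_mono_ae ?_
  filter_upwards [ae_sum_norm_sq_le_of_ae_bound hS ho] with s hs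
  rw [Finset.sum_congr rfl fun j _ => enorm_sq_eq_ofReal (S (o j) s),
    ← ENNReal.ofReal_sum_of_nonneg fun _ _ => by positivity]
  exact ENNReal.ofReal_le_ofReal hs

end HilbertSchmidt

/-! ### Pointwise representation of operators into `L²(μ)`. -/

section representation

variable {H ι : Type*} [NormedAddCommGroup H] [InnerProductSpace ℂ H]

/-- Riesz–Fischer; `φ` stands in the antilinear slot, so its coordinates are the conjugates of `c`.
-/
theorem HilbertBasis.exists_inner_eq (e : HilbertBasis ι ℂ H) {c : ι → ℂ}
    (hc : ∑' i, ‖c i‖ₑ ^ 2 ≠ ∞) :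
    ∃ φ : H, (∀ i, ⟪φ, e i⟫ = c i) ∧ ‖φ‖ₑ ^ 2 = ∑' i, ‖c i‖ₑ ^ 2 := by
  have hm : Memℓp (fun i => conj (c i)) 2 := memℓp_two_iff_tsum.2 <| by
    simpa only [RCLike.enorm_conj] using hc
  refine ⟨e.repr.symm ⟨_, hm⟩, fun i => ?_, ?_⟩
  · rw [← inner_conj_symm, ← e.repr_apply_apply, LinearIsometryEquiv.apply_symm_apply]
    exact Complex.conj_conj _
  · rw [LinearIsometryEquiv.enorm_map, lp.enorm_sq_eq_tsum]
    simp only [RCLike.enorm_conj]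

/-- An operator into `L²` is represented by pointwise functionals as soon as it is so on a
Hilbert basis. -/
theorem ae_eq_inner_of_hilbertBasis [Countable ι] {α : Type*} [MeasurableSpace α] {μ : Measure α}
    (e : HilbertBasis ι ℂ H) (T : H →L[ℂ] Lp ℂ 2 μ) {φ : α → H}
    (hφ : ∀ᵐ t ∂μ, ∀ i, ⟪φ t, e i⟫ = T (e i) t) (ψ : H) : ∀ᵐ t ∂μ, T ψ t = ⟪φ t, ψ⟫ := by
  have h1 : HasSum (fun i => e.repr ψ i • T (e i)) (T ψ) := by
    simpa using (e.hasSum_repr ψ).mapL T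
  -- Convergence of the basis expansion in `L²(μ)` gives pointwise convergence along a sequence of
  -- partial sums; pointwise, the same sums converge to the inner product.
  have h2 : TendstoInMeasure μ (fun s : Finset ι => (∑ i ∈ s, e.repr ψ i • T (e i) : Lp ℂ 2 μ))
      atTop (T ψ) := tendstoInMeasure_of_tendsto_Lp h1
  obtain ⟨ns, hns, hae⟩ := h2.exists_seq_tendsto_ae'
  have hsum : ∀ᵐ t ∂μ, ∀ s : Finset ι, (∑ i ∈ s, e.repr ψ i • T (e i) : Lp ℂ 2 μ) t =
      ∑ i ∈ s, e.repr ψ i * T (e i) t := by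
    have hsm : ∀ᵐ t ∂μ, ∀ i, (e.repr ψ i • T (e i) : Lp ℂ 2 μ) t = e.repr ψ i * T (e i) t := by
      rw [ae_all_iff]
      intro i
      filter_upwards [Lp.coeFn_smul (e.repr ψ i) (T (e i))] with t ht
      rw [ht, Pi.smul_apply, smul_eq_mul]
    rw [ae_all_iff]
    intro s
    filter_upwards [Lp.coeFn_fun_finsetSum s fun i => e.repr ψ i • T (e i), hsm] with t ht ht'
    rw [ht]
    exact Finset.sum_congr rfl fun i _ => ht' i
  filter_upwards [hφ, hae, hsum] with t h3 h4 h5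
  have h6 : HasSum (fun i => e.repr ψ i * T (e i) t) ⟪φ t, ψ⟫ := by
    have := (e.hasSum_repr ψ).mapL (innerSL ℂ (φ t))
    simpa [inner_smul_right, h3] using this
  refine tendsto_nhds_unique h4 ?_
  have h7 : Tendsto (fun s : Finset ι => ∑ i ∈ s, e.repr ψ i * T (e i) t) atTop
    (𝓝 ⟪φ t, ψ⟫) := h6
  simp only [h5]
  exact h7.comp hns

end representation

/-- Orthonormal vectors have distance `√2`, so balls of radius `1 / 2` around them are disjoint open
sets. -/
theorem exists_countable_hilbertBasis (H : Type*) [NormedAddCommGroup H] [InnerProductSpace ℂ H]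
    [CompleteSpace H] [SecondCountableTopology H] :
    ∃ w : Set H, w.Countable ∧ Nonempty (HilbertBasis w ℂ H) := by
  obtain ⟨w, e, he⟩ := exists_hilbertBasis ℂ H
  refine ⟨w, ?_, ⟨e⟩⟩
  refine Set.PairwiseDisjoint.countable_of_isOpen (s := fun x : H => Metric.ball x (1 / 2)) ?_
    (fun x _ => Metric.isOpen_ball) fun x _ => ⟨x, Metric.mem_ball_self (by norm_num)⟩
  intro x hx y hy hxy
  rw [Function.onFun, Set.disjoint_left]
  intro z hzx hzy
  rw [Metric.mem_ball] at hzx hzy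
  have h1 : dist x y < 1 := (dist_triangle_left x y z).trans_lt (by linarith)
  have ho := e.orthonormal
  rw [he] at ho
  have h2 : ⟪x, y⟫ = 0 := ho.2 (i := ⟨x, hx⟩) (j := ⟨y, hy⟩) fun h => hxy (congrArg Subtype.val h)
  have h3 : ‖x‖ = 1 := ho.1 ⟨x, hx⟩
  have h4 : ‖y‖ = 1 := ho.1 ⟨y, hy⟩
  have h5 := norm_sub_sq (𝕜 := ℂ) x y
  rw [h2, h3, h4] at h5
  rw [dist_eq_norm] at h1
  norm_num at h5
  nlinarith [norm_nonneg (x - y)]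

/-! ### Construction of the generalized eigenfunctionals. -/

section functionals

variable {X : Type*} [Countable X] {ℓ : X → ℝ} {μ : Measure ℝ}

theorem edgeMeasure_univ (r : ℝ) : edgeMeasure r univ = ENNReal.ofReal r := by
  rw [Measure.restrict_apply_univ, Real.volume_Ioo, sub_zero]

/-- The adjoint of an isometry with smooth range is given, almost everywhere, by functionals of
polynomial growth. -/
theorem exists_generalized_functionals [DecidableEq X] [IsFiniteMeasure μ]
    (W : Lp ℂ 2 μ →ₗᵢ[ℂ] lp (fun x => EdgeL2 (ℓ x)) 2) {C : ℝ}
    (hC : ∀ g x, ∀ᵐ s ∂(edgeMeasure (ℓ x)),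
      ‖W (mulLp μ Nonreal.I.kernel g) x s‖ ≤ C * ‖g‖) {ρ : X → ℝ≥0∞} (hρ0 : ∀ x, ρ x ≠ 0)
    (hρ : ∑' x, ρ x * ENNReal.ofReal (ℓ x) ≠ ∞) :
    ∃ φ : ℝ → ∀ x, EdgeL2 (ℓ x),
      (∀ x (ψ : EdgeL2 (ℓ x)), ∀ᵐ t ∂μ,
        W.toContinuousLinearMap.adjoint (lp.single 2 x ψ) t = ⟪φ t x, ψ⟫) ∧
      (∀ᵐ t ∂μ, ∑' x, ρ x * ‖φ t x‖ₑ ^ 2 ≠ ∞) ∧ ∀ᵐ t ∂μ, ∃ x, φ t x ≠ 0 := by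
  have : Fact ((2 : ℝ≥0∞) ≠ ∞) := ⟨by norm_num⟩
  choose w hw e using fun x => exists_countable_hilbertBasis (EdgeL2 (ℓ x))
  replace e := fun x => (e x).some
  have hwc : ∀ x, Countable (w x) := fun x => (hw x).to_subtype
  set T : ∀ x, EdgeL2 (ℓ x) →L[ℂ] Lp ℂ 2 μ := fun x =>
    W.toContinuousLinearMap.adjoint ∘L lp.singleContinuousLinearMap ℂ (fun x => EdgeL2 (ℓ x)) 2 x
  have hT : ∀ x ψ, T x ψ = W.toContinuousLinearMap.adjoint (lp.single 2 x ψ) := fun _ _ => rfl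
  set r := Nonreal.I.kernel
  -- `star r` times the component `T x` is the adjoint of the resolvent on the cyclic subspace
  -- followed by restriction to the edge `x`, to which the Hilbert–Schmidt bound applies.
  have hS : ∀ x, ∑' i, ‖mulLp μ (star r) (T x (e x i))‖ₑ ^ 2 ≤
      ENNReal.ofReal (C ^ 2) * ENNReal.ofReal (ℓ x) := by
    intro x
    set S : Lp ℂ 2 μ →L[ℂ] EdgeL2 (ℓ x) := lp.evalCLM ℂ (fun x => EdgeL2 (ℓ x)) 2 x ∘L
      W.toContinuousLinearMap ∘L mulLp μ r
    have h1 : ∀ ψ, S.adjoint ψ = mulLp μ (star r) (T x ψ) := by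
      intro ψ
      refine ext_inner_right ℂ fun g => ?_
      rw [ContinuousLinearMap.adjoint_inner_left, ← inner_mulLp, hT,
        ContinuousLinearMap.adjoint_inner_left, lp.inner_single_left]
      rfl
    have h2 := tsum_enorm_adjoint_sq_le (S := S) (C := C) (fun g => hC g x) (e x).orthonormal
    rw [edgeMeasure_univ] at h2
    simpa only [h1] using h2
  have hmeas : ∀ x i, AEMeasurable (fun t => ‖T x (e x i) t‖ₑ ^ 2) μ := fun x i =>
    (Lp.aestronglyMeasurable (T x (e x i))).enorm.pow_const 2
  have hr : Measurable fun t => ‖r t‖ₑ ^ 2 := (r.continuous.measurable.enorm).pow_const 2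
  -- The weighted sum is integrable after multiplication by `|r|²`, and `r` has no zeros, so it is
  -- finite almost everywhere.
  have hfin : ∀ᵐ t ∂μ, ∑' x, ρ x * ∑' i, ‖T x (e x i) t‖ₑ ^ 2 ≠ ∞ := by
    have h1 : ∫⁻ t, ‖r t‖ₑ ^ 2 * ∑' x, ρ x * ∑' i, ‖T x (e x i) t‖ₑ ^ 2 ∂μ ≠ ∞ := by
      have h2 : ∀ x i, ∫⁻ t, ‖r t‖ₑ ^ 2 * ‖T x (e x i) t‖ₑ ^ 2 ∂μ =
          ‖mulLp μ (star r) (T x (e x i))‖ₑ ^ 2 := fun x i => by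
        rw [Lp.enorm_sq_eq_lintegral]
        refine lintegral_congr_ae ?_
        filter_upwards [coeFn_mulLp (star r) (T x (e x i))] with t ht
        rw [ht, enorm_mul, mul_pow, BoundedContinuousFunction.star_apply, RCLike.star_def,
          RCLike.enorm_conj]
      have h3 : ∫⁻ t, ‖r t‖ₑ ^ 2 * ∑' x, ρ x * ∑' i, ‖T x (e x i) t‖ₑ ^ 2 ∂μ =
          ∑' x, ρ x * ∑' i, ‖mulLp μ (star r) (T x (e x i))‖ₑ ^ 2 := by
        simp only [← ENNReal.tsum_mul_left, ← h2]
        have h4 : ∀ x i, AEMeasurable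
            (fun t => ‖r t‖ₑ ^ 2 * (ρ x * ‖T x (e x i) t‖ₑ ^ 2)) μ := fun x i =>
          hr.aemeasurable.mul ((hmeas x i).const_mul _)
        have h5 : ∀ x, AEMeasurable
            (fun t => ∑' i, ‖r t‖ₑ ^ 2 * (ρ x * ‖T x (e x i) t‖ₑ ^ 2)) μ := fun x =>
          AEMeasurable.tsum fun i => h4 x i
        rw [lintegral_tsum h5]
        refine tsum_congr fun x => ?_
        rw [lintegral_tsum (h4 x)]
        refine tsum_congr fun i => ?_
        have h6 : AEMeasurable (fun t => ‖r t‖ₑ ^ 2 * ‖T x (e x i) t‖ₑ ^ 2) μ :=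
          hr.aemeasurable.mul (hmeas x i)
        rw [← lintegral_const_mul'' _ h6]
        exact lintegral_congr fun t => mul_left_comm _ _ _
      rw [h3]
      refine ne_top_of_le_ne_top (b := ENNReal.ofReal (C ^ 2) *
        ∑' x, ρ x * ENNReal.ofReal (ℓ x)) (ENNReal.mul_ne_top ENNReal.ofReal_ne_top hρ) ?_
      rw [← ENNReal.tsum_mul_left]
      refine ENNReal.tsum_le_tsum fun x => ?_
      rw [mul_left_comm]
      gcongr
      exact hS x
    have hm : AEMeasurable (fun t => ‖r t‖ₑ ^ 2 * ∑' x, ρ x * ∑' i, ‖T x (e x i) t‖ₑ ^ 2) μ :=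
      hr.aemeasurable.mul (AEMeasurable.tsum fun x =>
        (AEMeasurable.tsum fun i => hmeas x i).const_mul _)
    filter_upwards [ae_lt_top' hm h1] with t ht h
    have hrt : ‖r t‖ₑ ^ 2 ≠ 0 := by
      refine pow_ne_zero _ (enorm_ne_zero.2 ?_)
      exact inv_ne_zero (ofReal_sub_ne_zero Nonreal.I.2 t)
    rw [h, ENNReal.mul_top hrt] at ht
    exact lt_irrefl _ ht
  classical
  -- The value `0` is taken only on a null set, where some coefficient family is not square
  -- summable.
  set φ : ℝ → ∀ x, EdgeL2 (ℓ x) := fun t x =>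
    if h : ∑' i, ‖T x (e x i) t‖ₑ ^ 2 ≠ ∞ then ((e x).exists_inner_eq h).choose else 0
  have hφ : ∀ᵐ t ∂μ, ∀ x, (∀ i, ⟪φ t x, e x i⟫ = T x (e x i) t) ∧
      ‖φ t x‖ₑ ^ 2 = ∑' i, ‖T x (e x i) t‖ₑ ^ 2 := by
    filter_upwards [hfin] with t ht x
    have h : ∑' i, ‖T x (e x i) t‖ₑ ^ 2 ≠ ∞ := fun h => by
      refine ENNReal.ne_top_of_tsum_ne_top ht x ?_
      rw [h, ENNReal.mul_top (hρ0 x)]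
    simp only [φ]
    rw [dif_pos h]
    exact ((e x).exists_inner_eq h).choose_spec
  refine ⟨φ, fun x ψ => ?_, ?_, ?_⟩
  · refine ae_eq_inner_of_hilbertBasis (e x) (T x) (φ := fun t => φ t x) ?_ ψ
    filter_upwards [hφ] with t ht
    exact (ht x).1
  · filter_upwards [hfin, hφ] with t ht h
    simpa only [(h _).2] using ht
  -- `Z` is the set where all coefficients vanish. Its indicator is annihilated by the isometry `W`,
  -- hence is zero in `L²(μ)`.
  · set Z : Set ℝ := ⋂ x, ⋂ i, {t | T x (e x i) t = 0}
    have hZ : MeasurableSet Z := MeasurableSet.iInter fun x => MeasurableSet.iInter fun i =>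
      (Lp.stronglyMeasurable (T x (e x i))).measurable (measurableSet_singleton 0)
    set g := indicatorConstLp 2 hZ (measure_ne_top μ Z) (1 : ℂ)
    have h1 : W g = 0 := by
      ext1
      funext x
      have h2 : (e x).repr (W g x) = 0 := by
        ext1
        funext i
        have h3 : ⟪lp.single 2 x (e x i), W.toContinuousLinearMap g⟫ = ⟪e x i, W g x⟫ :=
          lp.inner_single_left x (e x i) (W g)
        rw [(e x).repr_apply_apply, ← h3]
        change _ = (0 : ℂ)
        rw [← ContinuousLinearMap.adjoint_inner_left, ← hT, ← inner_conj_symm,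
          L2.inner_indicatorConstLp_eq_setIntegral_inner, setIntegral_eq_zero_of_forall_eq_zero,
          map_zero]
        intro t ht
        rw [show T x (e x i) t = 0 from mem_iInter.1 (mem_iInter.1 ht x) i, inner_zero_right]
      simpa using h2
    have h2 : μ Z = 0 := by
      have h3 : g = 0 := by
        have := W.norm_map g
        rwa [h1, norm_zero, eq_comm, norm_eq_zero] at this
      have h4 : ‖g‖ = 0 := by rw [h3, norm_zero]
      rw [norm_indicatorConstLp (by norm_num) (by norm_num), norm_one, one_mul] at h4
      have h5 := (Real.rpow_eq_zero measureReal_nonneg (by norm_num)).1 h4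
      exact (measureReal_eq_zero_iff (measure_ne_top _ _)).1 h5
    filter_upwards [measure_eq_zero_iff_ae_notMem.1 h2, hφ] with t ht h
    by_contra! h6
    refine ht (mem_iInter.2 fun x => mem_iInter.2 fun i => ?_)
    change T x (e x i) t = 0
    rw [← (h x).1 i, h6 x, inner_zero_left]

end functionals

/-! ### The weak eigenvalue equation. -/

section functionals

variable {X : Type*} {ℓ : X → ℝ} {μ : Measure ℝ}

theorem lp.eq_sum_single [DecidableEq X] {H : X → Type*} [∀ x, NormedAddCommGroup (H x)]
    (s : Finset X) (ψ : lp H 2) (hψ : ∀ x ∉ s, ψ x = 0) : ψ = ∑ x ∈ s, lp.single 2 x (ψ x) := by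
  ext1
  funext y
  rw [lp.coeFn_sum, Finset.sum_apply]
  by_cases hy : y ∈ s
  · rw [Finset.sum_eq_single_of_mem y hy fun x _ hxy => lp.single_apply_ne _ _ _ hxy.symm,
      lp.single_apply_self]
  · rw [hψ y hy, Finset.sum_eq_zero fun x hx =>
      lp.single_apply_ne 2 x (ψ x) fun h : y = x => hy (h ▸ hx)]

theorem ae_eq_sum_inner [DecidableEq X] {T : lp (fun x => EdgeL2 (ℓ x)) 2 →L[ℂ] Lp ℂ 2 μ}
    {φ : ℝ → ∀ x, EdgeL2 (ℓ x)}
    (hφ : ∀ x (ψ : EdgeL2 (ℓ x)), ∀ᵐ t ∂μ, T (lp.single 2 x ψ) t = ⟪φ t x, ψ⟫) (s : Finset X)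
    (ψ : lp (fun x => EdgeL2 (ℓ x)) 2) (hψ : ∀ x ∉ s, ψ x = 0) :
    ∀ᵐ t ∂μ, T ψ t = ∑ x ∈ s, ⟪φ t x, ψ x⟫ := by
  have h1 : T ψ = ∑ x ∈ s, T (lp.single 2 x (ψ x)) := by
    rw [← map_sum, ← lp.eq_sum_single s ψ hψ]
  have h2 : ∀ᵐ t ∂μ, ∀ x ∈ s, T (lp.single 2 x (ψ x)) t = ⟪φ t x, ψ x⟫ := by
    rw [Finset.eventually_all]
    exact fun x _ => hφ x (ψ x)
  filter_upwards [h2, Lp.coeFn_fun_finsetSum s fun x => T (lp.single 2 x (ψ x))] with t h3 h4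
  rw [h1, h4]
  exact Finset.sum_congr rfl h3

/-- The functionals diagonalizing a relation satisfy the eigenvalue equation weakly. -/
theorem ae_weak_eigenvector [Countable X] [DecidableEq X]
    {T : lp (fun x => EdgeL2 (ℓ x)) 2 →L[ℂ] Lp ℂ 2 μ} {φ : ℝ → ∀ x, EdgeL2 (ℓ x)}
    (hφ : ∀ x (ψ : EdgeL2 (ℓ x)), ∀ᵐ t ∂μ, T (lp.single 2 x ψ) t = ⟪φ t x, ψ⟫)
    {G : Set (lp (fun x => EdgeL2 (ℓ x)) 2 × lp (fun x => EdgeL2 (ℓ x)) 2)}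
    (hT : ∀ ψ η, (ψ, η) ∈ G → ∀ᵐ t ∂μ, T η t = t * T ψ t) :
    ∀ᵐ t ∂μ, ∀ s : Finset X, ∀ F ∈ G, (∀ x ∉ s, F.1 x = 0 ∧ F.2 x = 0) →
      ∑ x ∈ s, ⟪φ t x, F.2 x⟫ = t * ∑ x ∈ s, ⟪φ t x, F.1 x⟫ := by
  have : Fact ((2 : ℝ≥0∞) ≠ ∞) := ⟨by norm_num⟩
  have : ∀ x, SecondCountableTopology (EdgeL2 (ℓ x)) := fun x => inferInstance
  rw [ae_all_iff]
  intro s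
  have : SecondCountableTopology (∀ x : s, EdgeL2 (ℓ x) × EdgeL2 (ℓ x)) := inferInstance
  set r : lp (fun x => EdgeL2 (ℓ x)) 2 × lp (fun x => EdgeL2 (ℓ x)) 2 →
    ∀ x : s, EdgeL2 (ℓ x) × EdgeL2 (ℓ x) := fun F x => (F.1 x, F.2 x)
  -- The exceptional null set depends on `F`. For each of the countably many finite sets `s`,
  -- separability of the space of restrictions to `s` reduces to countably many `F`, and continuity
  -- covers the rest.
  set J := r '' {F | F ∈ G ∧ ∀ x ∉ s, F.1 x = 0 ∧ F.2 x = 0}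
  obtain ⟨D, hDJ, hDc, hD⟩ :=
    (TopologicalSpace.IsSeparable.of_separableSpace J).exists_countable_dense_subset
  have h1 : ∀ᵐ t ∂μ, ∀ j ∈ D, ∑ x : s, ⟪φ t x, (j x).2⟫ = t * ∑ x : s, ⟪φ t x, (j x).1⟫ := by
    rw [ae_ball_iff hDc]
    intro j hj
    obtain ⟨F, ⟨hF, hs⟩, rfl⟩ := hDJ hj
    filter_upwards [hT F.1 F.2 hF, ae_eq_sum_inner hφ s F.1 fun x hx => (hs x hx).1,
      ae_eq_sum_inner hφ s F.2 fun x hx => (hs x hx).2] with t h2 h3 h4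
    rw [h3, h4] at h2
    simp only [r]
    rw [Finset.sum_coe_sort s fun x => ⟪φ t x, F.2 x⟫,
      Finset.sum_coe_sort s fun x => ⟪φ t x, F.1 x⟫]
    exact h2
  filter_upwards [h1] with t ht F hF hs
  have h2 : r F ∈ closure D := hD ⟨F, ⟨hF, hs⟩, rfl⟩
  have h3 : IsClosed {j : ∀ x : s, EdgeL2 (ℓ x) × EdgeL2 (ℓ x) |
      ∑ x : s, ⟪φ t x, (j x).2⟫ = t * ∑ x : s, ⟪φ t x, (j x).1⟫} :=
    isClosed_eq (by fun_prop) (by fun_prop)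
  have h4 : ∑ x : s, ⟪φ t x, F.2 x⟫ = t * ∑ x : s, ⟪φ t x, F.1 x⟫ :=
    closure_minimal (fun j hj => ht j hj) h3 h2
  rwa [Finset.sum_coe_sort s fun x => ⟪φ t x, F.2 x⟫,
    Finset.sum_coe_sort s fun x => ⟪φ t x, F.1 x⟫] at h4

end functionals

/-! ### Generalized eigenfunctions on line-like graphs and their growth. -/

namespace LineLike

variable {b : ℕ → ℕ} {Γ : ℕ → DecorationGraph} {n : ℕ} {ℓm ℓp κ qm qp : ℝ}

/-- The weights of the edges of a line-like graph. -/
def weight (x : GraphEdge Γ n) : ℝ≥0∞ := ENNReal.ofReal ((((x.1 : ℕ) : ℝ)⁻¹) ^ 2)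

theorem weight_ne_zero (x : GraphEdge Γ n) : weight x ≠ 0 := by
  have h : (0 : ℝ) < (x.1 : ℕ) := by exact_mod_cast (Nat.zero_le n).trans_lt x.1.2
  rw [weight, Ne, ENNReal.ofReal_eq_zero, not_le]
  positivity

/-- Each decoration graph has volume at most `ℓp`, and `∑ k⁻²` converges. -/
theorem tsum_weight_ne_top (hU : UniformDecoration Γ ℓm ℓp κ qm qp) :
    ∑' x : GraphEdge Γ n, weight x * ENNReal.ofReal ((Γ x.1).len x.2) ≠ ∞ := by
  rw [ENNReal.tsum_sigma']
  have h1 : ∑' k : Ioi n, ENNReal.ofReal ((((k : ℕ) : ℝ)⁻¹) ^ 2) ≠ ∞ := by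
    have h2 : Summable fun k : ℕ => ((k : ℝ)⁻¹) ^ 2 := by
      simpa only [inv_pow] using Real.summable_nat_pow_inv.2 one_lt_two
    exact (h2.subtype (Ioi n)).tsum_ofReal_ne_top
  refine ne_top_of_le_ne_top (ENNReal.mul_ne_top h1 (b := ENNReal.ofReal ℓp)
    ENNReal.ofReal_ne_top) ?_
  rw [← ENNReal.tsum_mul_right]
  refine ENNReal.tsum_le_tsum fun k => ?_
  change ∑' e, ENNReal.ofReal ((((k : ℕ) : ℝ)⁻¹) ^ 2) * ENNReal.ofReal ((Γ k).len e) ≤ _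
  rw [ENNReal.tsum_mul_left, tsum_fintype,
    ← ENNReal.ofReal_sum_of_nonneg fun e _ => ((Γ k).len_pos e).le]
  gcongr
  exact hU.volume_le k (Nat.one_le_of_lt k.2)

/-- Almost all points of the spectrum admit generalized eigenfunctions of polynomial growth. -/
theorem ae_exists_isGeneralizedEigenfunction (hb : ∀ k, n < k → 1 ≤ b k)
    (hU : UniformDecoration Γ ℓm ℓp κ qm qp) (hℓm : 0 < ℓm) (hℓp : 0 < ℓp) (hκ : 0 < κ)
    {f : L2 Γ n} {μ : Measure ℝ} (hμ : IsSpectralMeasureAt (hamiltonian b Γ n) f μ) :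
    ∀ᵐ lam ∂μ, ∃ φ u u' a, IsGeneralizedEigenfunction b Γ n lam φ u u' a ∧
      HasSum (fun x : GraphEdge Γ n => (‖φ x‖ / (x.1 : ℕ)) ^ 2) 1 := by
  classical
  have := hμ.finite
  have hG := isSelfAdjointRelation_hamiltonianGraph (b := b) (n := n) hb hU hℓm hℓp hκ
  obtain ⟨W, hW⟩ := hμ.exists_isometry (by rw [graph_hamiltonian]; exact hG)
  simp only [graph_hamiltonian] at hW
  obtain ⟨C, hC0, hC⟩ := exists_sup_bound (b := b) (n := n) hb hU hℓm hℓp hκ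
  -- The pair from `map_mulLp_mem` has components of norm at most `‖g‖` and `2 * ‖g‖`, since the
  -- kernel at `I` is bounded by `1`; this gives the factor `3`.
  have hsup : ∀ g (x : GraphEdge Γ n), ∀ᵐ s ∂(edgeMeasure ((Γ x.1).len x.2)),
      ‖W (mulLp μ Nonreal.I.kernel g) x s‖ ≤ C * 3 * ‖g‖ := by
    intro g x
    filter_upwards [hC _ (hG.map_mulLp_mem hW g) x] with s hs
    refine hs.trans ?_
    rw [mul_assoc]
    refine mul_le_mul_of_nonneg_left ?_ hC0
    have h1 : ‖mulLp μ Nonreal.I.kernel g‖ ≤ ‖g‖ := (norm_mulLp_le _ _).trans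
      (mul_le_of_le_one_left (norm_nonneg _) Nonreal.norm_kernel_I_le)
    have h2 := norm_add_le g (Complex.I • mulLp μ Nonreal.I.kernel g)
    rw [norm_smul, Complex.norm_I, one_mul] at h2
    change ‖W _‖ + ‖W _‖ ≤ _
    rw [W.norm_map, W.norm_map]
    linarith
  obtain ⟨φ, hφ, hfin, hne⟩ := exists_generalized_functionals W hsup weight_ne_zero
    (tsum_weight_ne_top hU)
  filter_upwards [hfin, hne, ae_weak_eigenvector hφ (G := hamiltonianGraph b Γ n) hW]
    with t h1 h2 h3
  have hk : ∀ x : GraphEdge Γ n, (0 : ℝ) < (x.1 : ℕ) := fun x => by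
    exact_mod_cast (Nat.zero_le n).trans_lt x.1.2
  have h4 : ∀ x : GraphEdge Γ n, weight x * ‖φ t x‖ₑ ^ 2 =
      ENNReal.ofReal ((‖φ t x‖ / (x.1 : ℕ)) ^ 2) := fun x => by
    rw [weight, enorm_sq_eq_ofReal, ← ENNReal.ofReal_mul (by positivity), div_pow, div_eq_inv_mul,
      inv_pow]
  simp only [h4] at h1
  have h5 : Summable fun x : GraphEdge Γ n => (‖φ t x‖ / (x.1 : ℕ)) ^ 2 := by
    refine (ENNReal.summable_toReal h1).congr fun x => ?_
    rw [ENNReal.toReal_ofReal (by positivity)]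
  obtain ⟨x₀, hx₀⟩ := h2
  set N := ∑' x : GraphEdge Γ n, (‖φ t x‖ / (x.1 : ℕ)) ^ 2
  have hN : 0 < N := h5.tsum_pos (fun x => by positivity) x₀ (by
    have := hk x₀
    have := norm_pos_iff.2 hx₀
    positivity)
  set c : ℝ := (Real.sqrt N)⁻¹
  have hc : 0 < c := inv_pos.2 (Real.sqrt_pos.2 hN)
  -- The functionals `φ t` stand in the first slot of the inner product, so the weak equation is
  -- conjugated; this is harmless because `t` and `c` are real.
  obtain ⟨u, u', a, h⟩ := exists_isH2_of_weak hb (g := fun x => (c : ℂ) • φ t x)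
    (h := fun x => (t : ℂ) • ((c : ℂ) • φ t x)) fun s F hF hs => by
      have h6 := congrArg conj (h3 s F hF hs)
      simp only [map_mul, map_sum, inner_conj_symm, Complex.conj_ofReal] at h6
      simp only [inner_smul_right, ← Finset.mul_sum]
      rw [h6]
      ring
  refine ⟨_, u, u', a, h, ?_⟩
  have h6 : ∀ x : GraphEdge Γ n, (‖(c : ℂ) • φ t x‖ / (x.1 : ℕ)) ^ 2 =
      N⁻¹ * (‖φ t x‖ / (x.1 : ℕ)) ^ 2 := fun x => by
    rw [norm_smul, Complex.norm_real, Real.norm_of_nonneg hc.le, mul_div_assoc, mul_pow, inv_pow,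
      Real.sq_sqrt hN.le]
  simp only [h6]
  have := h5.hasSum.mul_left N⁻¹
  rwa [inv_mul_cancel₀ hN.ne'] at this

/-- The normalization bounds the norm on the edge at `o₀` of `G_{k+1}` by `k + 1`, and the trace
estimate is applied with second derivative `-lam * φ`. Finally `k + 1 ≤ 2 * k` because `1 ≤ k`. -/
theorem IsGeneralizedEigenfunction.norm_le (hU : UniformDecoration Γ ℓm ℓp κ qm qp)
    (hℓm : 0 < ℓm) (hℓp : 0 < ℓp) (hκ : 0 < κ) {lam : ℝ}
    {φ : ∀ x : GraphEdge Γ n, EdgeL2 ((Γ x.1).len x.2)} {u u' : ∀ k, (Γ k).E → ℝ → ℂ}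
    {a : ∀ k, (Γ k).V → ℂ} (h : IsGeneralizedEigenfunction b Γ n lam φ u u' a)
    (hφ : HasSum (fun x : GraphEdge Γ n => (‖φ x‖ / (x.1 : ℕ)) ^ 2) 1) {k : ℕ} (hnk : n ≤ k)
    (hk : 1 ≤ k) :
    ‖a (k + 1) (Γ (k + 1)).o₀‖ ≤ traceConst (κ * ℓm) ℓp * (1 + |lam|) * 2 * k ∧
      ‖(Γ (k + 1)).dag₀ (u' (k + 1))‖ ≤ traceConst (κ * ℓm) ℓp * (1 + |lam|) * 2 * k := by
  have hK : 0 ≤ traceConst (κ * ℓm) ℓp := traceConst_nonneg hℓp.le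
  obtain ⟨e, he⟩ := hU.exists_first_edge hℓm hκ (Nat.le_add_left 1 k)
  have h1 := he _ _ _ _ _ (h.deco ⟨k + 1, Nat.lt_succ_of_le hnk⟩)
  set y : GraphEdge Γ n := ⟨⟨k + 1, Nat.lt_succ_of_le hnk⟩, e⟩
  have h2 : ‖φ y‖ ≤ k + 1 := by
    have h3 := le_hasSum hφ y fun x _ => by positivity
    rw [sq_le_one_iff₀ (by positivity)] at h3
    have h4 : (((y.1 : ℕ) : ℝ)) = k + 1 := by simp [y]
    rw [h4, div_le_one (by positivity)] at h3
    exact h3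
  have h3 : ‖φ y‖ + ‖-((lam : ℂ) • φ y)‖ ≤ (1 + |lam|) * 2 * k := by
    have hk' : (1 : ℝ) ≤ k := by exact_mod_cast hk
    rw [norm_neg, norm_smul, Complex.norm_real, Real.norm_eq_abs]
    calc ‖φ y‖ + |lam| * ‖φ y‖ = (1 + |lam|) * ‖φ y‖ := by ring
      _ ≤ (1 + |lam|) * (2 * k) := by gcongr; linarith
      _ = _ := by ring
  have h4 := mul_le_mul_of_nonneg_left h3 hK
  rw [← mul_assoc, ← mul_assoc] at h4
  exact ⟨h1.1.trans h4, h1.2.trans h4⟩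

end LineLike

end

theorem mainTheorem7 :
    (∀ (V : Type*) (b : ℕ → ℕ) (T : RadialTree V b) (Γ : ℕ → DecorationGraph),
      b 0 = 1 → (∀ n, 1 ≤ b n) →
      UnitarilyEquivalent (T.hamiltonian Γ)
        (directSumOperator fun i : Σ m : ℕ, Fin (reductionMultiplicity b m) =>
          LineLike.hamiltonian b Γ i.1) ∧
      ((∃ ℓm ℓp κ qm qp : ℝ, 0 < ℓm ∧ 0 < ℓp ∧ 0 < κ ∧ κ ≤ 1 ∧
          UniformDecoration Γ ℓm ℓp κ qm qp) →
        IsSelfAdjoint (T.hamiltonian Γ) ∧ ∀ m, IsSelfAdjoint (LineLike.hamiltonian b Γ m))) ∧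
    (∀ ℓm ℓp κ qm qp : ℝ, 0 < ℓm → 0 < ℓp → 0 < κ → κ ≤ 1 →
      ∃ C : ℝ → ℝ, ∀ (b : ℕ → ℕ) (Γ : ℕ → DecorationGraph),
        (∀ n, 1 ≤ b n) → UniformDecoration Γ ℓm ℓp κ qm qp →
        ∀ (m : ℕ) (f : LineLike.L2 Γ m) (μ : MeasureTheory.Measure ℝ),
          IsSpectralMeasureAt (LineLike.hamiltonian b Γ m) f μ →
          ∀ᵐ lam ∂μ, ∃ φ u u' a,
            LineLike.IsGeneralizedEigenfunction b Γ m lam φ u u' a ∧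
            HasSum (fun x : LineLike.GraphEdge Γ m => (‖φ x‖ / (x.1 : ℕ)) ^ 2) 1 ∧
            ∀ k, m ≤ k → 1 ≤ k →
              ‖a (k + 1) (Γ (k + 1)).o₀‖ ≤ C lam * k ∧
              ‖(Γ (k + 1)).dag₀ (u' (k + 1))‖ ≤ C lam * k) := by
  refine ⟨fun V b T Γ hb0 hb => ?_, fun ℓm ℓp κ qm qp hℓm hℓp hκ hκ1 => ?_⟩
  · have hequiv := T.unitarilyEquivalent_hamiltonian Γ hb0 hb
    refine ⟨hequiv, ?_⟩
    rintro ⟨ℓm, ℓp, κ, qm, qp, hℓm, hℓp, hκ, -, hU⟩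
    have hline : ∀ m, IsSelfAdjointRelation (LineLike.hamiltonian b Γ m).graph := fun m => by
      rw [LineLike.graph_hamiltonian]
      exact LineLike.isSelfAdjointRelation_hamiltonianGraph (fun k _ => hb k) hU hℓm hℓp hκ
    exact ⟨isSelfAdjoint_of_graph (isSelfAdjointRelation_of_unitarilyEquivalent hequiv
      (isSelfAdjointRelation_directSum fun i => hline i.1)),
      fun m => isSelfAdjoint_of_graph (hline m)⟩
  · refine ⟨fun lam => traceConst (κ * ℓm) ℓp * (1 + |lam|) * 2,
      fun b Γ hb hU m f μ hμ => ?_⟩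
    filter_upwards [LineLike.ae_exists_isGeneralizedEigenfunction (fun k _ => hb k) hU hℓm hℓp hκ
      hμ] with lam ⟨φ, u, u', a, h, hsum⟩
    exact ⟨φ, u, u', a, h, hsum, fun k hmk hk => h.norm_le hU hℓm hℓp hκ hsum hmk hk⟩
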